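/- All graphs are finite and undirected, without multiple edges. Loops are allowed, except that $G$ and $H$ below are simple graphs. Let $\hom(F,G)$ be the number of homomorphisms from $F$ to $G$. Fix an integer $t\ge 1$. **Bilabelled graphs.** A $(t,t)$-bilabelled graph is $\boldsymbol F=(F,\boldsymbol u,\boldsymbol v)$ with $\boldsymbol u,\boldsymbol v\in V(F)^t$; it is *atomic* if every vertex of $F$ occurs in $\boldsymbol u$ or $\boldsymbol v$. *Series composition* $\boldsymbol F\cdot\boldsymbol F'$ identifies $\boldsymbol v_i$ with $\boldsymbol u'_i$ for all $i$ in the disjoint union and keeps the labels $\boldsymbol u,\boldsymbol v'$. *Parallel composition* $\boldsymbol F\odot\boldsymbol F'$ identifies $\boldsymbol u_i$ with $\boldsymbol u'_i$ and $\boldsymbol v_i$ with $\boldsymbol v'_i$ for all $i$ and keeps the labels $\boldsymbol u,\boldsymbol v$. The group $\mathfrak S_{2t}$ acts by permuting the $2t$ labels. Let $\mathcal L_t$ be the class of graphs underlying (up to isomorphism) the bilabelled graphs generated from atomic ones by parallel composition with atomic graphs, series composition and label permutations, together with the graph without vertices; $\mathcal L_t^+$ is defined likewise with arbitrary parallel compositions.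 The homomorphism tensor $\boldsymbol F_G\in\mathbb C^{V(G)^t\times V(G)^t}$ has as $(\boldsymbol x,\boldsymbol y)$ entry the number of homomorphisms $h\colon F\to G$ with $h(\boldsymbol u)=\boldsymbol x$ and $h(\boldsymbol v)=\boldsymbol y$. For $A\in\mathbb C^{V^t\times V^t}$ and $\sigma\in\mathfrak S_{2t}$, let $A^\sigma(w_1\dots w_t,w_{t+1}\dots w_{2t})=A(w_{\sigma^{-1}(1)}\dots w_{\sigma^{-1}(t)},w_{\sigma^{-1}(t+1)}\dots w_{\sigma^{-1}(2t)})$. Write $J$ for all-ones matrices and $\odot$ also for the entrywise product of matrices. **Theorem.** For every $t\ge1$, the class $\mathcal L_t$ is minor-closed, every graph in $\mathcal L_t$, and even every graph in $\mathcal L_t^+$, has treewidth at most $3t-1$, and for all simple graphs $G,H$ the following are equivalent. 1. $G\simeq_t^{\mathrm L}H$, i.e. the level-$t$ Lasserre relaxation for graph isomorphism is feasible: there are reals $y_I$, for $I\subseteq V(G)\times V(H)$ with $|I|\le 2t$, such that the matrix $(y_{I\cup K})_{|I|,|K|\le t}$ is positive semidefinite; $\sum_{h\in V(H)} y_{I\cup\{gh\}}=y_I$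 for all $|I|\le 2t-2$ and $g\in V(G)$; $\sum_{g\in V(G)} y_{I\cup\{gh\}}=y_I$ for all $|I|\le 2t-2$ and $h\in V(H)$; $y_I=0$ whenever $I$ is not a partial isomorphism; and $y_\emptyset=1$. Here $I$ is a partial isomorphism if $g=g'\Leftrightarrow h=h'$ and $gg'\in E(G)\Leftrightarrow hh'\in E(H)$ for all $gh,g'h'\in I$. 2. $G$ and $H$ are level-$t$ $\mathcal S_+$-isomorphic: there is a real positive semidefinite matrix $M$ indexed by $(V(G)\times V(H))^t$ such that, writing $M[\boldsymbol g;\boldsymbol h]=M_{g_1h_1\dots g_th_t,\;g_{t+1}h_{t+1}\dots g_{2t}h_{2t}}$ for $\boldsymbol g\in V(G)^{2t}$ and $\boldsymbol h\in V(H)^{2t}$: $\sum_{g_i\in V(G)} M[\boldsymbol g;\boldsymbol h]=\sum_{h_i\in V(H)} M[\boldsymbol g;\boldsymbol h]$ for all $i\in\{1,\dots,2t\}$ and all values of the remaining entries; $\sum_{\boldsymbol h}M[\boldsymbol g;\boldsymbol h]=1$ for all $\boldsymbol g$ and $\sum_{\boldsymbol g}M[\boldsymbol g;\boldsymbol h]=1$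 for all $\boldsymbol h$; $M[\boldsymbol g;\boldsymbol h]=0$ unless $g_i=g_j\Leftrightarrow h_i=h_j$ and $g_ig_j\in E(G)\Leftrightarrow h_ih_j\in E(H)$ for all $i,j$; and $M[\boldsymbol g;\boldsymbol h]$ is invariant under permuting the $2t$ pairs $g_ih_i$. 3. There is a level-$t$ $\mathcal S_+$-isomorphism map from $G$ to $H$: a linear map $\Phi\colon\mathbb C^{V(G)^t\times V(G)^t}\to\mathbb C^{V(H)^t\times V(H)^t}$ such that, for every $r\in\mathbb N$, $\mathrm{id}_r\otimes\Phi$ maps real positive semidefinite matrices to real positive semidefinite matrices; $\Phi(\boldsymbol A_G\odot X)=\boldsymbol A_H\odot\Phi(X)$ for all atomic $\boldsymbol A$ and all $X$; $\Phi(J)=J=\Phi^*(J)$, where $\Phi^*$ is the adjoint with respect to $\langle A,B\rangle=\operatorname{tr}(AB^*)$; and $\Phi(X^\sigma)=\Phi(X)^\sigma$ for all $X$ and $\sigma\in\mathfrak S_{2t}$. 4. $G$ and $H$ are partially $t$-equivalent. To define this, let $\widehat{\mathcal A}^t_G\subseteq\mathbb C^{V(G)^t\times V(G)^t}$ be the smallest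 unital self-adjoint matrix algebra which contains $J$ and is closed under $X\mapsto\boldsymbol A_G\odot X$ for all atomic $\boldsymbol A$ and under $X\mapsto X^\sigma$ for all $\sigma\in\mathfrak S_{2t}$. Then $G$ and $H$ are partially $t$-equivalent if $|V(G)|=|V(H)|$ and there is a vector space isomorphism $\phi\colon\widehat{\mathcal A}^t_G\to\widehat{\mathcal A}^t_H$ with $\phi(M^*)=\phi(M)^*$, $\phi(MN)=\phi(M)\phi(N)$, $\phi(I)=I$, $\phi(J)=J$, $\phi(\boldsymbol A_G)=\boldsymbol A_H$, $\phi(\boldsymbol A_G\odot M)=\boldsymbol A_H\odot\phi(M)$ and $\phi(M^\sigma)=\phi(M)^\sigma$ for all $M,N\in\widehat{\mathcal A}^t_G$, all atomic $\boldsymbol A$ and all $\sigma\in\mathfrak S_{2t}$. 5. $G$ and $H$ are homomorphism indistinguishable over $\mathcal L_t$: $\hom(F,G)=\hom(F,H)$ for all $F\in\mathcal L_t$. -/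

import Mathlib

open scoped Matrix

/-! ### Finite graphs, loops allowed -/

/-- A finite undirected graph without multiple edges, in which loops are allowed. -/
structure FGraph where
  V : Type
  finite : Finite V
  Adj : V → V → Prop
  symm : ∀ a b, Adj a b → Adj b a

namespace FGraph

/-- The simple graph obtained by forgetting the loops. -/
def toSimple (F : FGraph) : SimpleGraph F.V where
  Adj a b := a ≠ b ∧ F.Adj a b
  symm := ⟨fun _ _ h => ⟨h.1.symm, F.symm _ _ h.2⟩⟩
  loopless := ⟨fun _ h => h.1 rfl⟩

/-- Graph isomorphism. -/
def Iso (F F' : FGraph) : Prop :=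
  ∃ e : F.V ≃ F'.V, ∀ a b, F.Adj a b ↔ F'.Adj (e a) (e b)

/-- `h` is a homomorphism from `F` to the simple graph `G`. -/
def IsHom {V : Type*} (F : FGraph) (G : SimpleGraph V) (h : F.V → V) : Prop :=
  ∀ a b, F.Adj a b → G.Adj (h a) (h b)

/-- The number of homomorphisms from `F` to `G`. -/
noncomputable def homCount {V : Type*} (F : FGraph) (G : SimpleGraph V) : ℕ :=
  Nat.card {h : F.V → V // F.IsHom G h}

/-- `M` is a minor of `F`: it arises from `F` by deleting vertices, deleting edges and contracting
edges (parallel edges being merged). This is expressed by branch sets: pairwise disjoint connected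
vertex sets of `F`, one for each vertex of `M`, each of which is contracted to a single vertex. -/
def IsMinor (M F : FGraph) : Prop :=
  ∃ branch : M.V → Set F.V,
    (∀ x, (F.toSimple.induce (branch x)).Connected) ∧
    (∀ x y, x ≠ y → Disjoint (branch x) (branch y)) ∧
    (∀ x y, x ≠ y → M.Adj x y → ∃ a ∈ branch x, ∃ b ∈ branch y, F.Adj a b) ∧
    (∀ x, M.Adj x x → ∃ a ∈ branch x, F.Adj a a)

/-- `β` is a `T`-decomposition of `F`. -/
structure IsDecomposition (F : FGraph) {N : Type} (T : SimpleGraph N) (β : N → Set F.V) :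
    Prop where
  cover : ∀ a : F.V, ∃ x, a ∈ β x
  edge : ∀ a b, F.Adj a b → ∃ x, a ∈ β x ∧ b ∈ β x
  connected : ∀ a : F.V, (T.induce {x | a ∈ β x}).Connected

/-- `F` has treewidth at most `k`: there is a decomposition of `F` over a finite tree, all of whose
bags have at most `k + 1` elements. -/
def TreewidthLE (F : FGraph) (k : ℕ) : Prop :=
  ∃ (N : Type) (_ : Finite N) (T : SimpleGraph N) (β : N → Set F.V),
    T.IsTree ∧ F.IsDecomposition T β ∧ ∀ x, (β x).ncard ≤ k + 1

end FGraph

/-- A class of graphs is minor-closed if it contains every minor of each of its members. -/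
def MinorClosed (C : FGraph → Prop) : Prop :=
  ∀ F, C F → ∀ M : FGraph, M.IsMinor F → C M

/-- `G` and `H` are homomorphism indistinguishable over the class `C`. -/
def HomIndistinguishable {V W : Type*} (C : FGraph → Prop) (G : SimpleGraph V)
    (H : SimpleGraph W) : Prop :=
  ∀ F, C F → F.homCount G = F.homCount H

/-! ### Bilabelled graphs -/

/-- A `(t,t)`-bilabelled graph. The in-labels are `lab (Sum.inl i)`, the out-labels are
`lab (Sum.inr i)`; the index set `Fin t ⊕ Fin t` plays the role of `{1, …, 2t}`. -/
structure BiGraph (t : ℕ) where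
  graph : FGraph
  lab : Fin t ⊕ Fin t → graph.V

namespace BiGraph

variable {t : ℕ}

/-- Every vertex is labelled. -/
def IsAtomic (F : BiGraph t) : Prop := Function.Surjective F.lab

/-- Adjacency in the disjoint union of two graphs. -/
def unionAdj (F F' : FGraph) : F.V ⊕ F'.V → F.V ⊕ F'.V → Prop
  | Sum.inl a, Sum.inl b => F.Adj a b
  | Sum.inr a, Sum.inr b => F'.Adj a b
  | _, _ => False

lemma unionAdj_symm (F F' : FGraph) (a b : F.V ⊕ F'.V) (h : unionAdj F F' a b) :
    unionAdj F F' b a := by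
  rcases a with a | a <;> rcases b with b | b
  · exact F.symm _ _ h
  · exact h
  · exact h
  · exact F'.symm _ _ h

/-- The graph obtained from the disjoint union of `F` and `F'` by identifying the vertices related
by (the equivalence relation generated by) `r`. Parallel edges are merged, loops are kept. -/
def glue (F F' : FGraph) (r : F.V ⊕ F'.V → F.V ⊕ F'.V → Prop) : FGraph where
  V := Quot r
  finite := by
    have := F.finite
    have := F'.finite
    exact Finite.of_surjective (Quot.mk r) Quot.mk_surjective
  Adj x y := ∃ a b, Quot.mk r a = x ∧ Quot.mk r b = y ∧ unionAdj F F' a b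
  symm := by
    rintro x y ⟨a, b, ha, hb, h⟩
    exact ⟨b, a, hb, ha, unionAdj_symm F F' a b h⟩

/-- Series composition identifies the `i`-th out-label of `F` with the `i`-th in-label of `F'`. -/
def seriesRel (F F' : BiGraph t) (a b : F.graph.V ⊕ F'.graph.V) : Prop :=
  ∃ i : Fin t, a = Sum.inl (F.lab (Sum.inr i)) ∧ b = Sum.inr (F'.lab (Sum.inl i))

/-- Parallel composition identifies corresponding in-labels and corresponding out-labels. -/
def parallelRel (F F' : BiGraph t) (a b : F.graph.V ⊕ F'.graph.V) : Prop :=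
  ∃ i : Fin t ⊕ Fin t, a = Sum.inl (F.lab i) ∧ b = Sum.inr (F'.lab i)

/-- Series composition `F · F'`. -/
def series (F F' : BiGraph t) : BiGraph t where
  graph := glue F.graph F'.graph (seriesRel F F')
  lab := Sum.elim
    (fun i => Quot.mk _ (Sum.inl (F.lab (Sum.inl i))))
    (fun i => Quot.mk _ (Sum.inr (F'.lab (Sum.inr i))))

/-- Parallel composition `F ⊙ F'`. -/
def parallel (F F' : BiGraph t) : BiGraph t where
  graph := glue F.graph F'.graph (parallelRel F F')
  lab := fun i => Quot.mk _ (Sum.inl (F.lab i))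

/-- The action of the symmetric group on the `2t` labels. -/
def permute (F : BiGraph t) (σ : Equiv.Perm (Fin t ⊕ Fin t)) : BiGraph t where
  graph := F.graph
  lab := F.lab ∘ σ

/-- The homomorphism tensor of `F` for `G`. -/
noncomputable def tensor {V : Type*} (F : BiGraph t) (G : SimpleGraph V) :
    Matrix (Fin t → V) (Fin t → V) ℂ :=
  Matrix.of fun x y => (Nat.card {h : F.graph.V → V //
    F.graph.IsHom G h ∧ (∀ i, h (F.lab (Sum.inl i)) = x i) ∧
      (∀ i, h (F.lab (Sum.inr i)) = y i)} : ℂ)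

end BiGraph

/-- The bilabelled graphs generated by the atomic graphs under parallel composition with atomic
graphs, series composition and permutation of the labels. -/
inductive BiL (t : ℕ) : BiGraph t → Prop
  | atomic (A : BiGraph t) : A.IsAtomic → BiL t A
  | parallel (A F : BiGraph t) : A.IsAtomic → BiL t F → BiL t (A.parallel F)
  | series (F F' : BiGraph t) : BiL t F → BiL t F' → BiL t (F.series F')
  | permute (F : BiGraph t) (σ : Equiv.Perm (Fin t ⊕ Fin t)) : BiL t F → BiL t (F.permute σ)

/-- The bilabelled graphs generated by the atomic graphs under arbitrary parallel composition,
series composition and permutation of the labels. -/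
inductive BiLPlus (t : ℕ) : BiGraph t → Prop
  | atomic (A : BiGraph t) : A.IsAtomic → BiLPlus t A
  | parallel (F F' : BiGraph t) : BiLPlus t F → BiLPlus t F' → BiLPlus t (F.parallel F')
  | series (F F' : BiGraph t) : BiLPlus t F → BiLPlus t F' → BiLPlus t (F.series F')
  | permute (F : BiGraph t) (σ : Equiv.Perm (Fin t ⊕ Fin t)) :
      BiLPlus t F → BiLPlus t (F.permute σ)

/-- The class `L_t` of (unlabelled) graphs: the graphs isomorphic to the underlying graph of a
bilabelled graph in `BiL t`, together with the graph without vertices (which is a minor of every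
graph, and has exactly one homomorphism to every graph). -/
def LClass (t : ℕ) (F : FGraph) : Prop :=
  IsEmpty F.V ∨ ∃ B : BiGraph t, BiL t B ∧ F.Iso B.graph

/-- The class `L_t^+` of (unlabelled) graphs, with the same convention. -/
def LPlusClass (t : ℕ) (F : FGraph) : Prop :=
  IsEmpty F.V ∨ ∃ B : BiGraph t, BiLPlus t B ∧ F.Iso B.graph

/-! ### The Lasserre relaxation -/

/-- `I` is a partial isomorphism. -/
def IsPartialIso {V W : Type*} (G : SimpleGraph V) (H : SimpleGraph W)
    (I : Finset (V × W)) : Prop :=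
  ∀ p ∈ I, ∀ q ∈ I, (p.1 = q.1 ↔ p.2 = q.2) ∧ (G.Adj p.1 q.1 ↔ H.Adj p.2 q.2)

/-- `y` is a solution to the level-`t` Lasserre relaxation for graph isomorphism. Only the values
`y I` with `I.card ≤ 2 * t` are variables of the system; the other values are irrelevant. -/
structure IsLasserreSolution {V W : Type*} [Fintype V] [Fintype W] [DecidableEq V] [DecidableEq W]
    (t : ℕ) (G : SimpleGraph V) (H : SimpleGraph W) (y : Finset (V × W) → ℝ) : Prop where
  psd : (Matrix.of fun I J : {I : Finset (V × W) // I.card ≤ t} => y (I.1 ∪ J.1)).PosSemidef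
  sum_right : ∀ I : Finset (V × W), I.card + 2 ≤ 2 * t → ∀ g : V,
    ∑ h : W, y (I ∪ {(g, h)}) = y I
  sum_left : ∀ I : Finset (V × W), I.card + 2 ≤ 2 * t → ∀ h : W,
    ∑ g : V, y (I ∪ {(g, h)}) = y I
  zero : ∀ I : Finset (V × W), I.card ≤ 2 * t → ¬ IsPartialIso G H I → y I = 0
  one : y ∅ = 1

/-- The level-`t` Lasserre relaxation is feasible. -/
def LasserreFeasible {V W : Type*} [Fintype V] [Fintype W] [DecidableEq V] [DecidableEq W]
    (t : ℕ) (G : SimpleGraph V) (H : SimpleGraph W) : Prop :=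
  ∃ y : Finset (V × W) → ℝ, IsLasserreSolution t G H y

/-! ### Level-`t` isomorphism for the family of positive semidefinite matrices -/

/-- The tuples `g` and `h` have the same relational type: corresponding pairs of entries are both
identical, both adjacent, or both distinct and non-adjacent. -/
def SameType {V W ι : Type*} (G : SimpleGraph V) (H : SimpleGraph W) (g : ι → V) (h : ι → W) :
    Prop :=
  ∀ i j, (g i = g j ↔ h i = h j) ∧ (G.Adj (g i) (g j) ↔ H.Adj (h i) (h j))

/-- The entry of `M` whose row is `g_1h_1 … g_th_t` and whose column is
`g_{t+1}h_{t+1} … g_{2t}h_{2t}`. -/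
def pairEntry {V W : Type*} {t : ℕ} (M : Matrix (Fin t → V × W) (Fin t → V × W) ℝ)
    (g : Fin t ⊕ Fin t → V) (h : Fin t ⊕ Fin t → W) : ℝ :=
  M (fun i => (g (Sum.inl i), h (Sum.inl i))) (fun i => (g (Sum.inr i), h (Sum.inr i)))

/-- `M` is a (real) positive semidefinite matrix witnessing level-`t` isomorphism. -/
structure IsSPlusIsoMatrix {V W : Type*} [Fintype V] [Fintype W] [DecidableEq V] [DecidableEq W]
    (t : ℕ) (G : SimpleGraph V) (H : SimpleGraph W)
    (M : Matrix (Fin t → V × W) (Fin t → V × W) ℝ) : Prop where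
  psd : M.PosSemidef
  sum_eq_sum : ∀ (g : Fin t ⊕ Fin t → V) (h : Fin t ⊕ Fin t → W) (i : Fin t ⊕ Fin t),
    ∑ a : V, pairEntry M (Function.update g i a) h = ∑ b : W, pairEntry M g (Function.update h i b)
  sum_right : ∀ g : Fin t ⊕ Fin t → V, ∑ h : Fin t ⊕ Fin t → W, pairEntry M g h = 1
  sum_left : ∀ h : Fin t ⊕ Fin t → W, ∑ g : Fin t ⊕ Fin t → V, pairEntry M g h = 1
  zero : ∀ (g : Fin t ⊕ Fin t → V) (h : Fin t ⊕ Fin t → W),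
    ¬ SameType G H g h → pairEntry M g h = 0
  symm : ∀ (σ : Equiv.Perm (Fin t ⊕ Fin t)) (g : Fin t ⊕ Fin t → V) (h : Fin t ⊕ Fin t → W),
    pairEntry M g h = pairEntry M (g ∘ σ) (h ∘ σ)

/-- `G` and `H` are level-`t` isomorphic for the family of real positive semidefinite matrices. -/
def SPlusIsomorphic {V W : Type*} [Fintype V] [Fintype W] [DecidableEq V] [DecidableEq W]
    (t : ℕ) (G : SimpleGraph V) (H : SimpleGraph W) : Prop :=
  ∃ M : Matrix (Fin t → V × W) (Fin t → V × W) ℝ, IsSPlusIsoMatrix t G H M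

/-! ### Isomorphism maps -/

/-- The complex matrix `X` belongs to the family of real positive semidefinite matrices. -/
def IsRealPSD {ι : Type*} (X : Matrix ι ι ℂ) : Prop :=
  ∃ Y : Matrix ι ι ℝ, Y.PosSemidef ∧ X = Y.map (fun a => (a : ℂ))

/-- The map `id_r ⊗ Φ`, applied blockwise. -/
def ampliation {ι κ : Type*} (r : ℕ) (Φ : Matrix ι ι ℂ →ₗ[ℂ] Matrix κ κ ℂ)
    (X : Matrix (Fin r × ι) (Fin r × ι) ℂ) : Matrix (Fin r × κ) (Fin r × κ) ℂ :=
  Matrix.of fun p q => Φ (Matrix.of fun i j => X (p.1, i) (q.1, j)) p.2 q.2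

/-- The adjoint `Φ^*` of `Φ` for the inner product `⟨A, B⟩ = tr (A Bᴴ)`. -/
noncomputable def hsAdjoint {ι κ : Type*} [DecidableEq ι] [Fintype κ]
    (Φ : Matrix ι ι ℂ →ₗ[ℂ] Matrix κ κ ℂ) (Y : Matrix κ κ ℂ) : Matrix ι ι ℂ :=
  Matrix.of fun i j => ∑ k, ∑ l, star (Φ (Matrix.single i j 1) k l) * Y k l

/-- The defining property of the adjoint. -/
lemma trace_hsAdjoint {ι κ : Type*} [Fintype ι] [DecidableEq ι] [Fintype κ]
    (Φ : Matrix ι ι ℂ →ₗ[ℂ] Matrix κ κ ℂ) (X : Matrix ι ι ℂ) (Y : Matrix κ κ ℂ) :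
    (Φ X * Yᴴ).trace = (X * (hsAdjoint Φ Y)ᴴ).trace := by
  have hX : X = ∑ i, ∑ j, X i j • Matrix.single i j (1 : ℂ) := by
    conv_lhs => rw [Matrix.matrix_eq_sum_single X]
    simp [Matrix.smul_single]
  have h1 : ∀ k l, Φ X k l = ∑ i, ∑ j, X i j * Φ (Matrix.single i j 1) k l := by
    intro k l
    conv_lhs => rw [hX]
    simp only [map_sum, map_smul, Matrix.sum_apply, Matrix.smul_apply, smul_eq_mul]
  simp only [Matrix.trace, Matrix.diag, Matrix.mul_apply, Matrix.conjTranspose_apply, h1,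
    hsAdjoint, Matrix.of_apply, star_sum, star_mul', star_star, Finset.mul_sum, Finset.sum_mul]
  have step : ∀ f : κ → κ → ι → ι → ℂ,
      ∑ k, ∑ l, ∑ i, ∑ j, f k l i j = ∑ i, ∑ j, ∑ k, ∑ l, f k l i j := by
    intro f
    simp only [← Fintype.sum_prod_type']
    exact Finset.sum_bij' (fun x _ => (x.2.2.1, x.2.2.2, x.1, x.2.1))
      (fun x _ => (x.2.2.1, x.2.2.2, x.1, x.2.1)) (by simp) (by simp) (by simp) (by simp) (by simp)
  rw [step]
  simp only [mul_assoc]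

/-- The all-ones matrix. -/
def allOnes (ι : Type*) : Matrix ι ι ℂ := Matrix.of fun _ _ => 1

/-- The action of the symmetric group on tensors:
`A^σ (w_1 … w_t, w_{t+1} … w_{2t})` is the entry of `A` at the tuple `i ↦ w_{σ⁻¹(i)}`. -/
def permTensor {V : Type*} {t : ℕ} (σ : Equiv.Perm (Fin t ⊕ Fin t))
    (A : Matrix (Fin t → V) (Fin t → V) ℂ) : Matrix (Fin t → V) (Fin t → V) ℂ :=
  Matrix.of fun u v =>
    A (fun i => Sum.elim u v (σ⁻¹ (Sum.inl i))) (fun i => Sum.elim u v (σ⁻¹ (Sum.inr i)))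

/-- `Φ` is a level-`t` isomorphism map from `G` to `H` for the family of real positive semidefinite
matrices. -/
structure IsSPlusIsoMap {V W : Type*} [Fintype V] [Fintype W] [DecidableEq V] [DecidableEq W]
    (t : ℕ) (G : SimpleGraph V) (H : SimpleGraph W)
    (Φ : Matrix (Fin t → V) (Fin t → V) ℂ →ₗ[ℂ] Matrix (Fin t → W) (Fin t → W) ℂ) : Prop where
  completely_preserving : ∀ (r : ℕ) (X : Matrix (Fin r × (Fin t → V)) (Fin r × (Fin t → V)) ℂ),
    IsRealPSD X → IsRealPSD (ampliation r Φ X)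
  map_hadamard : ∀ A : BiGraph t, A.IsAtomic → ∀ X, Φ (A.tensor G ⊙ X) = A.tensor H ⊙ Φ X
  map_allOnes : Φ (allOnes _) = allOnes _
  adjoint_allOnes : hsAdjoint Φ (allOnes _) = allOnes _
  map_perm : ∀ (σ : Equiv.Perm (Fin t ⊕ Fin t)) (X), Φ (permTensor σ X) = permTensor σ (Φ X)

/-! ### Partially coherent algebras -/

/-- `B` is self-symmetrical and partially coherent with respect to the homomorphism tensors for `G`
of the atomic graphs. (A `StarSubalgebra` is unital and self-adjoint.) -/
structure IsPartiallyCoherent {V : Type*} [Fintype V] [DecidableEq V] (t : ℕ) (G : SimpleGraph V)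
    (B : StarSubalgebra ℂ (Matrix (Fin t → V) (Fin t → V) ℂ)) : Prop where
  allOnes_mem : allOnes _ ∈ B
  hadamard_mem : ∀ A : BiGraph t, A.IsAtomic → ∀ X ∈ B, A.tensor G ⊙ X ∈ B
  perm_mem : ∀ (σ : Equiv.Perm (Fin t ⊕ Fin t)), ∀ X ∈ B, permTensor σ X ∈ B

/-- The `t`-partially coherent algebra of `G`: the smallest self-symmetrical partially coherent
algebra. -/
noncomputable def pcAlgebra {V : Type*} [Fintype V] [DecidableEq V] (t : ℕ) (G : SimpleGraph V) :
    StarSubalgebra ℂ (Matrix (Fin t → V) (Fin t → V) ℂ) :=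
  sInf {B | IsPartiallyCoherent t G B}

lemma pcAlgebra_isPartiallyCoherent {V : Type*} [Fintype V] [DecidableEq V] (t : ℕ)
    (G : SimpleGraph V) : IsPartiallyCoherent t G (pcAlgebra t G) where
  allOnes_mem := StarSubalgebra.mem_sInf.2 fun _ hB => hB.allOnes_mem
  hadamard_mem A hA X hX := StarSubalgebra.mem_sInf.2 fun B hB =>
    hB.hadamard_mem A hA X (StarSubalgebra.mem_sInf.1 hX B hB)
  perm_mem σ X hX := StarSubalgebra.mem_sInf.2 fun B hB =>
    hB.perm_mem σ X (StarSubalgebra.mem_sInf.1 hX B hB)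

lemma tensor_mem_pcAlgebra {V : Type*} [Fintype V] [DecidableEq V] {t : ℕ} (G : SimpleGraph V)
    (A : BiGraph t) (hA : A.IsAtomic) : A.tensor G ∈ pcAlgebra t G := by
  have h := (pcAlgebra_isPartiallyCoherent t G).hadamard_mem A hA _
    (pcAlgebra_isPartiallyCoherent t G).allOnes_mem
  have e : A.tensor G ⊙ allOnes _ = A.tensor G := by
    ext x y
    simp [allOnes, Matrix.hadamard]
  rwa [e] at h

namespace pcAlgebra

variable {V : Type*} [Fintype V] [DecidableEq V] {t : ℕ} {G : SimpleGraph V}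

/-- The all-ones matrix as an element of the algebra. -/
noncomputable def ones (t : ℕ) (G : SimpleGraph V) : pcAlgebra t G :=
  ⟨allOnes _, (pcAlgebra_isPartiallyCoherent t G).allOnes_mem⟩

/-- The homomorphism tensor of an atomic graph as an element of the algebra. -/
noncomputable def atom (G : SimpleGraph V) (A : BiGraph t) (hA : A.IsAtomic) : pcAlgebra t G :=
  ⟨A.tensor G, tensor_mem_pcAlgebra G A hA⟩

/-- Schur product with the homomorphism tensor of an atomic graph, within the algebra. -/
noncomputable def schur (A : BiGraph t) (hA : A.IsAtomic) (M : pcAlgebra t G) : pcAlgebra t G :=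
  ⟨A.tensor G ⊙ M.1, (pcAlgebra_isPartiallyCoherent t G).hadamard_mem A hA M.1 M.2⟩

/-- The action of the symmetric group, within the algebra. -/
noncomputable def perm (σ : Equiv.Perm (Fin t ⊕ Fin t)) (M : pcAlgebra t G) : pcAlgebra t G :=
  ⟨permTensor σ M.1, (pcAlgebra_isPartiallyCoherent t G).perm_mem σ M.1 M.2⟩

end pcAlgebra

/-- `φ` is a partial `t`-equivalence from `G` to `H`. -/
structure IsPartialEquivalence {V W : Type*} [Fintype V] [Fintype W] [DecidableEq V]
    [DecidableEq W] (t : ℕ) (G : SimpleGraph V) (H : SimpleGraph W)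
    (φ : pcAlgebra t G ≃ₗ[ℂ] pcAlgebra t H) : Prop where
  map_star : ∀ M, φ (star M) = star (φ M)
  map_mul : ∀ M N, φ (M * N) = φ M * φ N
  map_one : φ 1 = 1
  map_atom : ∀ (A : BiGraph t) (hA : A.IsAtomic), φ (pcAlgebra.atom G A hA) = pcAlgebra.atom H A hA
  map_ones : φ (pcAlgebra.ones t G) = pcAlgebra.ones t H
  map_schur : ∀ (A : BiGraph t) (hA : A.IsAtomic) (M),
    φ (pcAlgebra.schur A hA M) = pcAlgebra.schur A hA (φ M)
  map_perm : ∀ (σ : Equiv.Perm (Fin t ⊕ Fin t)) (M),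
    φ (pcAlgebra.perm σ M) = pcAlgebra.perm σ (φ M)

/-- `G` and `H` have the same number of vertices and are partially `t`-equivalent. -/
def PartiallyEquivalent {V W : Type*} [Fintype V] [Fintype W] [DecidableEq V] [DecidableEq W]
    (t : ℕ) (G : SimpleGraph V) (H : SimpleGraph W) : Prop :=
  Fintype.card V = Fintype.card W ∧
    ∃ φ : pcAlgebra t G ≃ₗ[ℂ] pcAlgebra t H, IsPartialEquivalence t G H φ

/-! The equivalences pass through the isomorphism matrix M of condition 2, read as the Choi matrix
of a map between tensors; it is supported on pairs of tuples of the same relational type. Conditions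
2 and 3 are linked by the Choi correspondence (`exists_choi`). The equality of marginals, which is
not imposed on Φ, follows from positivity (`IsWeakIsoMatrix.isSPlusIsoMatrix`).

For 2 → 4 the key is a multiplicative domain argument (`IsCoupling.sum_mul_eq_real`): if the map
sends X to X' and its transpose sends X' back to X, then certain nonnegative quadratic forms of M
sum to zero, so certain vectors lie in the kernel of M, and the map respects multiplication by X.
The matrices X inverted in this way, with image in the algebra of H, form a partially coherent
algebra, which contains the smallest one. For 4 → 5, φ carries the tensor for G of each generated
graph to its tensor for H, and J X J is J times the sum of the entries of X, which is a homomorphism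
count.

For 5 → 2, homomorphism counts determine the inner products of tensors of generated graphs, so F_G ↦
F_H extends to an isometry of their spans. Let K be the sum of b_k ⊗ b'_k over an orthonormal basis
b_k with images b'_k. Passing to adjoints yields the zero pattern and the symmetry of K, and
expanding J yields the sums. Positivity comes from K² = D K with D positive definite: K is
symmetric, so D commutes with K, and K = K D⁻¹ K (`IsFrame.choi_posSemidef`).

Between 1 and 2, an entry of M is the value of y at the set of its 2t pairs. One direction uses
positivity to extend the summation conditions to sets of size 2t - 1 (`sum_union_eq_of_posSemidef`);
the other shows that an entry of M depends only on the set of its pairs (`eq_of_range_eq`).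

For minors, each generated graph is a spanning subgraph of a connected host, glued in the same way
from complete atomic graphs. Connectedness lets superfluous vertices be absorbed into branch sets,
so every nonempty minor is a contraction of the host with some edges dropped, and contraction is
compatible with gluing. For treewidth, the invariant is that all labels share a bag of size at most
3t. -/

/-! ### Minors -/

/-- The relation induced on a glued graph by relations on the two parts. -/
def glueHost {α β : Type} (r : α ⊕ β → α ⊕ β → Prop) (C₁ : α → α → Prop) (C₂ : β → β → Prop)
    (x y : Quot r) : Prop :=
  ∃ a b, Quot.mk r a = x ∧ Quot.mk r b = y ∧ Sum.LiftRel C₁ C₂ a b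

/-- The fibres of `q` are connected with respect to `C`. -/
def FibresConnected {α X : Type} (C : α → α → Prop) (q : α → X) : Prop :=
  ∀ a b, q a = q b → Relation.EqvGen (fun a b => C a b ∧ q a = q b) a b

/-- `q` is a contraction of connected sets for the relation `C`, and all edges of `K` come
from `C`. -/
structure IsContraction {α : Type} (C : α → α → Prop) (K : FGraph) (q : α → K.V) : Prop where
  surj : Function.Surjective q
  fibres : FibresConnected C q
  lift : ∀ x y, K.Adj x y → ∃ a b, q a = x ∧ q b = y ∧ C a b

/-- The part of a contraction `q` of a glued graph that lives on one of the two glued graphs. -/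
def contractPart {α : Type} [Finite α] (C : α → α → Prop) (hC : ∀ a b, C a b → C b a)
    (K : FGraph) (q : α → K.V) : FGraph where
  V := Quot fun a b => C a b ∧ q a = q b
  finite := Finite.of_surjective (Quot.mk _) Quot.mk_surjective
  Adj x y := ∃ a b, Quot.mk _ a = x ∧ Quot.mk _ b = y ∧ C a b ∧ K.Adj (q a) (q b)
  symm := by
    rintro x y ⟨a, b, ha, hb, h, h'⟩
    exact ⟨b, a, hb, ha, hC _ _ h, K.symm _ _ h'⟩

/-- The projection to a part of a contraction. -/
def contractMk {α : Type} [Finite α] (C : α → α → Prop) (hC : ∀ a b, C a b → C b a)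
    (K : FGraph) (q : α → K.V) (a : α) : (contractPart C hC K q).V :=
  Quot.mk _ a

lemma isContraction_contractPart {α : Type} [Finite α] (C : α → α → Prop)
    (hC : ∀ a b, C a b → C b a) (K : FGraph) (q : α → K.V) :
    IsContraction C (contractPart C hC K q) (contractMk C hC K q) where
  surj := Quot.mk_surjective
  fibres a b h := (Quot.eqvGen_exact h).mono fun _ _ h => ⟨h.1, Quot.sound h⟩
  lift := by
    rintro x y ⟨a, b, ha, hb, h, -⟩
    exact ⟨a, b, ha, hb, h⟩

/-- The map from a part of a contraction to the contraction. -/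
def contractPartMap {α : Type} [Finite α] (C : α → α → Prop) (hC : ∀ a b, C a b → C b a)
    (K : FGraph) (q : α → K.V) : (contractPart C hC K q).V → K.V :=
  Quot.lift q fun _ _ h => h.2

/-- A contraction of a glued graph is the gluing of the contractions of its parts. -/
lemma exists_equiv_glue_contractPart {ι : Type} (F₁ F₂ : FGraph) (l₁ : ι → F₁.V) (l₂ : ι → F₂.V)
    (r : F₁.V ⊕ F₂.V → F₁.V ⊕ F₂.V → Prop)
    (hr : ∀ a b, r a b ↔ ∃ i, a = Sum.inl (l₁ i) ∧ b = Sum.inr (l₂ i))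
    [Finite F₁.V] [Finite F₂.V]
    (C₁ : F₁.V → F₁.V → Prop) (hC₁ : ∀ a b, C₁ a b → C₁ b a)
    (C₂ : F₂.V → F₂.V → Prop) (hC₂ : ∀ a b, C₂ a b → C₂ b a)
    (K : FGraph) (q : Quot r → K.V) (hq : IsContraction (glueHost r C₁ C₂) K q)
    (q₁ : F₁.V → K.V) (hq₁ : ∀ a, q (Quot.mk r (Sum.inl a)) = q₁ a)
    (q₂ : F₂.V → K.V) (hq₂ : ∀ a, q (Quot.mk r (Sum.inr a)) = q₂ a)
    (B₁ B₂ : FGraph)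
    (e₁ : B₁.V ≃ (contractPart C₁ hC₁ K q₁).V)
    (e₂ : B₂.V ≃ (contractPart C₂ hC₂ K q₂).V)
    (h₁ : ∀ x y, B₁.Adj x y ↔ FGraph.Adj _ (e₁ x) (e₁ y))
    (h₂ : ∀ x y, B₂.Adj x y ↔ FGraph.Adj _ (e₂ x) (e₂ y))
    (m₁ : ι → B₁.V) (m₂ : ι → B₂.V)
    (hm₁ : ∀ i, e₁ (m₁ i) = contractMk C₁ hC₁ K q₁ (l₁ i))
    (hm₂ : ∀ i, e₂ (m₂ i) = contractMk C₂ hC₂ K q₂ (l₂ i))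
    (s : B₁.V ⊕ B₂.V → B₁.V ⊕ B₂.V → Prop)
    (hs : ∀ a b, s a b ↔ ∃ i, a = Sum.inl (m₁ i) ∧ b = Sum.inr (m₂ i)) :
    ∃ e : (BiGraph.glue B₁ B₂ s).V ≃ K.V,
      (∀ b a, e₁ b = contractMk C₁ hC₁ K q₁ a → e (Quot.mk _ (Sum.inl b)) = q₁ a) ∧
      (∀ b a, e₂ b = contractMk C₂ hC₂ K q₂ a → e (Quot.mk _ (Sum.inr b)) = q₂ a) ∧
      ∀ x y, (BiGraph.glue B₁ B₂ s).Adj x y ↔ K.Adj (e x) (e y) := by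
  let φ : Quot s → K.V := Quot.lift
    (Sum.elim (fun b => contractPartMap C₁ hC₁ K q₁ (e₁ b))
      (fun b => contractPartMap C₂ hC₂ K q₂ (e₂ b))) (by
        rintro a b h
        obtain ⟨i, rfl, rfl⟩ := (hs a b).1 h
        simp only [Sum.elim_inl, Sum.elim_inr, hm₁, hm₂]
        change q₁ _ = q₂ _
        rw [← hq₁, ← hq₂]
        exact congrArg q (Quot.sound ((hr _ _).2 ⟨i, rfl, rfl⟩)))
  have φ_inl : ∀ b a, e₁ b = contractMk C₁ hC₁ K q₁ a → φ (Quot.mk _ (Sum.inl b)) = q₁ a := by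
    intro b a h
    change contractPartMap C₁ hC₁ K q₁ (e₁ b) = _
    rw [h]; rfl
  have φ_inr : ∀ b a, e₂ b = contractMk C₂ hC₂ K q₂ a → φ (Quot.mk _ (Sum.inr b)) = q₂ a := by
    intro b a h
    change contractPartMap C₂ hC₂ K q₂ (e₂ b) = _
    rw [h]; rfl
  -- Bijectivity of `φ` comes from a surjection `f` that satisfies `φ ∘ f = q` and is constant on
  -- the fibres of `q`.
  let f : Quot r → Quot s := Quot.lift
    (Sum.elim (fun a => Quot.mk s (Sum.inl (e₁.symm (contractMk C₁ hC₁ K q₁ a))))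
      (fun a => Quot.mk s (Sum.inr (e₂.symm (contractMk C₂ hC₂ K q₂ a))))) (by
        rintro a b h
        obtain ⟨i, rfl, rfl⟩ := (hr a b).1 h
        simp only [Sum.elim_inl, Sum.elim_inr, ← hm₁, ← hm₂, Equiv.symm_apply_apply]
        exact Quot.sound ((hs _ _).2 ⟨i, rfl, rfl⟩))
  have hf : ∀ x y, q x = q y → f x = f y := by
    intro x y h
    -- The points of a fibre are joined by chains of host edges inside it. Each such edge lies in
    -- one of the two parts, whose contraction already identifies its ends.
    have := hq.fibres x y h
    clear h
    induction this with
    | rel x y h =>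
      obtain ⟨⟨a, b, rfl, rfl, hab⟩, hxy⟩ := h
      cases hab with
      | inl h =>
        exact congrArg (fun z => Quot.mk s (Sum.inl (e₁.symm z))) (Quot.sound ⟨h, by rwa [← hq₁, ← hq₁]⟩)
      | inr h =>
        exact congrArg (fun z => Quot.mk s (Sum.inr (e₂.symm z))) (Quot.sound ⟨h, by rwa [← hq₂, ← hq₂]⟩)
    | refl => rfl
    | symm _ _ _ ih => exact ih.symm
    | trans _ _ _ _ _ ih ih' => exact ih.trans ih'
  have hφf : ∀ x, φ (f x) = q x := by
    rintro ⟨a | a⟩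
    · exact (φ_inl _ _ (e₁.apply_symm_apply _)).trans (hq₁ a).symm
    · exact (φ_inr _ _ (e₂.apply_symm_apply _)).trans (hq₂ a).symm
  have hfs : Function.Surjective f := by
    rintro ⟨b | b⟩
    · obtain ⟨a, ha⟩ := Quot.mk_surjective (e₁ b)
      refine ⟨Quot.mk _ (Sum.inl a), ?_⟩
      change Quot.mk s (Sum.inl (e₁.symm (contractMk C₁ hC₁ K q₁ a))) = _
      rw [contractMk, ha, Equiv.symm_apply_apply]
    · obtain ⟨a, ha⟩ := Quot.mk_surjective (e₂ b)
      refine ⟨Quot.mk _ (Sum.inr a), ?_⟩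
      change Quot.mk s (Sum.inr (e₂.symm (contractMk C₂ hC₂ K q₂ a))) = _
      rw [contractMk, ha, Equiv.symm_apply_apply]
  have hinj : Function.Injective φ := by
    intro x y h
    obtain ⟨x, rfl⟩ := hfs x
    obtain ⟨y, rfl⟩ := hfs y
    rw [hφf, hφf] at h
    exact hf _ _ h
  have hsurj : Function.Surjective φ := fun k => by
    obtain ⟨x, rfl⟩ := hq.surj k
    exact ⟨f x, hφf x⟩
  refine ⟨Equiv.ofBijective φ ⟨hinj, hsurj⟩, φ_inl, φ_inr, fun x y => ?_⟩
  change _ ↔ K.Adj (φ x) (φ y)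
  constructor
  · rintro ⟨a | a, b | b, rfl, rfl, hab⟩
    · obtain ⟨a', b', ha, hb, -, hab⟩ := (h₁ _ _).1 hab
      rwa [φ_inl _ _ ha.symm, φ_inl _ _ hb.symm]
    · exact hab.elim
    · exact hab.elim
    · obtain ⟨a', b', ha, hb, -, hab⟩ := (h₂ _ _).1 hab
      rwa [φ_inr _ _ ha.symm, φ_inr _ _ hb.symm]
  · intro h
    obtain ⟨x', y', hx, hy, a, b, rfl, rfl, hab⟩ := hq.lift _ _ h
    rw [← hx, ← hy] at h
    rw [← hφf] at hx hy
    rw [← hinj hx, ← hinj hy]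
    cases hab with
    | inl hab =>
      refine ⟨_, _, rfl, rfl, (h₁ _ _).2 ?_⟩
      rw [Equiv.apply_symm_apply, Equiv.apply_symm_apply]
      rw [hq₁, hq₁] at h
      exact ⟨_, _, rfl, rfl, hab, h⟩
    | inr hab =>
      refine ⟨_, _, rfl, rfl, (h₂ _ _).2 ?_⟩
      rw [Equiv.apply_symm_apply, Equiv.apply_symm_apply]
      rw [hq₂, hq₂] at h
      exact ⟨_, _, rfl, rfl, hab, h⟩

/-- `C` is a connected supergraph of `F` all of whose contractions are generated by atomic
graphs. -/
structure IsHost {t : ℕ} (F : BiGraph t) (C : F.graph.V → F.graph.V → Prop) : Prop where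
  symm : ∀ a b, C a b → C b a
  adj_le : ∀ a b, F.graph.Adj a b → C a b
  conn : ∀ a b, Relation.EqvGen C a b
  contract : ∀ (K : FGraph) (q : F.graph.V → K.V), IsContraction C K q →
    ∃ B : BiGraph t, BiL t B ∧ ∃ e : B.graph.V ≃ K.V,
      (∀ i, e (B.lab i) = q (F.lab i)) ∧ ∀ x y, B.graph.Adj x y ↔ K.Adj (e x) (e y)

/-! ### Connected hosts of generated graphs -/

section host

variable {t : ℕ}

/-- Surjectivity of the labelling survives every quotient and does not involve edges, so any image
with any edge set is atomic again. -/
lemma isHost_atomic (A : BiGraph t) (hA : A.IsAtomic) : IsHost A fun _ _ => True where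
  symm _ _ _ := trivial
  adj_le _ _ _ := trivial
  conn _ _ := .rel _ _ trivial
  contract K q hq := ⟨⟨K, q ∘ A.lab⟩, .atomic _ (hq.surj.comp hA), Equiv.refl _,
    fun _ => rfl, fun _ _ => Iff.rfl⟩

lemma IsHost.permute {F : BiGraph t} {C} (h : IsHost F C) (σ : Equiv.Perm (Fin t ⊕ Fin t)) :
    IsHost (F.permute σ) C where
  symm := h.symm
  adj_le := h.adj_le
  conn := h.conn
  contract K q hq := by
    obtain ⟨B, hB, e, he, hadj⟩ := h.contract K q hq
    exact ⟨B.permute σ, hB.permute _ σ, e, fun i => he _, hadj⟩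

/-- One identified pair of labels suffices to join two connected parts; for both compositions, its
existence is the assumption `1 ≤ t`. -/
lemma eqvGen_glueHost {ι α β : Type} [Nonempty ι] (l₁ : ι → α) (l₂ : ι → β)
    (r : α ⊕ β → α ⊕ β → Prop) (hr : ∀ i, r (Sum.inl (l₁ i)) (Sum.inr (l₂ i)))
    {C₁ : α → α → Prop} {C₂ : β → β → Prop} (h₁ : ∀ a b, Relation.EqvGen C₁ a b)
    (h₂ : ∀ a b, Relation.EqvGen C₂ a b) (x y : Quot r) :
    Relation.EqvGen (glueHost r C₁ C₂) x y := by
  have k₁ : ∀ a b, Relation.EqvGen (glueHost r C₁ C₂) (Quot.mk r (.inl a)) (Quot.mk r (.inl b)) := by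
    intro a b
    induction h₁ a b with
    | rel _ _ h => exact .rel _ _ ⟨_, _, rfl, rfl, .inl h⟩
    | refl => exact .refl _
    | symm _ _ _ ih => exact ih.symm
    | trans _ _ _ _ _ ih ih' => exact ih.trans _ _ _ ih'
  have k₂ : ∀ a b, Relation.EqvGen (glueHost r C₁ C₂) (Quot.mk r (.inr a)) (Quot.mk r (.inr b)) := by
    intro a b
    induction h₂ a b with
    | rel _ _ h => exact .rel _ _ ⟨_, _, rfl, rfl, .inr h⟩
    | refl => exact .refl _
    | symm _ _ _ ih => exact ih.symm
    | trans _ _ _ _ _ ih ih' => exact ih.trans _ _ _ ih'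
  have i : ι := Classical.arbitrary ι
  have e := Quot.sound (hr i)
  have k₁₂ : ∀ a b, Relation.EqvGen (glueHost r C₁ C₂) (Quot.mk r (.inl a)) (Quot.mk r (.inr b)) :=
    fun a b => (k₁ a (l₁ i)).trans _ _ _ (e ▸ k₂ (l₂ i) b)
  obtain ⟨x | x⟩ := x <;> obtain ⟨y | y⟩ := y
  · exact k₁ _ _
  · exact k₁₂ _ _
  · exact (k₁₂ _ _).symm
  · exact k₂ _ _

lemma glueHost_symm {α β : Type} (r : α ⊕ β → α ⊕ β → Prop) {C₁ : α → α → Prop}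
    {C₂ : β → β → Prop} (h₁ : ∀ a b, C₁ a b → C₁ b a) (h₂ : ∀ a b, C₂ a b → C₂ b a)
    (x y : Quot r) (h : glueHost r C₁ C₂ x y) : glueHost r C₁ C₂ y x := by
  obtain ⟨a, b, rfl, rfl, h⟩ := h
  refine ⟨b, a, rfl, rfl, ?_⟩
  cases h with
  | inl h => exact .inl (h₁ _ _ h)
  | inr h => exact .inr (h₂ _ _ h)

lemma glueHost_of_glue_adj {F₁ F₂ : FGraph} (r : F₁.V ⊕ F₂.V → F₁.V ⊕ F₂.V → Prop)
    {C₁ : F₁.V → F₁.V → Prop} {C₂ : F₂.V → F₂.V → Prop} (h₁ : ∀ a b, F₁.Adj a b → C₁ a b)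
    (h₂ : ∀ a b, F₂.Adj a b → C₂ a b) (x y : Quot r) (h : (BiGraph.glue F₁ F₂ r).Adj x y) :
    glueHost r C₁ C₂ x y := by
  obtain ⟨a | a, b | b, rfl, rfl, h⟩ := h
  · exact ⟨_, _, rfl, rfl, .inl (h₁ _ _ h)⟩
  · exact h.elim
  · exact h.elim
  · exact ⟨_, _, rfl, rfl, .inr (h₂ _ _ h)⟩

/-- Each part is contracted along its own host edges only. Vertices of one part whose fibre is
connected only through the other part stay distinct there and are merged by the gluing. -/
lemma IsHost.series (ht : 1 ≤ t) {F F' : BiGraph t} {C C'} (h : IsHost F C) (h' : IsHost F' C') :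
    IsHost (F.series F') (glueHost (BiGraph.seriesRel F F') C C') where
  symm := glueHost_symm _ h.symm h'.symm
  adj_le := glueHost_of_glue_adj _ h.adj_le h'.adj_le
  conn := by
    have : Nonempty (Fin t) := ⟨⟨0, ht⟩⟩
    exact eqvGen_glueHost (fun i => F.lab (.inr i)) (fun i => F'.lab (.inl i)) _
      (fun i => ⟨i, rfl, rfl⟩) h.conn h'.conn
  contract K q hq := by
    have := F.graph.finite
    have := F'.graph.finite
    obtain ⟨B, hB, e₁, he₁, ha₁⟩ := h.contract _ _ (isContraction_contractPart C h.symm K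
      fun a => q (Quot.mk _ (Sum.inl a)))
    obtain ⟨B', hB', e₂, he₂, ha₂⟩ := h'.contract _ _ (isContraction_contractPart C' h'.symm K
      fun a => q (Quot.mk _ (Sum.inr a)))
    obtain ⟨e, k₁, k₂, hadj⟩ := exists_equiv_glue_contractPart F.graph F'.graph
      (fun i : Fin t => F.lab (.inr i)) (fun i => F'.lab (.inl i)) _ (fun _ _ => Iff.rfl)
      C h.symm C' h'.symm K q hq _ (fun _ => rfl) _ (fun _ => rfl) B.graph B'.graph e₁ e₂ ha₁ ha₂
      (fun i : Fin t => B.lab (.inr i)) (fun i => B'.lab (.inl i)) (fun i => he₁ _)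
      (fun i => he₂ _) (BiGraph.seriesRel B B') (fun _ _ => Iff.rfl)
    refine ⟨B.series B', hB.series _ _ hB', e, ?_, hadj⟩
    rintro (i | i)
    · exact k₁ _ _ (he₁ _)
    · exact k₂ _ _ (he₂ _)

lemma IsHost.parallel (ht : 1 ≤ t) {F F' : BiGraph t} {C C'} (hF : F.IsAtomic) (h : IsHost F C)
    (h' : IsHost F' C') :
    IsHost (F.parallel F') (glueHost (BiGraph.parallelRel F F') C C') where
  symm := glueHost_symm _ h.symm h'.symm
  adj_le := glueHost_of_glue_adj _ h.adj_le h'.adj_le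
  conn := by
    have : Nonempty (Fin t ⊕ Fin t) := ⟨.inl ⟨0, ht⟩⟩
    exact eqvGen_glueHost F.lab F'.lab _ (fun i => ⟨i, rfl, rfl⟩) h.conn h'.conn
  contract K q hq := by
    have := F.graph.finite
    have := F'.graph.finite
    obtain ⟨B, hB, e₁, he₁, ha₁⟩ := h.contract _ _ (isContraction_contractPart C h.symm K
      fun a => q (Quot.mk _ (Sum.inl a)))
    obtain ⟨B', hB', e₂, he₂, ha₂⟩ := h'.contract _ _ (isContraction_contractPart C' h'.symm K
      fun a => q (Quot.mk _ (Sum.inr a)))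
    -- The parallel rule needs an atomic left factor, and a contraction of an atomic graph is
    -- atomic.
    have hBa : B.IsAtomic := by
      intro x
      obtain ⟨a, ha⟩ := Quot.mk_surjective (e₁ x)
      obtain ⟨i, rfl⟩ := hF a
      exact ⟨i, e₁.injective ((he₁ i).trans ha)⟩
    obtain ⟨e, k₁, k₂, hadj⟩ := exists_equiv_glue_contractPart F.graph F'.graph
      F.lab F'.lab _ (fun _ _ => Iff.rfl)
      C h.symm C' h'.symm K q hq _ (fun _ => rfl) _ (fun _ => rfl) B.graph B'.graph e₁ e₂ ha₁ ha₂
      B.lab B'.lab (fun i => he₁ _)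
      (fun i => he₂ _) (BiGraph.parallelRel B B') (fun _ _ => Iff.rfl)
    exact ⟨B.parallel B', .parallel _ _ hBa hB', e, fun i => k₁ _ _ (he₁ _), hadj⟩

lemma exists_isHost (ht : 1 ≤ t) {F : BiGraph t} (hF : BiL t F) : ∃ C, IsHost F C := by
  induction hF with
  | atomic A hA => exact ⟨_, isHost_atomic A hA⟩
  | parallel A F hA _ ih =>
    obtain ⟨C, h⟩ := ih
    exact ⟨_, (isHost_atomic A hA).parallel ht hA h⟩
  | series F F' _ _ ih ih' =>
    obtain ⟨C, h⟩ := ih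
    obtain ⟨C', h'⟩ := ih'
    exact ⟨_, h.series ht h'⟩
  | permute F σ _ ih =>
    obtain ⟨C, h⟩ := ih
    exact ⟨_, h.permute σ⟩

end host

/-- Disjoint connected sets in a connected graph extend to a partition into connected sets. -/
lemma exists_fibresConnected {α X : Type} [Finite α] [Nonempty X] (C : α → α → Prop)
    (hconn : ∀ a b, Relation.EqvGen C a b) (branch : X → Set α)
    (hne : ∀ x, (branch x).Nonempty) (hdisj : ∀ x y, x ≠ y → Disjoint (branch x) (branch y))
    (hbr : ∀ x, ∀ a ∈ branch x, ∀ b ∈ branch x,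
      Relation.EqvGen (fun a b => C a b ∧ a ∈ branch x ∧ b ∈ branch x) a b) :
    ∃ q : α → X, FibresConnected C q ∧ ∀ x, ∀ a ∈ branch x, q a = x := by
  classical
  choose base hbase using hne
  let R (S : Set α) (q : α → X) (a b : α) : Prop := C a b ∧ a ∈ S ∧ b ∈ S ∧ q a = q b
  -- The partition is built on a set `S` growing by one vertex at a time from the union of the
  -- branch sets. The invariant joins each vertex of `S` to the base point of its class within that
  -- class and within `S`.
  let P (S : Set α) : Prop := ∃ q : α → X, (∀ x, ∀ a ∈ branch x, q a = x) ∧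
    ∀ a ∈ S, Relation.EqvGen (R S q) a (base (q a))
  have key : ∀ n : ℕ, ∀ S : Set α, (∀ x, branch x ⊆ S) → Sᶜ.ncard = n → P S → P Set.univ := by
    intro n
    induction n with
    | zero =>
      intro S _ hS hP
      have : S = Set.univ := by
        rw [Set.ncard_eq_zero (Set.toFinite _)] at hS
        exact Set.compl_empty_iff.1 hS
      rwa [← this]
    | succ n ih =>
      rintro S hbS hS ⟨q, hq, hc⟩
      -- Connectedness provides an edge leaving `S`; its outer end is put into the class of its
      -- inner end.
      obtain ⟨s, hs, v, hv, hsv⟩ : ∃ s ∈ S, ∃ v ∉ S, C s v ∨ C v s := by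
        by_contra! hcon
        have hcl : ∀ a b, Relation.EqvGen C a b → (a ∈ S ↔ b ∈ S) := by
          intro a b h
          induction h with
          | rel a b h =>
            constructor
            · intro ha
              by_contra hb
              exact (hcon a ha b hb).1 h
            · intro hb
              by_contra ha
              exact (hcon b hb a ha).2 h
          | refl => rfl
          | symm _ _ _ ih => exact ih.symm
          | trans _ _ _ _ _ ih ih' => exact ih.trans ih'
        have hne : Sᶜ.Nonempty := by
          rw [← Set.ncard_pos (Set.toFinite _)]
          omega
        obtain ⟨v, hv⟩ := hne
        exact hv ((hcl _ _ (hconn _ _)).1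
          (hbS (Classical.arbitrary X) (hbase (Classical.arbitrary X))))
      let q' := Function.update q v (q s)
      have hq' : ∀ a ∈ S, q' a = q a := fun a ha =>
        Function.update_of_ne (by rintro rfl; exact hv ha) _ _
      have hq'v : q' v = q s := Function.update_self _ _ _
      have hold : ∀ a b, Relation.EqvGen (R S q) a b →
          Relation.EqvGen (R (insert v S) q') a b := fun a b h =>
        h.mono fun a b ⟨h, ha, hb, hab⟩ =>
          ⟨h, Set.mem_insert_of_mem _ ha, Set.mem_insert_of_mem _ hb, by rw [hq' a ha, hq' b hb, hab]⟩
      refine ih (insert v S) (fun x => (hbS x).trans (Set.subset_insert _ _)) ?_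
        ⟨q', fun x a ha => (hq' a (hbS x ha)).trans (hq x a ha), ?_⟩
      · have : (insert v S)ᶜ = Sᶜ \ {v} := by
          ext a; simp [not_or, and_comm]
        rw [this, Set.ncard_sdiff_singleton_of_mem hv, hS]
        rfl
      · rintro a (rfl | ha)
        · rw [hq'v]
          refine Relation.EqvGen.trans _ s _ ?_ (hold _ _ (hc s hs))
          have e : q' s = q' a := by rw [hq' s hs, hq'v]
          rcases hsv with h | h
          · exact .symm _ _ (.rel _ _ ⟨h, Set.mem_insert_of_mem _ hs, Set.mem_insert _ _, e⟩)
          · exact .rel _ _ ⟨h, Set.mem_insert _ _, Set.mem_insert_of_mem _ hs, e.symm⟩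
        · rw [hq' a ha]
          exact hold _ _ (hc a ha)
  have start : P (⋃ x, branch x) := by
    have hex : ∀ a, ∃ x, (∃ y, a ∈ branch y) → a ∈ branch x := fun a => by
      by_cases h : ∃ y, a ∈ branch y
      · exact ⟨h.choose, fun _ => h.choose_spec⟩
      · exact ⟨Classical.arbitrary X, fun h' => (h h').elim⟩
    choose q hq using hex
    have hq' : ∀ x, ∀ a ∈ branch x, q a = x := fun x a ha => by
      by_contra hne
      exact Set.disjoint_left.1 (hdisj _ _ hne) (hq a ⟨x, ha⟩) ha
    refine ⟨q, hq', fun a ha => ?_⟩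
    obtain ⟨x, hx⟩ := Set.mem_iUnion.1 ha
    rw [hq' x a hx]
    exact (hbr x a hx _ (hbase x)).mono fun a b ⟨h, ha, hb⟩ =>
      ⟨h, Set.mem_iUnion_of_mem x ha, Set.mem_iUnion_of_mem x hb, by rw [hq' x a ha, hq' x b hb]⟩
  obtain ⟨q, hq, hc⟩ := key _ _ (fun x => Set.subset_iUnion _ x) rfl start
  refine ⟨q, fun a b hab => ?_, hq⟩
  have mono : ∀ a, Relation.EqvGen (fun a b => C a b ∧ q a = q b) a (base (q a)) := fun a =>
    (hc a (Set.mem_univ a)).mono fun _ _ h => ⟨h.1, h.2.2.2⟩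
  exact (mono a).trans _ _ _ (hab ▸ (mono b).symm)

/-- Vertices outside the branch sets are absorbed into them along host edges rather than deleted.
Edge deletion costs nothing, since `IsContraction` only asks the edges of the minor to lift. The
absorption needs a branch set to start from, so the minor without vertices is covered by the
convention in `LClass`. -/
theorem minorClosed_LClass {t : ℕ} (ht : 1 ≤ t) : MinorClosed (LClass t) := by
  rintro F (hF | ⟨B, hB, e, he⟩) M ⟨branch, hconn, hdisj, hadj, hloop⟩
  · refine Or.inl ⟨fun x => ?_⟩
    obtain ⟨a, _⟩ := (hconn x).nonempty.some
    exact hF.false a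
  rcases isEmpty_or_nonempty M.V with hM | hM
  · exact Or.inl hM
  refine Or.inr ?_
  obtain ⟨C, hC⟩ := exists_isHost ht hB
  have := B.graph.finite
  have hAdj : ∀ a b, F.Adj a b → C (e a) (e b) := fun a b h => hC.adj_le _ _ ((he a b).1 h)
  obtain ⟨q, hqc, hq⟩ := exists_fibresConnected C hC.conn (fun x => e '' branch x)
    (fun x => by
      obtain ⟨a, ha⟩ := (hconn x).nonempty.some
      exact ⟨e a, a, ha, rfl⟩)
    (fun x y h => (Set.disjoint_image_iff e.injective).2 (hdisj x y h))
    (by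
      rintro x _ ⟨a, ha, rfl⟩ _ ⟨b, hb, rfl⟩
      have hr := (hconn x).preconnected ⟨a, ha⟩ ⟨b, hb⟩
      obtain ⟨w⟩ := hr
      have : ∀ u v : branch x, (F.toSimple.induce (branch x)).Walk u v →
          Relation.EqvGen (fun a b => C a b ∧ a ∈ e '' branch x ∧ b ∈ e '' branch x)
            (e u) (e v) := by
        intro u v w
        induction w with
        | nil => exact .refl _
        | cons h _ ih =>
          exact (Relation.EqvGen.rel _ _ ⟨hAdj _ _ h.2, ⟨_, Subtype.coe_prop _, rfl⟩,
            ⟨_, Subtype.coe_prop _, rfl⟩⟩).trans _ _ _ ih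
      exact this _ _ w)
  have hcon : IsContraction C M q := by
    refine ⟨fun x => ?_, hqc, fun x y hxy => ?_⟩
    · obtain ⟨a, ha⟩ := (hconn x).nonempty.some
      exact ⟨e a, hq x _ ⟨a, ha, rfl⟩⟩
    · by_cases h : x = y
      · subst h
        obtain ⟨a, ha, haa⟩ := hloop x hxy
        exact ⟨e a, e a, hq x _ ⟨a, ha, rfl⟩, hq x _ ⟨a, ha, rfl⟩, hAdj _ _ haa⟩
      · obtain ⟨a, ha, b, hb, hab⟩ := hadj x y h hxy
        exact ⟨e a, e b, hq x _ ⟨a, ha, rfl⟩, hq y _ ⟨b, hb, rfl⟩, hAdj _ _ hab⟩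
  obtain ⟨B', hB', e', -, he'⟩ := hC.contract M q hcon
  exact ⟨B', hB', e'.symm, fun a b => by rw [he']; simp⟩

/-! ### Treewidth -/

namespace SimpleGraph

variable {N₁ N₂ : Type}

/-- The disjoint union of two graphs together with an edge between `r₁` and `r₂`. -/
def join (T₁ : SimpleGraph N₁) (T₂ : SimpleGraph N₂) (r₁ : N₁) (r₂ : N₂) :
    SimpleGraph (N₁ ⊕ N₂) :=
  T₁.sum T₂ ⊔ edge (Sum.inl r₁) (Sum.inr r₂)

/-- Trees are recognised as the connected graphs with one vertex more than edges. -/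
lemma IsTree.join [Finite N₁] [Finite N₂] {T₁ : SimpleGraph N₁} {T₂ : SimpleGraph N₂}
    (h₁ : T₁.IsTree) (h₂ : T₂.IsTree) (r₁ : N₁) (r₂ : N₂) : (T₁.join T₂ r₁ r₂).IsTree := by
  have c : (T₁.join T₂ r₁ r₂).Connected := h₁.connected.sum_sup_edge h₂.connected
  rw [isTree_iff_connected_and_card] at h₁ h₂ ⊢
  refine ⟨c, ?_⟩
  have hcard : Nat.card (T₁.sum T₂).edgeSet = Nat.card T₁.edgeSet + Nat.card T₂.edgeSet := by
    rw [Nat.card_congr edgeSetSumEquiv, Nat.card_sum]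
  have hnot : s(Sum.inl r₁, Sum.inr r₂) ∉ (T₁.sum T₂).edgeSet := by simp
  have hset : (T₁.join T₂ r₁ r₂).edgeSet = insert s(Sum.inl r₁, Sum.inr r₂) (T₁.sum T₂).edgeSet := by
    rw [SimpleGraph.join, edgeSet_sup, edgeSet_edge_of_ne (by simp), Set.union_comm,
      Set.singleton_union]
  have h3 : Nat.card (T₁.join T₂ r₁ r₂).edgeSet = Nat.card (T₁.sum T₂).edgeSet + 1 := by
    rw [hset]
    exact Set.ncard_insert_of_notMem hnot (Set.toFinite _)
  rw [h3, hcard, Nat.card_sum]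
  omega

/-- Each element occurs in a connected (possibly empty) set of bags. -/
def BagsPreconnected {N X : Type} (T : SimpleGraph N) (β : N → Set X) : Prop :=
  ∀ a, (T.induce {x | a ∈ β x}).Preconnected

/-- An element occurring on both sides occurs at both ends of the new edge, which links its two sets
of nodes. -/
lemma BagsPreconnected.join {X : Type} {T₁ : SimpleGraph N₁} {T₂ : SimpleGraph N₂}
    {β₁ : N₁ → Set X} {β₂ : N₂ → Set X} (h₁ : BagsPreconnected T₁ β₁)
    (h₂ : BagsPreconnected T₂ β₂) (r₁ : N₁) (r₂ : N₂)
    (h : ∀ x y z, z ∈ β₁ x → z ∈ β₂ y → z ∈ β₁ r₁ ∧ z ∈ β₂ r₂) :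
    BagsPreconnected (T₁.join T₂ r₁ r₂) (Sum.elim β₁ β₂) := by
  intro z
  have k₁ : ∀ x y (hx : z ∈ β₁ x) (hy : z ∈ β₁ y),
      ((T₁.join T₂ r₁ r₂).induce {x | z ∈ Sum.elim β₁ β₂ x}).Reachable ⟨.inl x, hx⟩ ⟨.inl y, hy⟩ :=
    fun x y hx hy => (h₁ z ⟨x, hx⟩ ⟨y, hy⟩).map
      (G' := (T₁.join T₂ r₁ r₂).induce {x | z ∈ Sum.elim β₁ β₂ x})
      ⟨fun v => ⟨.inl v.1, v.2⟩, fun {a b} hab => by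
        simp only [comap_adj, Function.Embedding.subtype_apply] at hab ⊢
        exact Or.inl (by simpa using hab)⟩
  have k₂ : ∀ x y (hx : z ∈ β₂ x) (hy : z ∈ β₂ y),
      ((T₁.join T₂ r₁ r₂).induce {x | z ∈ Sum.elim β₁ β₂ x}).Reachable ⟨.inr x, hx⟩ ⟨.inr y, hy⟩ :=
    fun x y hx hy => (h₂ z ⟨x, hx⟩ ⟨y, hy⟩).map
      (G' := (T₁.join T₂ r₁ r₂).induce {x | z ∈ Sum.elim β₁ β₂ x})
      ⟨fun v => ⟨.inr v.1, v.2⟩, fun {a b} hab => by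
        simp only [comap_adj, Function.Embedding.subtype_apply] at hab ⊢
        exact Or.inl (by simpa using hab)⟩
  have k₁₂ : ∀ x y (hx : z ∈ β₁ x) (hy : z ∈ β₂ y),
      ((T₁.join T₂ r₁ r₂).induce {x | z ∈ Sum.elim β₁ β₂ x}).Reachable
        ⟨.inl x, hx⟩ ⟨.inr y, hy⟩ := by
    intro x y hx hy
    obtain ⟨hz₁, hz₂⟩ := h x y z hx hy
    refine (k₁ x r₁ hx hz₁).trans (.trans (Adj.reachable ?_) (k₂ r₂ y hz₂ hy))
    simp only [comap_adj, Function.Embedding.subtype_apply]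
    exact Or.inr (by simp [edge])
  rintro ⟨x | x, hx⟩ ⟨y | y, hy⟩
  · exact k₁ x y hx hy
  · exact k₁₂ x y hx hy
  · exact (k₁₂ y x hy hx).symm
  · exact k₂ x y hx hy

/-- Distinct points with the same image share the bag at `r`, so their connected sets of nodes meet
there. -/
lemma BagsPreconnected.image {N X Y : Type} {T : SimpleGraph N} {β : N → Set X}
    (h : BagsPreconnected T β) (f : X → Y) (r : N)
    (hf : ∀ a b, f a = f b → a = b ∨ (a ∈ β r ∧ b ∈ β r)) :
    BagsPreconnected T fun x => f '' β x := by
  intro z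
  have mono : ∀ a, f a = z → {x | a ∈ β x} ⊆ {x | z ∈ f '' β x} := fun a ha x hx => ⟨a, hx, ha⟩
  have k : ∀ a (ha : f a = z) x y (hx : a ∈ β x) (hy : a ∈ β y),
      (T.induce {x | z ∈ f '' β x}).Reachable ⟨x, mono a ha hx⟩ ⟨y, mono a ha hy⟩ :=
    fun a ha x y hx hy => (h a ⟨x, hx⟩ ⟨y, hy⟩).map (induceHomOfLE T (mono a ha)).toHom
  rintro ⟨x, a, hx, ha⟩ ⟨y, b, hy, hb⟩
  rcases hf a b (ha.trans hb.symm) with rfl | ⟨har, hbr⟩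
  · exact k a ha x y hx hy
  · exact (k a ha x r hx har).trans (k b hb r y hbr hy)

end SimpleGraph

open SimpleGraph

/-- `F` has a tree decomposition with bags of size at most `k`, one of which contains `S`. -/
def FGraph.HasRootedDecomposition (F : FGraph) (S : Set F.V) (k : ℕ) : Prop :=
  ∃ (N : Type) (_ : Finite N) (T : SimpleGraph N) (β : N → Set F.V) (r : N),
    T.IsTree ∧ (∀ a, ∃ x, a ∈ β x) ∧ (∀ a b, F.Adj a b → ∃ x, a ∈ β x ∧ b ∈ β x) ∧
      BagsPreconnected T β ∧ (∀ x, (β x).ncard ≤ k) ∧ S ⊆ β r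

lemma FGraph.HasRootedDecomposition.treewidthLE {F : FGraph} {S : Set F.V} {k : ℕ}
    (h : F.HasRootedDecomposition S (k + 1)) : F.TreewidthLE k := by
  obtain ⟨N, hN, T, β, r, hT, hc, he, hp, hb, -⟩ := h
  refine ⟨N, hN, T, β, hT, ⟨hc, he, fun a => ?_⟩, hb⟩
  obtain ⟨x, hx⟩ := hc a
  have : Nonempty {x | a ∈ β x} := ⟨⟨x, hx⟩⟩
  exact ⟨hp a⟩

lemma FGraph.Iso.treewidthLE {F F' : FGraph} (h : F.Iso F') {k : ℕ} (h' : F'.TreewidthLE k) :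
    F.TreewidthLE k := by
  obtain ⟨e, he⟩ := h
  obtain ⟨N, hN, T, β, hT, hd, hb⟩ := h'
  refine ⟨N, hN, T, fun x => e ⁻¹' β x, hT, ⟨fun a => hd.cover _, fun a b hab =>
    hd.edge _ _ ((he a b).1 hab), fun a => hd.connected (e a)⟩, fun x => ?_⟩
  change (e ⁻¹' β x).ncard ≤ k + 1
  rw [← e.symm_symm, ← Equiv.image_eq_preimage_symm, Set.ncard_image_of_injective _ e.symm.injective]
  exact hb x

/-- Vertices identified in a glued graph are equal or both labelled. -/
lemma eq_or_labelled_of_quot_mk_eq {ι α β : Type} {l₁ : ι → α} {l₂ : ι → β}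
    {r : α ⊕ β → α ⊕ β → Prop}
    (hr : ∀ a b, r a b → ∃ i, a = Sum.inl (l₁ i) ∧ b = Sum.inr (l₂ i)) {x y : α ⊕ β}
    (h : Quot.mk r x = Quot.mk r y) :
    x = y ∨ (x ∈ Sum.elim (Sum.inl ∘ l₁) (Sum.inr ∘ l₂) '' (Set.univ : Set (ι ⊕ ι)) ∧
      y ∈ Sum.elim (Sum.inl ∘ l₁) (Sum.inr ∘ l₂) '' (Set.univ : Set (ι ⊕ ι))) := by
  have := Quot.eqvGen_exact h
  clear h
  induction this with
  | rel x y h =>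
    obtain ⟨i, rfl, rfl⟩ := hr x y h
    exact Or.inr ⟨⟨.inl i, trivial, rfl⟩, ⟨.inr i, trivial, rfl⟩⟩
  | refl => exact Or.inl rfl
  | symm _ _ _ ih => exact ih.imp Eq.symm And.symm
  | trans x y z _ _ ih ih' =>
    rcases ih with rfl | ih
    · exact ih'
    · rcases ih' with rfl | ih'
      · exact Or.inr ih
      · exact Or.inr ⟨ih.1, ih'.2⟩

/-- A new node with bag `R` is placed between the roots of the two trees. Gluing identifies labelled
vertices only, and these lie in the root bags and in `R`, so the nodes of every vertex remain
connected. -/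
lemma hasRootedDecomposition_glue {ι : Type} {F₁ F₂ : FGraph} (l₁ : ι → F₁.V) (l₂ : ι → F₂.V)
    (r : F₁.V ⊕ F₂.V → F₁.V ⊕ F₂.V → Prop)
    (hr : ∀ a b, r a b → ∃ i, a = Sum.inl (l₁ i) ∧ b = Sum.inr (l₂ i))
    {L₁ : Set F₁.V} {L₂ : Set F₂.V} {k : ℕ} (hl₁ : ∀ i, l₁ i ∈ L₁) (hl₂ : ∀ i, l₂ i ∈ L₂)
    (h₁ : F₁.HasRootedDecomposition L₁ k) (h₂ : F₂.HasRootedDecomposition L₂ k)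
    (R : Set (Quot r))
    (hR : R = (fun a => Quot.mk r (Sum.inl a)) '' L₁ ∪ (fun a => Quot.mk r (Sum.inr a)) '' L₂)
    (hk : R.ncard ≤ k) :
    (BiGraph.glue F₁ F₂ r).HasRootedDecomposition R k := by
  have := F₁.finite
  have := F₂.finite
  obtain ⟨N₁, hN₁, T₁, β₁, r₁, hT₁, hc₁, he₁, hp₁, hb₁, hS₁⟩ := h₁
  obtain ⟨N₂, hN₂, T₂, β₂, r₂, hT₂, hc₂, he₂, hp₂, hb₂, hS₂⟩ := h₂
  have inl_inl : ∀ a b, Quot.mk r (Sum.inl a) = Quot.mk r (Sum.inl b) →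
      a = b ∨ (a ∈ L₁ ∧ b ∈ L₁) := by
    intro a b h
    rcases eq_or_labelled_of_quot_mk_eq hr h with h | ⟨⟨i | i, -, hi⟩, ⟨j | j, -, hj⟩⟩
    · exact Or.inl (Sum.inl_injective h)
    · exact Or.inr ⟨Sum.inl_injective hi ▸ hl₁ i, Sum.inl_injective hj ▸ hl₁ j⟩
    all_goals simp_all
  have inr_inr : ∀ a b, Quot.mk r (Sum.inr a) = Quot.mk r (Sum.inr b) →
      a = b ∨ (a ∈ L₂ ∧ b ∈ L₂) := by
    intro a b h
    rcases eq_or_labelled_of_quot_mk_eq hr h with h | ⟨⟨i | i, -, hi⟩, ⟨j | j, -, hj⟩⟩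
    · exact Or.inl (Sum.inr_injective h)
    on_goal 4 => exact Or.inr ⟨Sum.inr_injective hi ▸ hl₂ i, Sum.inr_injective hj ▸ hl₂ j⟩
    all_goals simp_all
  have inl_inr : ∀ a b, Quot.mk r (Sum.inl a) = Quot.mk r (Sum.inr b) → a ∈ L₁ ∧ b ∈ L₂ := by
    intro a b h
    rcases eq_or_labelled_of_quot_mk_eq hr h with h | ⟨⟨i | i, -, hi⟩, ⟨j | j, -, hj⟩⟩
    · simp at h
    on_goal 2 => exact ⟨Sum.inl_injective hi ▸ hl₁ i, Sum.inr_injective hj ▸ hl₂ j⟩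
    all_goals simp_all
  have mem_inl : ∀ a, Quot.mk r (Sum.inl a) ∈ R → a ∈ L₁ := by
    intro a ha
    rw [hR] at ha
    rcases ha with ⟨b, hb, h⟩ | ⟨b, hb, h⟩
    · rcases inl_inl _ _ h with rfl | h
      · exact hb
      · exact h.2
    · exact (inl_inr _ _ h.symm).1
  have mem_inr : ∀ a, Quot.mk r (Sum.inr a) ∈ R → a ∈ L₂ := by
    intro a ha
    rw [hR] at ha
    rcases ha with ⟨b, hb, h⟩ | ⟨b, hb, h⟩
    · exact (inl_inr _ _ h).2
    · rcases inr_inr _ _ h with rfl | h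
      · exact hb
      · exact h.2
  have p₁ := hp₁.image (fun a => Quot.mk r (Sum.inl a)) r₁
    (fun a b h => (inl_inl a b h).imp_right fun h => ⟨hS₁ h.1, hS₁ h.2⟩)
  have p₂ := hp₂.image (fun a => Quot.mk r (Sum.inr a)) r₂
    (fun a b h => (inr_inr a b h).imp_right fun h => ⟨hS₂ h.1, hS₂ h.2⟩)
  have p₀ : BagsPreconnected (⊥ : SimpleGraph Unit) (fun _ => R) := by
    rintro z ⟨x, hx⟩ ⟨y, hy⟩
    exact .refl _
  have q := p₁.join p₀ r₁ () (by
    rintro x - _ ⟨a, ha, rfl⟩ hR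
    exact ⟨⟨a, hS₁ (mem_inl a hR), rfl⟩, hR⟩)
  refine ⟨(N₁ ⊕ Unit) ⊕ N₂, inferInstance, _, _, .inl (.inr ()),
    (hT₁.join IsTree.of_subsingleton r₁ ()).join hT₂ (.inr ()) r₂, ?_, ?_,
    q.join p₂ (.inr ()) r₂ ?_, ?_, subset_rfl⟩
  · rintro ⟨a | a⟩
    · obtain ⟨x, hx⟩ := hc₁ a
      exact ⟨.inl (.inl x), a, hx, rfl⟩
    · obtain ⟨x, hx⟩ := hc₂ a
      exact ⟨.inr x, a, hx, rfl⟩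
  · rintro _ _ ⟨a | a, b | b, rfl, rfl, h⟩
    · obtain ⟨x, hx, hy⟩ := he₁ a b h
      exact ⟨.inl (.inl x), ⟨a, hx, rfl⟩, ⟨b, hy, rfl⟩⟩
    · exact h.elim
    · exact h.elim
    · obtain ⟨x, hx, hy⟩ := he₂ a b h
      exact ⟨.inr x, ⟨a, hx, rfl⟩, ⟨b, hy, rfl⟩⟩
  · rintro (x | x) y _ hx ⟨a, ha, rfl⟩
    · obtain ⟨b, hb, h⟩ := hx
      obtain ⟨hb', ha'⟩ := inl_inr _ _ h
      exact ⟨hR ▸ Or.inl ⟨b, hb', h⟩, ⟨a, hS₂ ha', rfl⟩⟩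
    · exact ⟨hx, ⟨a, hS₂ (mem_inr a hx), rfl⟩⟩
  · rintro ((x | x) | x)
    · exact (Set.ncard_image_le (Set.toFinite _)).trans (hb₁ x)
    · exact hk
    · exact (Set.ncard_image_le (Set.toFinite _)).trans (hb₂ x)

lemma FGraph.HasRootedDecomposition.mono {F : FGraph} {S S' : Set F.V} {k : ℕ} (hS : S' ⊆ S)
    (h : F.HasRootedDecomposition S k) : F.HasRootedDecomposition S' k := by
  obtain ⟨N, hN, T, β, r, hT, hc, he, hp, hb, hr⟩ := h
  exact ⟨N, hN, T, β, r, hT, hc, he, hp, hb, hS.trans hr⟩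

lemma ncard_range_le_card {ι α : Type} [Fintype ι] (f : ι → α) :
    (Set.range f).ncard ≤ Fintype.card ι := by
  rw [← Nat.card_eq_fintype_card]
  exact Finite.card_range_le f

/-- The bound is forced by series composition, whose new bag holds `t` in-labels of `F`, `t`
identified labels and `t` out-labels of `F'`. Atomic graphs and parallel compositions need new bags
of size `2 * t` only. -/
lemma BiLPlus.hasRootedDecomposition {t : ℕ} {F : BiGraph t} (hF : BiLPlus t F) :
    F.graph.HasRootedDecomposition (Set.range F.lab) (3 * t) := by
  induction hF with
  | atomic A hA =>
    refine ⟨Unit, inferInstance, ⊥, fun _ => Set.range A.lab, (), IsTree.of_subsingleton,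
      fun a => ⟨(), hA a⟩, fun a b _ => ⟨(), hA a, hA b⟩, ?_, fun _ => ?_, subset_rfl⟩
    · rintro z ⟨x, hx⟩ ⟨y, hy⟩
      exact .refl _
    · refine (ncard_range_le_card A.lab).trans ?_
      simp only [Fintype.card_sum, Fintype.card_fin]
      omega
  | parallel F F' _ _ ih ih' =>
    refine (hasRootedDecomposition_glue F.lab F'.lab (F.parallelRel F') (fun _ _ h => h)
      (fun i => Set.mem_range_self i) (fun i => Set.mem_range_self i) ih ih' _ rfl ?_).mono ?_
    · rw [← Set.range_comp, ← Set.range_comp]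
      have : (fun a => Quot.mk (F.parallelRel F') (Sum.inr a)) ∘ F'.lab =
          (fun a => Quot.mk (F.parallelRel F') (Sum.inl a)) ∘ F.lab :=
        funext fun i => (Quot.sound ⟨i, rfl, rfl⟩).symm
      rw [this, Set.union_self]
      refine (ncard_range_le_card _).trans ?_
      simp only [Fintype.card_sum, Fintype.card_fin]
      omega
    · rintro _ ⟨i, rfl⟩
      exact Or.inl ⟨_, ⟨i, rfl⟩, rfl⟩
  | series F F' _ _ ih ih' =>
    refine (hasRootedDecomposition_glue (fun i : Fin t => F.lab (.inr i))
      (fun i => F'.lab (.inl i)) (F.seriesRel F') (fun _ _ h => h)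
      (fun i => Set.mem_range_self _) (fun i => Set.mem_range_self _) ih ih' _ rfl ?_).mono ?_
    · let f : (Fin t ⊕ Fin t) ⊕ Fin t → Quot (F.seriesRel F') := Sum.elim
        (fun i => Quot.mk _ (Sum.inl (F.lab i))) (fun i => Quot.mk _ (Sum.inr (F'.lab (.inr i))))
      refine (Set.ncard_le_ncard (t := Set.range f) ?_ (Set.toFinite _)).trans
        ((ncard_range_le_card f).trans ?_)
      · rintro _ (⟨_, ⟨i, rfl⟩, rfl⟩ | ⟨_, ⟨i | i, rfl⟩, rfl⟩)
        · exact ⟨.inl i, rfl⟩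
        · exact ⟨.inl (.inr i), Quot.sound ⟨i, rfl, rfl⟩⟩
        · exact ⟨.inr i, rfl⟩
      · simp only [Fintype.card_sum, Fintype.card_fin]
        omega
    · rintro _ ⟨i | i, rfl⟩
      · exact Or.inl ⟨_, ⟨_, rfl⟩, rfl⟩
      · exact Or.inr ⟨_, ⟨_, rfl⟩, rfl⟩
  | permute F σ _ ih =>
    refine ih.mono ?_
    rintro _ ⟨i, rfl⟩
    exact ⟨σ i, rfl⟩

lemma FGraph.treewidthLE_of_isEmpty {F : FGraph} (h : IsEmpty F.V) (k : ℕ) : F.TreewidthLE k :=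
  ⟨Unit, inferInstance, ⊥, fun _ => ∅, IsTree.of_subsingleton,
    ⟨fun a => h.elim a, fun a => h.elim a, fun a => h.elim a⟩, fun _ => by simp⟩

theorem LPlusClass.treewidthLE {t : ℕ} (ht : 1 ≤ t) {F : FGraph} (hF : LPlusClass t F) :
    F.TreewidthLE (3 * t - 1) := by
  rcases hF with hF | ⟨B, hB, hiso⟩
  · exact FGraph.treewidthLE_of_isEmpty hF _
  · refine hiso.treewidthLE (FGraph.HasRootedDecomposition.treewidthLE (S := Set.range B.lab) ?_)
    rw [Nat.sub_add_cancel (by omega)]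
    exact hB.hasRootedDecomposition

lemma BiL.biLPlus {t : ℕ} {F : BiGraph t} (hF : BiL t F) : BiLPlus t F := by
  induction hF with
  | atomic A hA => exact .atomic A hA
  | parallel A F hA _ ih => exact .parallel _ _ (.atomic A hA) ih
  | series F F' _ _ ih ih' => exact .series _ _ ih ih'
  | permute F σ _ ih => exact .permute _ _ ih

lemma LClass.lPlusClass {t : ℕ} {F : FGraph} (hF : LClass t F) : LPlusClass t F :=
  hF.imp_right fun ⟨B, hB, h⟩ => ⟨B, hB.biLPlus, h⟩

/-! ### Homomorphism tensors -/

section tensor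

variable {V : Type*} {t : ℕ}

lemma isHom_glue_iff {F F' : FGraph} {r : F.V ⊕ F'.V → F.V ⊕ F'.V → Prop} {G : SimpleGraph V}
    {h : Quot r → V} :
    (BiGraph.glue F F' r).IsHom G h ↔
      F.IsHom G (fun a => h (Quot.mk r (Sum.inl a))) ∧
        F'.IsHom G (fun a => h (Quot.mk r (Sum.inr a))) := by
  constructor
  · intro H
    exact ⟨fun a b hab => H _ _ ⟨_, _, rfl, rfl, hab⟩, fun a b hab => H _ _ ⟨_, _, rfl, rfl, hab⟩⟩
  · rintro ⟨H, H'⟩ _ _ ⟨a | a, b | b, rfl, rfl, hab⟩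
    · exact H _ _ hab
    · exact hab.elim
    · exact hab.elim
    · exact H' _ _ hab

namespace BiGraph

/-- Homomorphisms with prescribed values at the labels. -/
def LabelledHom (F : BiGraph t) (G : SimpleGraph V) (x y : Fin t → V) : Type _ :=
  {h : F.graph.V → V // F.graph.IsHom G h ∧ (∀ i, h (F.lab (Sum.inl i)) = x i) ∧
      (∀ i, h (F.lab (Sum.inr i)) = y i)}

lemma tensor_apply (F : BiGraph t) (G : SimpleGraph V) (x y : Fin t → V) :
    F.tensor G x y = (Nat.card (F.LabelledHom G x y) : ℂ) := rfl

instance [Finite V] (F : BiGraph t) (G : SimpleGraph V) (x y : Fin t → V) :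
    Finite (F.LabelledHom G x y) := by
  have := F.graph.finite
  unfold LabelledHom
  infer_instance

/-- Homomorphisms from a parallel composition are pairs of homomorphisms. -/
def parallelHomEquiv (F F' : BiGraph t) (G : SimpleGraph V) (x y : Fin t → V) :
    (F.parallel F').LabelledHom G x y ≃ F.LabelledHom G x y × F'.LabelledHom G x y where
  toFun h := ⟨⟨fun a => h.1 (Quot.mk _ (Sum.inl a)), (isHom_glue_iff.1 h.2.1).1, h.2.2⟩,
    ⟨fun a => h.1 (Quot.mk _ (Sum.inr a)), (isHom_glue_iff.1 h.2.1).2,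
      fun i => (congrArg h.1 (Quot.sound ⟨_, rfl, rfl⟩ :
        Quot.mk (parallelRel F F') (Sum.inl (F.lab (Sum.inl i))) = _)).symm.trans (h.2.2.1 i),
      fun i => (congrArg h.1 (Quot.sound ⟨_, rfl, rfl⟩ :
        Quot.mk (parallelRel F F') (Sum.inl (F.lab (Sum.inr i))) = _)).symm.trans (h.2.2.2 i)⟩⟩
  invFun p := ⟨Quot.lift (Sum.elim p.1.1 p.2.1) (by
      rintro _ _ ⟨i | i, rfl, rfl⟩
      · exact (p.1.2.2.1 i).trans (p.2.2.2.1 i).symm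
      · exact (p.1.2.2.2 i).trans (p.2.2.2.2 i).symm),
    isHom_glue_iff.2 ⟨p.1.2.1, p.2.2.1⟩, p.1.2.2⟩
  left_inv h := Subtype.ext (funext fun q => by
    obtain ⟨a | a⟩ := q <;> rfl)
  right_inv p := rfl

/-- Homomorphisms from a series composition are pairs of homomorphisms which agree on the
identified labels. -/
def seriesHomEquiv (F F' : BiGraph t) (G : SimpleGraph V) (x y : Fin t → V) :
    (F.series F').LabelledHom G x y ≃
      Σ z : Fin t → V, F.LabelledHom G x z × F'.LabelledHom G z y where
  toFun h := ⟨fun i => h.1 (Quot.mk _ (Sum.inl (F.lab (Sum.inr i)))),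
    ⟨fun a => h.1 (Quot.mk _ (Sum.inl a)), (isHom_glue_iff.1 h.2.1).1, h.2.2.1, fun _ => rfl⟩,
    ⟨fun a => h.1 (Quot.mk _ (Sum.inr a)), (isHom_glue_iff.1 h.2.1).2,
      fun i => (congrArg h.1 (Quot.sound ⟨_, rfl, rfl⟩ :
        Quot.mk (seriesRel F F') (Sum.inl (F.lab (Sum.inr i))) = _)).symm, h.2.2.2⟩⟩
  invFun p := ⟨Quot.lift (Sum.elim p.2.1.1 p.2.2.1) (by
      rintro _ _ ⟨i, rfl, rfl⟩
      exact (p.2.1.2.2.2 i).trans (p.2.2.2.2.1 i).symm),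
    isHom_glue_iff.2 ⟨p.2.1.2.1, p.2.2.2.1⟩, p.2.1.2.2.1, p.2.2.2.2.2⟩
  left_inv h := Subtype.ext (funext fun q => by
    obtain ⟨a | a⟩ := q <;> rfl)
  right_inv := by
    rintro ⟨z, ⟨h, hh, hx, hz⟩, ⟨h', hh', hz', hy⟩⟩
    obtain rfl : z = fun i => h (F.lab (Sum.inr i)) := funext fun i => (hz i).symm
    rfl

lemma tensor_parallel (F F' : BiGraph t) (G : SimpleGraph V) :
    (F.parallel F').tensor G = F.tensor G ⊙ F'.tensor G := by
  ext x y
  rw [Matrix.hadamard_apply, tensor_apply, Nat.card_congr (parallelHomEquiv F F' G x y),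
    Nat.card_prod, Nat.cast_mul]
  rfl

lemma tensor_series [Fintype V] (F F' : BiGraph t) (G : SimpleGraph V) :
    (F.series F').tensor G = F.tensor G * F'.tensor G := by
  classical
  ext x y
  rw [Matrix.mul_apply, tensor_apply, Nat.card_congr (seriesHomEquiv F F' G x y),
    Nat.card_sigma, Nat.cast_sum]
  refine Finset.sum_congr rfl fun z _ => ?_
  rw [Nat.card_prod, Nat.cast_mul]
  rfl

lemma tensor_permute (F : BiGraph t) (σ : Equiv.Perm (Fin t ⊕ Fin t)) (G : SimpleGraph V) :
    (F.permute σ).tensor G = permTensor σ (F.tensor G) := by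
  ext x y
  change _ = F.tensor G _ _
  rw [tensor_apply, tensor_apply]
  congr 1
  refine Nat.card_congr (Equiv.subtypeEquivRight fun h => and_congr_right fun _ => ?_)
  have e : (∀ i, h (F.lab (σ i)) = Sum.elim x y i) ↔
      ∀ i, h (F.lab i) = Sum.elim x y (σ⁻¹ i) := by
    refine ⟨fun H i => ?_, fun H i => ?_⟩
    · rw [← H]
      simp
    · rw [H]
      simp
  rwa [Sum.forall, Sum.forall] at e

/-- Every homomorphism is counted exactly once, at the images of the labels. -/
lemma sum_tensor [Fintype V] (F : BiGraph t) (G : SimpleGraph V) :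
    ∑ x, ∑ y, F.tensor G x y = F.graph.homCount G := by
  classical
  have e : {h : F.graph.V → V // F.graph.IsHom G h} ≃
      Σ z : (Fin t → V) × (Fin t → V), F.LabelledHom G z.1 z.2 :=
    { toFun := fun h => ⟨(fun i => h.1 (F.lab (Sum.inl i)), fun i => h.1 (F.lab (Sum.inr i))),
        h.1, h.2, fun _ => rfl, fun _ => rfl⟩
      invFun := fun p => ⟨p.2.1, p.2.2.1⟩
      left_inv := fun _ => rfl
      right_inv := by
        rintro ⟨⟨x, y⟩, h, hh, hx, hy⟩
        obtain rfl : x = fun i => h (F.lab (Sum.inl i)) := funext fun i => (hx i).symm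
        obtain rfl : y = fun i => h (F.lab (Sum.inr i)) := funext fun i => (hy i).symm
        rfl }
  rw [FGraph.homCount, Nat.card_congr e, Nat.card_sigma, Nat.cast_sum, Fintype.sum_prod_type]
  rfl

end BiGraph

lemma FGraph.Iso.homCount_eq {F F' : FGraph} (h : F.Iso F') (G : SimpleGraph V) :
    F.homCount G = F'.homCount G := by
  obtain ⟨e, he⟩ := h
  refine Nat.card_congr (Equiv.subtypeEquiv (e.arrowCongr (Equiv.refl V)) fun h => ?_)
  constructor
  · intro H a b hab
    exact H _ _ ((he _ _).2 (by simpa using hab))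
  · intro H a b hab
    have := H _ _ ((he a b).1 hab)
    simpa using this

/-! ### Atomic graphs -/

open Classical in
/-- The tensor of an atomic graph is the indicator of a property of the relational type. -/
lemma BiGraph.IsAtomic.tensor_eq {A : BiGraph t} (hA : A.IsAtomic) (G : SimpleGraph V)
    (g : Fin t ⊕ Fin t → V) :
    A.tensor G (fun i => g (Sum.inl i)) (fun i => g (Sum.inr i)) =
      if (∀ i j, A.lab i = A.lab j → g i = g j) ∧
        (∀ i j, A.graph.Adj (A.lab i) (A.lab j) → G.Adj (g i) (g j)) then 1 else 0 := by
  rw [BiGraph.tensor_apply]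
  have key : ∀ h : A.LabelledHom G (fun i => g (Sum.inl i)) (fun i => g (Sum.inr i)),
      ∀ i, h.1 (A.lab i) = g i := by
    rintro h (i | i)
    · exact h.2.2.1 i
    · exact h.2.2.2 i
  have hsub : Subsingleton
      (A.LabelledHom G (fun i => g (Sum.inl i)) (fun i => g (Sum.inr i))) := by
    refine ⟨fun h h' => Subtype.ext (funext fun a => ?_)⟩
    obtain ⟨i, rfl⟩ := hA a
    rw [key, key]
  split_ifs with H
  · obtain ⟨h₁, h₂⟩ := H
    have hs : ∀ i, g (Function.surjInv hA (A.lab i)) = g i := fun i =>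
      h₁ _ _ (Function.surjInv_eq hA _)
    have : Nonempty (A.LabelledHom G (fun i => g (Sum.inl i)) (fun i => g (Sum.inr i))) := by
      refine ⟨⟨fun a => g (Function.surjInv hA a), fun a b hab => h₂ _ _ ?_,
        fun i => hs _, fun i => hs _⟩⟩
      have e := Function.surjInv_eq (f := A.lab) hA
      rwa [e, e]
    rw [Nat.card_eq_one_iff_unique.2 ⟨hsub, this⟩, Nat.cast_one]
  · have : IsEmpty (A.LabelledHom G (fun i => g (Sum.inl i)) (fun i => g (Sum.inr i))) := by
      refine ⟨fun h => H ⟨fun i j hij => ?_, fun i j hij => ?_⟩⟩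
      · rw [← key h, ← key h, hij]
      · rw [← key h, ← key h]
        exact h.2.1 _ _ hij
    rw [Nat.card_of_isEmpty, Nat.cast_zero]

lemma SameType.tensor_eq {W : Type*} {A : BiGraph t} (hA : A.IsAtomic) {G : SimpleGraph V}
    {H : SimpleGraph W} {g : Fin t ⊕ Fin t → V} {h : Fin t ⊕ Fin t → W} (hgh : SameType G H g h) :
    A.tensor G (fun i => g (Sum.inl i)) (fun i => g (Sum.inr i)) =
      A.tensor H (fun i => h (Sum.inl i)) (fun i => h (Sum.inr i)) := by
  classical
  rw [hA.tensor_eq, hA.tensor_eq]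
  congr 1
  refine propext (and_congr ?_ ?_)
  · exact forall₂_congr fun i j => imp_congr_right fun _ => (hgh i j).1
  · exact forall₂_congr fun i j => imp_congr_right fun _ => (hgh i j).2

/-- The edgeless atomic graph whose labels are identified according to `ρ`. -/
def quotGraph (ρ : Fin t ⊕ Fin t → Fin t ⊕ Fin t → Prop) : BiGraph t where
  graph :=
    { V := Quot ρ
      finite := Finite.of_surjective (Quot.mk ρ) Quot.mk_surjective
      Adj := fun _ _ => False
      symm := fun _ _ h => h }
  lab := Quot.mk ρ

lemma isAtomic_quotGraph (ρ : Fin t ⊕ Fin t → Fin t ⊕ Fin t → Prop) : (quotGraph ρ).IsAtomic :=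
  Quot.mk_surjective

open Classical in
lemma tensor_quotGraph (ρ : Fin t ⊕ Fin t → Fin t ⊕ Fin t → Prop) (G : SimpleGraph V)
    (g : Fin t ⊕ Fin t → V) :
    (quotGraph ρ).tensor G (fun i => g (Sum.inl i)) (fun i => g (Sum.inr i)) =
      if ∀ i j, ρ i j → g i = g j then 1 else 0 := by
  rw [(isAtomic_quotGraph ρ).tensor_eq]
  congr 1
  refine propext ⟨fun H i j hij => H.1 i j (Quot.sound hij), fun H => ⟨fun i j hij => ?_,
    fun i j hij => hij.elim⟩⟩
  have := Quot.eqvGen_exact hij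
  clear hij
  induction this with
  | rel i j h => exact H i j h
  | refl => rfl
  | symm _ _ _ ih => exact ih.symm
  | trans _ _ _ _ _ ih ih' => exact ih.trans ih'

/-- The atomic graph with distinct labels and a single edge, between the labels `i` and `j`. -/
def edgeGraph (i j : Fin t ⊕ Fin t) : BiGraph t where
  graph :=
    { V := Fin t ⊕ Fin t
      finite := inferInstance
      Adj := fun a b => (a = i ∧ b = j) ∨ (a = j ∧ b = i)
      symm := fun _ _ h => h.symm.imp And.symm And.symm }
  lab := id

lemma isAtomic_edgeGraph (i j : Fin t ⊕ Fin t) : (edgeGraph i j).IsAtomic :=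
  Function.surjective_id

open Classical in
lemma tensor_edgeGraph (i j : Fin t ⊕ Fin t) (G : SimpleGraph V) (g : Fin t ⊕ Fin t → V) :
    (edgeGraph i j).tensor G (fun i => g (Sum.inl i)) (fun i => g (Sum.inr i)) =
      if G.Adj (g i) (g j) then 1 else 0 := by
  rw [(isAtomic_edgeGraph i j).tensor_eq]
  congr 1
  refine propext ⟨fun H => H.2 i j (Or.inl ⟨rfl, rfl⟩), fun H => ⟨fun a b hab => ?_, ?_⟩⟩
  · obtain rfl : a = b := hab
    rfl
  · rintro a b (⟨ha, hb⟩ | ⟨ha, hb⟩)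
    · rwa [show a = i from ha, show b = j from hb]
    · rw [show a = j from ha, show b = i from hb]
      exact H.symm

/-- Tuples on which all tensors of atomic graphs agree have the same relational type. -/
lemma sameType_of_tensor_eq {W : Type*} {G : SimpleGraph V}
    {H : SimpleGraph W} {g : Fin t ⊕ Fin t → V} {h : Fin t ⊕ Fin t → W}
    (hgh : ∀ A : BiGraph t, A.IsAtomic →
      A.tensor G (fun i => g (Sum.inl i)) (fun i => g (Sum.inr i)) =
        A.tensor H (fun i => h (Sum.inl i)) (fun i => h (Sum.inr i))) : SameType G H g h := by
  classical
  intro i j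
  constructor
  -- Identifying just the labels `i` and `j` tests equality of two entries; a single edge between
  -- them tests adjacency.
  · have := hgh _ (isAtomic_quotGraph fun a b => a = i ∧ b = j)
    rw [tensor_quotGraph, tensor_quotGraph] at this
    simp only [and_imp, forall_eq_apply_imp_iff, forall_eq] at this
    split_ifs at this <;> simp_all
  · have := hgh _ (isAtomic_edgeGraph i j)
    rw [tensor_edgeGraph, tensor_edgeGraph] at this
    split_ifs at this <;> simp_all

/-- The atomic graph whose tensor is the identity matrix. -/
def idGraph (t : ℕ) : BiGraph t := quotGraph fun a b => ∃ i, a = Sum.inl i ∧ b = Sum.inr i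

lemma isAtomic_idGraph : (idGraph t).IsAtomic := isAtomic_quotGraph _

lemma tensor_idGraph [DecidableEq V] (G : SimpleGraph V) : (idGraph t).tensor G = 1 := by
  classical
  ext x y
  have := tensor_quotGraph (fun a b => ∃ i, a = Sum.inl i ∧ b = Sum.inr i) G (Sum.elim x y)
  simp only [Sum.elim_inl, Sum.elim_inr] at this
  rw [idGraph, this, Matrix.one_apply]
  congr 1
  refine propext ⟨fun H => funext fun i => H _ _ ⟨i, rfl, rfl⟩, ?_⟩
  rintro rfl _ _ ⟨i, rfl, rfl⟩
  rfl

lemma tensor_quotGraph_bot (G : SimpleGraph V) :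
    (quotGraph (t := t) fun _ _ => False).tensor G = allOnes _ := by
  classical
  ext x y
  have := tensor_quotGraph (fun _ _ => False) G (Sum.elim x y)
  simp only [Sum.elim_inl, Sum.elim_inr] at this
  simp [this, allOnes]

end tensor

/-! ### Couplings -/

section coupling

/-- A positive semidefinite matrix that describes a doubly stochastic correspondence between pairs
of elements of `α` and pairs of elements of `β`, preserving equality of pairs. -/
structure IsCoupling {α β : Type*} [Fintype α] [Fintype β] (m : Matrix (α × β) (α × β) ℝ) : Prop where
  psd : m.PosSemidef
  zero_left : ∀ a a' b, a ≠ a' → m (a, b) (a', b) = 0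
  zero_right : ∀ a b b', b ≠ b' → m (a, b) (a, b') = 0
  sum_right : ∀ a a', ∑ b, ∑ b', m (a, b) (a', b') = 1
  sum_left : ∀ b b', ∑ a, ∑ a', m (a, b) (a', b') = 1

variable {α β : Type*} [Fintype α]

/-- The linear map with Choi matrix `m`. -/
def choiMap (m : Matrix (α × β) (α × β) ℝ) : Matrix α α ℂ →ₗ[ℂ] Matrix β β ℂ where
  toFun X := Matrix.of fun b b' => ∑ a, ∑ a', (m (a, b) (a', b') : ℂ) * X a a'
  map_add' X Y := by
    ext b b'
    simp [mul_add, Finset.sum_add_distrib]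
  map_smul' c X := by
    ext b b'
    simp [Finset.mul_sum, mul_left_comm]

lemma choiMap_apply (m : Matrix (α × β) (α × β) ℝ) (X : Matrix α α ℂ) (b b' : β) :
    choiMap m X b b' = ∑ a, ∑ a', (m (a, b) (a', b') : ℂ) * X a a' := rfl

/-- The Choi matrix of the transposed map. -/
def choiSwap (m : Matrix (α × β) (α × β) ℝ) : Matrix (β × α) (β × α) ℝ :=
  m.submatrix Prod.swap Prod.swap

namespace IsCoupling

variable [Fintype β] {m : Matrix (α × β) (α × β) ℝ}

lemma swap (hm : IsCoupling m) : IsCoupling (choiSwap m) where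
  psd := hm.psd.submatrix _
  zero_left b b' a h := hm.zero_right a b b' h
  zero_right b a a' h := hm.zero_left a a' b h
  sum_right := hm.sum_left
  sum_left := hm.sum_right

lemma apply_comm (hm : IsCoupling m) (p q : α × β) : m p q = m q p := by
  have := hm.psd.isHermitian.apply q p
  simpa using this

lemma sum_diag_right (hm : IsCoupling m) (a : α) : ∑ b, m (a, b) (a, b) = 1 := by
  rw [← hm.sum_right a a]
  refine Finset.sum_congr rfl fun b _ => (Finset.sum_eq_single
    (f := fun b' => m (a, b) (a, b')) b (fun b' _ h => ?_)
    fun h => (h (Finset.mem_univ _)).elim).symm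
  exact hm.zero_right a b b' h.symm

lemma sum_diag_left (hm : IsCoupling m) (b : β) : ∑ a, m (a, b) (a, b) = 1 :=
  hm.swap.sum_diag_right b

/-- Multiplicative domain of the map with Choi matrix `m`, on the level of entries. -/
lemma sum_mul_eq_real (hm : IsCoupling m) (X : Matrix α α ℝ) (X' : Matrix β β ℝ)
    (h : ∀ b b', ∑ a, ∑ a', m (a, b) (a', b') * X a a' = X' b b')
    (h' : ∀ a a', ∑ b, ∑ b', m (a, b) (a', b') * X' b b' = X a a')
    (a₀ : α) (b₀ : β) (p : α × β) :
    ∑ a, X a a₀ * m (a, b₀) p = ∑ b, X' b₀ b * m (a₀, b) p := by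
  classical
  -- The claim is that coordinate `p` of `m *ᵥ v a₀ b₀` vanishes. As `m` is positive semidefinite,
  -- it suffices that the quadratic form vanishes at `v a₀ b₀`; these values are nonnegative, and
  -- their sum over all `a₀`, `b₀` turns out to be zero.
  let v (a₀ : α) (b₀ : β) (q : α × β) : ℝ :=
    (if q.2 = b₀ then X q.1 a₀ else 0) - (if q.1 = a₀ then X' b₀ q.2 else 0)
  have hv : ∀ a₀ b₀ (f : α × β → ℝ),
      ∑ q, v a₀ b₀ q * f q = ∑ a, X a a₀ * f (a, b₀) - ∑ b, X' b₀ b * f (a₀, b) := by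
    intro a₀ b₀ f
    rw [Fintype.sum_prod_type]
    simp only [v, sub_mul, Finset.sum_sub_distrib, ite_mul, zero_mul, Finset.sum_ite_eq',
      Finset.mem_univ, if_true]
    congr 1
    rw [Finset.sum_comm]
    simp
  have hquad : ∀ a₀ b₀, star (v a₀ b₀) ⬝ᵥ m *ᵥ v a₀ b₀ =
      ∑ a, X a a₀ ^ 2 * m (a, b₀) (a, b₀) + ∑ b, X' b₀ b ^ 2 * m (a₀, b) (a₀, b)
        - (∑ a, ∑ b, X a a₀ * (X' b₀ b * m (a, b₀) (a₀, b))
          + ∑ b, ∑ a, X' b₀ b * (X a a₀ * m (a, b₀) (a₀, b))) := by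
    intro a₀ b₀
    have e : ∀ q, (m *ᵥ v a₀ b₀) q =
        ∑ a, X a a₀ * m q (a, b₀) - ∑ b, X' b₀ b * m q (a₀, b) := by
      intro q
      rw [← hv, Matrix.mulVec, dotProduct]
      exact Finset.sum_congr rfl fun _ _ => mul_comm _ _
    simp only [dotProduct, Pi.star_apply, star_trivial]
    rw [hv]
    simp only [e, mul_sub, Finset.sum_sub_distrib]
    have e₁ : ∀ a, ∑ a', X a' a₀ * m (a, b₀) (a', b₀) = X a a₀ * m (a, b₀) (a, b₀) := fun a =>
      Finset.sum_eq_single a (fun a' _ h => by rw [hm.zero_left _ _ _ h.symm, mul_zero]) (by simp)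
    have e₂ : ∀ b, ∑ b', X' b₀ b' * m (a₀, b) (a₀, b') = X' b₀ b * m (a₀, b) (a₀, b) := fun b =>
      Finset.sum_eq_single b (fun b' _ h => by rw [hm.zero_right _ _ _ h.symm, mul_zero]) (by simp)
    simp only [e₁, e₂, Finset.mul_sum, hm.apply_comm (a₀, _) (_, b₀), ← mul_assoc, ← sq]
    ring
  -- Diagonal entries of `m` sum to one along each row and column, so the square terms give ‖X‖² +
  -- ‖X'‖².
  have hX : ∑ a₀, ∑ b₀, ∑ a, X a a₀ ^ 2 * m (a, b₀) (a, b₀) = ∑ a₀, ∑ a, X a a₀ ^ 2 := by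
    refine Finset.sum_congr rfl fun a₀ _ => ?_
    rw [Finset.sum_comm]
    refine Finset.sum_congr rfl fun a _ => ?_
    rw [← Finset.mul_sum, hm.sum_diag_right, mul_one]
  have hX' : ∑ a₀, ∑ b₀, ∑ b, X' b₀ b ^ 2 * m (a₀, b) (a₀, b) = ∑ b₀, ∑ b, X' b₀ b ^ 2 := by
    rw [Finset.sum_comm]
    refine Finset.sum_congr rfl fun b₀ _ => ?_
    rw [Finset.sum_comm]
    refine Finset.sum_congr rfl fun b _ => ?_
    rw [← Finset.mul_sum, hm.sum_diag_left, mul_one]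
  -- The two cross terms are the same number; evaluating one with `h'` as ‖X‖² and the other with
  -- `h` as ‖X'‖² cancels the square terms exactly.
  have c₁ : ∑ a₀, ∑ b₀, ∑ a, ∑ b, X a a₀ * (X' b₀ b * m (a, b₀) (a₀, b)) =
      ∑ a₀, ∑ a, X a a₀ ^ 2 := by
    refine Finset.sum_congr rfl fun a₀ _ => ?_
    rw [Finset.sum_comm]
    refine Finset.sum_congr rfl fun a _ => ?_
    simp only [← Finset.mul_sum]
    rw [sq, ← h' a a₀]
    simp only [mul_comm]
  have c₂ : ∑ a₀, ∑ b₀, ∑ b, ∑ a, X' b₀ b * (X a a₀ * m (a, b₀) (a₀, b)) =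
      ∑ b₀, ∑ b, X' b₀ b ^ 2 := by
    rw [Finset.sum_comm]
    refine Finset.sum_congr rfl fun b₀ _ => ?_
    rw [Finset.sum_comm]
    refine Finset.sum_congr rfl fun b _ => ?_
    simp only [← Finset.mul_sum]
    rw [sq, ← h b₀ b, Finset.sum_comm]
    simp only [mul_comm]
  have hsum : ∑ a₀, ∑ b₀, star (v a₀ b₀) ⬝ᵥ m *ᵥ v a₀ b₀ = 0 := by
    simp only [hquad, Finset.sum_sub_distrib, Finset.sum_add_distrib, hX, hX', c₁, c₂, sub_self]
  have hzero : star (v a₀ b₀) ⬝ᵥ m *ᵥ v a₀ b₀ = 0 := by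
    have nn : ∀ a b, 0 ≤ star (v a b) ⬝ᵥ m *ᵥ v a b := fun a b => hm.psd.dotProduct_mulVec_nonneg _
    have h₁ := (Finset.sum_eq_zero_iff_of_nonneg fun a _ =>
      Finset.sum_nonneg fun b _ => nn a b).1 hsum a₀ (Finset.mem_univ _)
    exact (Finset.sum_eq_zero_iff_of_nonneg fun b _ => nn a₀ b).1 h₁ b₀ (Finset.mem_univ _)
  have := congrFun ((hm.psd.dotProduct_mulVec_zero_iff _).1 hzero) p
  rw [Pi.zero_apply, Matrix.mulVec, dotProduct] at this
  simp only [hm.apply_comm p, mul_comm (m _ p)] at this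
  rw [hv] at this
  exact sub_eq_zero.1 this

/-- Multiplicative domain of the map with Choi matrix `m`, on the level of entries. -/
lemma sum_mul_eq (hm : IsCoupling m) {X : Matrix α α ℂ} {X' : Matrix β β ℂ}
    (h : choiMap m X = X') (h' : choiMap (choiSwap m) X' = X) (a₀ : α) (b₀ : β) (p : α × β) :
    ∑ a, X a a₀ * (m (a, b₀) p : ℂ) = ∑ b, X' b₀ b * (m (a₀, b) p : ℂ) := by
  -- Since `m` is real, the hypotheses split into real and imaginary parts.
  have hre := hm.sum_mul_eq_real (X.map Complex.re) (X'.map Complex.re)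
    (fun b b' => by
      have := congrArg Complex.re (congrFun (congrFun h b) b')
      simpa [choiMap_apply] using this)
    (fun a a' => by
      have := congrArg Complex.re (congrFun (congrFun h' a) a')
      simpa [choiMap_apply, choiSwap] using this) a₀ b₀ p
  have him := hm.sum_mul_eq_real (X.map Complex.im) (X'.map Complex.im)
    (fun b b' => by
      have := congrArg Complex.im (congrFun (congrFun h b) b')
      simpa [choiMap_apply] using this)
    (fun a a' => by
      have := congrArg Complex.im (congrFun (congrFun h' a) a')
      simpa [choiMap_apply, choiSwap] using this) a₀ b₀ p
  apply Complex.ext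
  · simpa using hre
  · simpa using him

/-- Left multiplication by `X` is moved through `m` by `sum_mul_eq`. Only `X` has to be inverted by
the transposed map; `Y` is arbitrary. -/
lemma choiMap_mul (hm : IsCoupling m) {X : Matrix α α ℂ} {X' : Matrix β β ℂ}
    (h : choiMap m X = X') (h' : choiMap (choiSwap m) X' = X) (Y : Matrix α α ℂ) :
    choiMap m (X * Y) = X' * choiMap m Y := by
  ext b b'
  simp only [choiMap_apply, Matrix.mul_apply, Finset.mul_sum]
  calc ∑ a, ∑ a', ∑ c, (m (a, b) (a', b') : ℂ) * (X a c * Y c a')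
      = ∑ c, ∑ a', Y c a' * ∑ a, X a c * (m (a, b) (a', b') : ℂ) := by
        simp only [Finset.mul_sum]
        rw [Finset.sum_comm]
        conv_rhs => rw [Finset.sum_comm]
        refine Finset.sum_congr rfl fun a' _ => ?_
        rw [Finset.sum_comm]
        refine Finset.sum_congr rfl fun c _ => Finset.sum_congr rfl fun a _ => ?_
        ring
    _ = ∑ c, ∑ a', Y c a' * ∑ d, X' b d * (m (c, d) (a', b') : ℂ) := by
        simp only [hm.sum_mul_eq h h']
    _ = _ := by
        simp only [Finset.mul_sum]
        conv_rhs => rw [Finset.sum_comm]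
        refine Finset.sum_congr rfl fun c _ => ?_
        rw [Finset.sum_comm]
        refine Finset.sum_congr rfl fun d _ => Finset.sum_congr rfl fun a' _ => ?_
        ring

lemma choiMap_star (hm : IsCoupling m) (X : Matrix α α ℂ) :
    choiMap m (star X) = star (choiMap m X) := by
  ext b b'
  simp only [Matrix.star_apply, choiMap_apply, star_sum, star_mul']
  rw [Finset.sum_comm]
  refine Finset.sum_congr rfl fun a _ => Finset.sum_congr rfl fun a' _ => ?_
  rw [hm.apply_comm]
  simp

lemma choiMap_allOnes (hm : IsCoupling m) : choiMap m (allOnes α) = allOnes β := by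
  ext b b'
  have := hm.sum_left b b'
  simp only [choiMap_apply, allOnes, Matrix.of_apply, mul_one]
  exact_mod_cast this

lemma choiMap_one [DecidableEq α] [DecidableEq β] (hm : IsCoupling m) :
    choiMap m (1 : Matrix α α ℂ) = 1 := by
  ext b b'
  simp only [choiMap_apply, Matrix.one_apply, mul_ite, mul_one, mul_zero, Finset.sum_ite_eq,
    Finset.mem_univ, if_true]
  split_ifs with h
  · subst h
    exact_mod_cast hm.sum_diag_left b
  · refine Finset.sum_eq_zero fun a _ => ?_
    rw [hm.zero_right a b b' h, Complex.ofReal_zero]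

lemma card_eq (hm : IsCoupling m) : Fintype.card α = Fintype.card β := by
  have h : ∑ a, ∑ b, m (a, b) (a, b) = (Fintype.card α : ℝ) := by
    simp [hm.sum_diag_right]
  have h' : ∑ b, ∑ a, m (a, b) (a, b) = (Fintype.card β : ℝ) := by
    simp [hm.sum_diag_left]
  rw [Finset.sum_comm, h'] at h
  exact_mod_cast h.symm

end IsCoupling

end coupling

/-! ### Isomorphism matrices and isomorphism maps -/

section isoMatrix

variable {V W : Type*} {t : ℕ}

/-- A matrix indexed by tuples of pairs as a matrix indexed by pairs of tuples. -/
def unzipMatrix (M : Matrix (Fin t → V × W) (Fin t → V × W) ℝ) :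
    Matrix ((Fin t → V) × (Fin t → W)) ((Fin t → V) × (Fin t → W)) ℝ :=
  M.submatrix (fun p i => (p.1 i, p.2 i)) (fun p i => (p.1 i, p.2 i))

/-- A matrix indexed by pairs of tuples as a matrix indexed by tuples of pairs. -/
def zipMatrix (m : Matrix ((Fin t → V) × (Fin t → W)) ((Fin t → V) × (Fin t → W)) ℝ) :
    Matrix (Fin t → V × W) (Fin t → V × W) ℝ :=
  m.submatrix (fun p => (fun i => (p i).1, fun i => (p i).2))
    (fun p => (fun i => (p i).1, fun i => (p i).2))

lemma pairEntry_eq (M : Matrix (Fin t → V × W) (Fin t → V × W) ℝ) (g : Fin t ⊕ Fin t → V)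
    (h : Fin t ⊕ Fin t → W) :
    pairEntry M g h = unzipMatrix M (fun i => g (Sum.inl i), fun i => h (Sum.inl i))
      (fun i => g (Sum.inr i), fun i => h (Sum.inr i)) := rfl

lemma unzipMatrix_apply (M : Matrix (Fin t → V × W) (Fin t → V × W) ℝ) (x y : Fin t → V)
    (u v : Fin t → W) :
    unzipMatrix M (x, u) (y, v) = pairEntry M (Sum.elim x y) (Sum.elim u v) := rfl

lemma pairEntry_zipMatrix (m : Matrix ((Fin t → V) × (Fin t → W)) ((Fin t → V) × (Fin t → W)) ℝ)
    (g : Fin t ⊕ Fin t → V) (h : Fin t ⊕ Fin t → W) :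
    pairEntry (zipMatrix m) g h = m (fun i => g (Sum.inl i), fun i => h (Sum.inl i))
      (fun i => g (Sum.inr i), fun i => h (Sum.inr i)) := rfl

lemma sum_sumArrow {ι κ V R : Type*} [Fintype ι] [Fintype κ] [Fintype V] [DecidableEq ι]
    [DecidableEq κ] [AddCommMonoid R] (f : (ι → V) → (κ → V) → R) :
    ∑ g : ι ⊕ κ → V, f (fun i => g (Sum.inl i)) (fun i => g (Sum.inr i)) = ∑ x, ∑ y, f x y := by
  rw [← Fintype.sum_prod_type']
  exact Fintype.sum_equiv (Equiv.sumArrowEquivProdArrow ι κ V) _ _ fun _ => rfl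

lemma sum_agree_off {ι V R : Type*} [Fintype ι] [DecidableEq ι] [Fintype V]
    [AddCommMonoid R] (k : ι) (a₀ : ι → V) (f : (ι → V) → R)
    (p : (ι → V) → Prop) [DecidablePred p] (hp : ∀ a, p a ↔ ∀ j, j ≠ k → a j = a₀ j) :
    (∑ a, if p a then f a else 0) = ∑ c, f (Function.update a₀ k c) := by
  rw [← Finset.sum_filter]
  refine Finset.sum_nbij' (fun a => a k) (fun c => Function.update a₀ k c) (by simp) ?_ ?_
    (by simp) ?_
  · intro c _
    simp only [Finset.mem_filter, Finset.mem_univ, true_and, hp]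
    intro j hj
    simp [hj]
  · intro a ha
    simp only [Finset.mem_filter, Finset.mem_univ, true_and, hp] at ha
    funext j
    by_cases h : j = k
    · subst h; simp
    · simp [h, ha j h]
  · intro a ha
    simp only [Finset.mem_filter, Finset.mem_univ, true_and, hp] at ha
    congr 1
    funext j
    by_cases h : j = k
    · subst h; simp
    · simp [h, ha j h]

lemma update_inl_comp_inl {ι κ U : Type*} [DecidableEq ι] [DecidableEq κ] (f : ι ⊕ κ → U) (k : ι)
    (c : U) :
    (fun i => Function.update f (Sum.inl k) c (Sum.inl i)) =
      Function.update (fun i => f (Sum.inl i)) k c := by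
  funext i
  by_cases hi : i = k
  · subst hi; simp
  · simp [hi]

/-- The atomic graph whose tensor is the indicator of agreement of tuples off the entry `k`. -/
def agreeOffGraph (k : Fin t) : BiGraph t :=
  quotGraph fun a b => ∃ j, j ≠ k ∧ a = Sum.inl j ∧ b = Sum.inr j

lemma isAtomic_agreeOffGraph (k : Fin t) : (agreeOffGraph k).IsAtomic := isAtomic_quotGraph _

open Classical in
lemma tensor_agreeOffGraph (k : Fin t) (G : SimpleGraph V) (x y : Fin t → V) :
    (agreeOffGraph k).tensor G x y = if ∀ j, j ≠ k → x j = y j then 1 else 0 := by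
  have := tensor_quotGraph (fun a b => ∃ j, j ≠ k ∧ a = Sum.inl j ∧ b = Sum.inr j) G (Sum.elim x y)
  simp only [Sum.elim_inl, Sum.elim_inr] at this
  rw [agreeOffGraph, this]
  congr 1
  refine propext ⟨fun H j hj => H _ _ ⟨j, hj, rfl, rfl⟩, ?_⟩
  rintro H _ _ ⟨j, hj, rfl, rfl⟩
  exact H j hj

/-- The defining properties of a level-`t` isomorphism matrix, except for the equality of marginals,
which follows from the others. -/
structure IsWeakIsoMatrix {V W : Type*} [Fintype V] [Fintype W] [DecidableEq V] [DecidableEq W]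
    (t : ℕ) (G : SimpleGraph V) (H : SimpleGraph W)
    (M : Matrix (Fin t → V × W) (Fin t → V × W) ℝ) : Prop where
  psd : M.PosSemidef
  sum_right : ∀ g : Fin t ⊕ Fin t → V, ∑ h : Fin t ⊕ Fin t → W, pairEntry M g h = 1
  sum_left : ∀ h : Fin t ⊕ Fin t → W, ∑ g : Fin t ⊕ Fin t → V, pairEntry M g h = 1
  zero : ∀ (g : Fin t ⊕ Fin t → V) (h : Fin t ⊕ Fin t → W),
    ¬ SameType G H g h → pairEntry M g h = 0
  symm : ∀ (σ : Equiv.Perm (Fin t ⊕ Fin t)) (g : Fin t ⊕ Fin t → V) (h : Fin t ⊕ Fin t → W),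
    pairEntry M g h = pairEntry M (g ∘ σ) (h ∘ σ)

lemma SameType.symm {ι : Type*} {G : SimpleGraph V} {H : SimpleGraph W} {g : ι → V} {h : ι → W}
    (hgh : SameType G H g h) : SameType H G h g :=
  fun i j => ⟨(hgh i j).1.symm, (hgh i j).2.symm⟩

/-- The transposed isomorphism matrix. -/
def swapMatrix (M : Matrix (Fin t → V × W) (Fin t → V × W) ℝ) :
    Matrix (Fin t → W × V) (Fin t → W × V) ℝ :=
  M.submatrix (fun p i => (p i).swap) (fun p i => (p i).swap)

variable [Fintype V] [Fintype W] [DecidableEq V] [DecidableEq W]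
  {G : SimpleGraph V} {H : SimpleGraph W} {M : Matrix (Fin t → V × W) (Fin t → V × W) ℝ}

lemma IsSPlusIsoMatrix.weak (hM : IsSPlusIsoMatrix t G H M) : IsWeakIsoMatrix t G H M :=
  ⟨hM.psd, hM.sum_right, hM.sum_left, hM.zero, hM.symm⟩

namespace IsWeakIsoMatrix

lemma swap (hM : IsWeakIsoMatrix t G H M) : IsWeakIsoMatrix t H G (swapMatrix M) where
  psd := hM.psd.submatrix _
  sum_right := hM.sum_left
  sum_left := hM.sum_right
  zero h g hgh := hM.zero g h fun H => hgh H.symm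
  symm σ h g := hM.symm σ g h

lemma isCoupling (hM : IsWeakIsoMatrix t G H M) : IsCoupling (unzipMatrix M) where
  psd := hM.psd.submatrix _
  zero_left x x' u hx := by
    refine hM.zero (Sum.elim x x') (Sum.elim u u) fun hs => hx (funext fun i => ?_)
    exact (hs (Sum.inl i) (Sum.inr i)).1.2 rfl
  zero_right x u u' hu := by
    refine hM.zero (Sum.elim x x) (Sum.elim u u') fun hs => hu (funext fun i => ?_)
    exact (hs (Sum.inl i) (Sum.inr i)).1.1 rfl
  sum_right x y := by
    rw [← sum_sumArrow]
    exact hM.sum_right (Sum.elim x y)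
  sum_left u v := by
    rw [← sum_sumArrow]
    exact hM.sum_left (Sum.elim u v)

/-- Wherever `M` is nonzero the two tuples have the same type, and atomic tensors depend on the type
only. -/
lemma choiMap_hadamard (hM : IsWeakIsoMatrix t G H M) (A : BiGraph t) (hA : A.IsAtomic)
    (X : Matrix (Fin t → V) (Fin t → V) ℂ) :
    choiMap (unzipMatrix M) (A.tensor G ⊙ X) = A.tensor H ⊙ choiMap (unzipMatrix M) X := by
  ext u v
  simp only [choiMap_apply, Matrix.hadamard_apply, Finset.mul_sum]
  refine Finset.sum_congr rfl fun x _ => Finset.sum_congr rfl fun y _ => ?_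
  by_cases hs : SameType G H (Sum.elim x y) (Sum.elim u v)
  · have := hs.tensor_eq hA
    simp only [Sum.elim_inl, Sum.elim_inr] at this
    rw [this]
    ring
  · rw [unzipMatrix_apply, hM.zero _ _ hs]
    simp

lemma choiMap_permTensor (hM : IsWeakIsoMatrix t G H M) (σ : Equiv.Perm (Fin t ⊕ Fin t))
    (X : Matrix (Fin t → V) (Fin t → V) ℂ) :
    choiMap (unzipMatrix M) (permTensor σ X) = permTensor σ (choiMap (unzipMatrix M) X) := by
  have key : ∀ (h : Fin t ⊕ Fin t → W) (Y : Matrix (Fin t → V) (Fin t → V) ℂ),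
      choiMap (unzipMatrix M) Y (fun i => h (Sum.inl i)) (fun i => h (Sum.inr i)) =
        ∑ g : Fin t ⊕ Fin t → V, (pairEntry M g h : ℂ) *
          Y (fun i => g (Sum.inl i)) (fun i => g (Sum.inr i)) := by
    intro h Y
    rw [choiMap_apply, ← sum_sumArrow]
    rfl
  ext u v
  change _ = choiMap (unzipMatrix M) X _ _
  rw [key fun i => Sum.elim u v (σ⁻¹ i)]
  have := key (Sum.elim u v) (permTensor σ X)
  simp only [Sum.elim_inl, Sum.elim_inr] at this
  rw [this]
  refine Fintype.sum_equiv (σ.arrowCongr (Equiv.refl V)) _ _ fun g => ?_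
  rw [hM.symm σ⁻¹]
  congr 1
  change X _ _ = X _ _
  congr 1 <;> funext i
  · exact congrArg (fun f => f (σ⁻¹ (Sum.inl i))) (Sum.elim_comp_inl_inr g)
  · exact congrArg (fun f => f (σ⁻¹ (Sum.inr i))) (Sum.elim_comp_inl_inr g)

lemma choiMap_tensor (hM : IsWeakIsoMatrix t G H M) (A : BiGraph t) (hA : A.IsAtomic) :
    choiMap (unzipMatrix M) (A.tensor G) = A.tensor H := by
  have e : A.tensor G ⊙ allOnes _ = A.tensor G := by
    ext x y
    simp [allOnes]
  have e' : A.tensor H ⊙ allOnes _ = A.tensor H := by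
    ext x y
    simp [allOnes]
  rw [← e, hM.choiMap_hadamard A hA, hM.isCoupling.choiMap_allOnes, e']

/-- Being atomic, the indicator of agreement off `k` is carried to its counterpart and back, so
`sum_mul_eq` applies to it. Multiplication by this indicator sums over the entry `k`. -/
lemma sum_update_inl (hM : IsWeakIsoMatrix t G H M) (g : Fin t ⊕ Fin t → V)
    (h : Fin t ⊕ Fin t → W) (k : Fin t) :
    ∑ a : V, pairEntry M (Function.update g (Sum.inl k) a) h =
      ∑ b : W, pairEntry M g (Function.update h (Sum.inl k) b) := by
  classical
  have hA := isAtomic_agreeOffGraph k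
  have := hM.isCoupling.sum_mul_eq (hM.choiMap_tensor _ hA) (hM.swap.choiMap_tensor _ hA)
    (fun i => g (Sum.inl i)) (fun i => h (Sum.inl i))
    (fun i => g (Sum.inr i), fun i => h (Sum.inr i))
  simp only [tensor_agreeOffGraph, ite_mul, one_mul, zero_mul, eq_comm (a := h (Sum.inl _))] at this
  rw [sum_agree_off k (fun i => g (Sum.inl i)) _ _ fun _ => Iff.rfl,
    sum_agree_off k (fun i => h (Sum.inl i)) _ _ fun _ => Iff.rfl] at this
  simp only [pairEntry_eq, update_inl_comp_inl]
  simp only [Function.update_of_ne (Sum.inr_ne_inl : Sum.inr _ ≠ Sum.inl k)]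
  exact_mod_cast this

/-- The equality of marginals follows from the other properties of an isomorphism matrix. -/
lemma isSPlusIsoMatrix (hM : IsWeakIsoMatrix t G H M) : IsSPlusIsoMatrix t G H M where
  psd := hM.psd
  sum_right := hM.sum_right
  sum_left := hM.sum_left
  zero := hM.zero
  symm := hM.symm
  sum_eq_sum g h i := by
    rcases i with k | k
    · exact hM.sum_update_inl g h k
    -- Exchanging the two halves turns an out-label into an in-label.
    · have e := hM.sum_update_inl (g ∘ Equiv.sumComm _ _) (h ∘ Equiv.sumComm _ _) k
      rw [Finset.sum_congr rfl fun a _ => hM.symm (Equiv.sumComm _ _) _ _,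
        Finset.sum_congr rfl fun b _ => hM.symm (Equiv.sumComm _ _) g _]
      convert e using 3 with a _ b
      · exact Function.update_comp_equiv g (Equiv.sumComm (Fin t) (Fin t)) (Sum.inr k) a
      · exact Function.update_comp_equiv h (Equiv.sumComm (Fin t) (Fin t)) (Sum.inr k) b

end IsWeakIsoMatrix

end isoMatrix

/-- Summing the blocks of a positive semidefinite matrix preserves positive semidefiniteness. -/
lemma Matrix.PosSemidef.sum_blocks {κ α : Type*} [Fintype κ] [Fintype α] [DecidableEq κ]
    {Z : Matrix (κ × α) (κ × α) ℝ} (hZ : Z.PosSemidef) :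
    (Matrix.of fun s s' => ∑ a, ∑ a', Z (s, a) (s', a')).PosSemidef := by
  let C : Matrix (κ × α) κ ℝ := Matrix.of fun p s => if p.1 = s then 1 else 0
  have := hZ.conjTranspose_mul_mul_same C
  convert this using 1
  ext s s'
  simp only [Matrix.mul_apply, Matrix.conjTranspose_apply, C, Matrix.of_apply, star_trivial,
    Fintype.sum_prod_type, ite_mul, mul_ite, one_mul, mul_one, zero_mul, mul_zero]
  have e : ∀ (f : κ → α → ℝ) s, ∑ x, ∑ y, (if x = s then f x y else 0) = ∑ y, f s y := by
    intro f s
    rw [Finset.sum_comm]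
    simp
  rw [e]
  simp only [e]
  rw [Finset.sum_comm]

/-- The ampliation is a block sum of the Schur product of the pull-backs of `m` and `Y` to the index
set `(Fin r × β) × α`; both operations preserve positivity. -/
lemma isRealPSD_ampliation_choiMap {α β : Type*} [Fintype α] [Fintype β]
    {m : Matrix (α × β) (α × β) ℝ} (hm : m.PosSemidef) (r : ℕ)
    (X : Matrix (Fin r × α) (Fin r × α) ℂ) (hX : IsRealPSD X) :
    IsRealPSD (ampliation r (choiMap m) X) := by
  classical
  obtain ⟨Y, hY, rfl⟩ := hX
  have h₁ := hm.submatrix fun p : (Fin r × β) × α => (p.2, p.1.2)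
  have h₂ := hY.submatrix fun p : (Fin r × β) × α => (p.1.1, p.2)
  refine ⟨_, (h₁.hadamard h₂).sum_blocks, ?_⟩
  ext p q
  simp [ampliation, choiMap_apply]

/-! ### Isomorphism maps and their Choi matrices -/

section isoMap

variable {V W : Type*} [Fintype V] [Fintype W] [DecidableEq V] [DecidableEq W] {t : ℕ}
  {G : SimpleGraph V} {H : SimpleGraph W}

lemma choiMap_single {α β : Type*} [Fintype α] [DecidableEq α] (m : Matrix (α × β) (α × β) ℝ)
    (a a' : α) (b b' : β) :
    choiMap m (Matrix.single a a' 1) b b' = (m (a, b) (a', b') : ℂ) := by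
  simp [choiMap_apply, Matrix.single_apply, ite_and]

lemma IsWeakIsoMatrix.isSPlusIsoMap {M : Matrix (Fin t → V × W) (Fin t → V × W) ℝ}
    (hM : IsWeakIsoMatrix t G H M) : IsSPlusIsoMap t G H (choiMap (unzipMatrix M)) where
  completely_preserving := isRealPSD_ampliation_choiMap hM.isCoupling.psd
  map_hadamard A hA X := hM.choiMap_hadamard A hA X
  map_allOnes := hM.isCoupling.choiMap_allOnes
  adjoint_allOnes := by
    ext x y
    have := hM.isCoupling.sum_right x y
    simp only [hsAdjoint, choiMap_single, allOnes, Matrix.of_apply, mul_one]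
    simp only [Complex.star_def, Complex.conj_ofReal]
    exact_mod_cast this
  map_perm := hM.choiMap_permTensor

/-- The rank one matrix of the vector v = ∑ e_a ⊗ e_a has the matrix units as its blocks. Applying
the ampliation of size |α| to it therefore assembles the Choi matrix, which is real and positive
semidefinite by `hΦ`. -/
lemma exists_choi {α β : Type*} [Fintype α] [DecidableEq α]
    (Φ : Matrix α α ℂ →ₗ[ℂ] Matrix β β ℂ)
    (hΦ : ∀ (r : ℕ) (X : Matrix (Fin r × α) (Fin r × α) ℂ),
      IsRealPSD X → IsRealPSD (ampliation r Φ X)) :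
    ∃ m : Matrix (α × β) (α × β) ℝ, m.PosSemidef ∧ Φ = choiMap m := by
  classical
  let e := Fintype.equivFin α
  let v : Fin (Fintype.card α) × α → ℝ := fun p => if e p.2 = p.1 then 1 else 0
  obtain ⟨Z, hZ, hZX⟩ := hΦ (Fintype.card α)
    ((Matrix.vecMulVec v (star v)).map fun a => (a : ℂ))
    ⟨_, Matrix.posSemidef_vecMulVec_self_star v, rfl⟩
  have hent : ∀ a b a' b', Φ (Matrix.single a a' 1) b b' = (Z (e a, b) (e a', b') : ℂ) := by
    intro a b a' b'
    have := congrFun (congrFun hZX (e a, b)) (e a', b')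
    rw [Matrix.map_apply] at this
    rw [← this]
    simp only [ampliation, Matrix.of_apply]
    refine congrArg (fun A => Φ A b b') ?_
    ext i j
    simp only [Matrix.single_apply, Matrix.map_apply, Matrix.vecMulVec_apply, v,
      star_trivial, EmbeddingLike.apply_eq_iff_eq, eq_comm (b := a), eq_comm (b := a'), ite_and,
      Matrix.of_apply]
    split_ifs <;> simp
  refine ⟨Z.submatrix (fun p => (e p.1, p.2)) (fun p => (e p.1, p.2)), hZ.submatrix _, ?_⟩
  refine LinearMap.ext fun X => ?_
  rw [Matrix.matrix_eq_sum_single X]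
  simp only [map_sum]
  refine Finset.sum_congr rfl fun a _ => Finset.sum_congr rfl fun a' _ => ?_
  have : Matrix.single a a' (X a a') = X a a' • Matrix.single a a' (1 : ℂ) := by simp
  rw [this, map_smul, map_smul]
  congr 1
  ext b b'
  rw [hent, choiMap_single]
  rfl

lemma permTensor_apply {U : Type*} (σ : Equiv.Perm (Fin t ⊕ Fin t))
    (A : Matrix (Fin t → U) (Fin t → U) ℂ) (w : Fin t ⊕ Fin t → U) :
    permTensor σ A (fun i => w (Sum.inl i)) (fun i => w (Sum.inr i)) =
      A (fun i => (w ∘ ⇑σ⁻¹) (Sum.inl i)) (fun i => (w ∘ ⇑σ⁻¹) (Sum.inr i)) := by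
  have e : Sum.elim (fun i => w (Sum.inl i)) (fun i => w (Sum.inr i)) = w :=
    Sum.elim_comp_inl_inr w
  simp only [permTensor, Matrix.of_apply, e, Function.comp_apply]

lemma single_apply_tuple {V : Type*} [DecidableEq V] (g w : Fin t ⊕ Fin t → V) :
    Matrix.single (fun i => g (Sum.inl i)) (fun i => g (Sum.inr i)) (1 : ℂ)
      (fun i => w (Sum.inl i)) (fun i => w (Sum.inr i)) = if g = w then 1 else 0 := by
  simp only [Matrix.single_apply, funext_iff, Sum.forall]

/-- A matrix unit is an eigenvector of every Schur multiplication, so at a nonzero entry of the Choi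
matrix all atomic tensors for G and H agree, which forces equal types. Label permutations permute
the matrix units, which gives the symmetry. -/
lemma IsSPlusIsoMap.exists_isWeakIsoMatrix
    {Φ : Matrix (Fin t → V) (Fin t → V) ℂ →ₗ[ℂ] Matrix (Fin t → W) (Fin t → W) ℂ}
    (hΦ : IsSPlusIsoMap t G H Φ) :
    ∃ M : Matrix (Fin t → V × W) (Fin t → V × W) ℝ, IsWeakIsoMatrix t G H M := by
  obtain ⟨m, hm, rfl⟩ := exists_choi Φ hΦ.completely_preserving
  have hent : ∀ g h, (pairEntry (zipMatrix m) g h : ℂ) =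
      choiMap m (Matrix.single (fun i => g (Sum.inl i)) (fun i => g (Sum.inr i)) 1)
        (fun i => h (Sum.inl i)) (fun i => h (Sum.inr i)) := by
    intro g h
    rw [choiMap_single, pairEntry_zipMatrix]
  refine ⟨zipMatrix m, hm.submatrix _, fun g => ?_, fun h => ?_, fun g h hgh => ?_,
    fun σ g h => ?_⟩
  · have := congrFun (congrFun hΦ.adjoint_allOnes fun i => g (Sum.inl i)) fun i => g (Sum.inr i)
    simp only [hsAdjoint, choiMap_single, allOnes, Matrix.of_apply, mul_one, Complex.star_def,
      Complex.conj_ofReal] at this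
    rw [← sum_sumArrow] at this
    exact_mod_cast this
  · have := congrFun (congrFun hΦ.map_allOnes fun i => h (Sum.inl i)) fun i => h (Sum.inr i)
    simp only [choiMap_apply, allOnes, Matrix.of_apply, mul_one] at this
    rw [← sum_sumArrow] at this
    exact_mod_cast this
  · by_contra hne
    refine hgh (sameType_of_tensor_eq fun A hA => ?_)
    have := congrFun (congrFun (hΦ.map_hadamard A hA (Matrix.single (fun i => g (Sum.inl i))
      (fun i => g (Sum.inr i)) 1)) fun i => h (Sum.inl i)) fun i => h (Sum.inr i)
    have e : A.tensor G ⊙ Matrix.single (fun i => g (Sum.inl i)) (fun i => g (Sum.inr i)) 1 =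
        A.tensor G (fun i => g (Sum.inl i)) (fun i => g (Sum.inr i)) •
          Matrix.single (fun i => g (Sum.inl i)) (fun i => g (Sum.inr i)) (1 : ℂ) := by
      ext x y
      simp only [Matrix.hadamard_apply, Matrix.smul_apply, Matrix.single_apply, smul_eq_mul]
      split_ifs with h
      · rw [h.1, h.2]
      · simp
    rw [e, map_smul, Matrix.smul_apply, smul_eq_mul, Matrix.hadamard_apply, ← hent] at this
    exact mul_right_cancel₀ (by exact_mod_cast hne) this
  · have := congrFun (congrFun (hΦ.map_perm σ⁻¹ (Matrix.single (fun i => (g ∘ σ) (Sum.inl i))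
      (fun i => (g ∘ σ) (Sum.inr i)) 1)) fun i => h (Sum.inl i)) fun i => h (Sum.inr i)
    have e : permTensor σ⁻¹ (Matrix.single (fun i => (g ∘ σ) (Sum.inl i))
        (fun i => (g ∘ σ) (Sum.inr i)) (1 : ℂ)) =
          Matrix.single (fun i => g (Sum.inl i)) (fun i => g (Sum.inr i)) 1 := by
      ext x y
      obtain ⟨w, rfl, rfl⟩ : ∃ w : Fin t ⊕ Fin t → V,
          x = (fun i => w (Sum.inl i)) ∧ y = fun i => w (Sum.inr i) := ⟨Sum.elim x y, rfl, rfl⟩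
      rw [permTensor_apply, inv_inv]
      erw [single_apply_tuple, single_apply_tuple]
      congr 1
      exact propext ⟨fun h => σ.surjective.injective_comp_right h, fun h => h ▸ rfl⟩
    rw [e, ← hent, permTensor_apply, inv_inv] at this
    erw [← hent (g ∘ σ) (h ∘ σ)] at this
    exact_mod_cast this

end isoMap

/-! ### Partially coherent algebras -/

section algebra

variable {V W : Type*} [Fintype V] [Fintype W] [DecidableEq V] [DecidableEq W] {t : ℕ}
  {G : SimpleGraph V} {H : SimpleGraph W} {M : Matrix (Fin t → V × W) (Fin t → V × W) ℝ}

namespace IsWeakIsoMatrix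

lemma choiMap_mul (hM : IsWeakIsoMatrix t G H M) {X : Matrix (Fin t → V) (Fin t → V) ℂ}
    (hX : choiMap (unzipMatrix (swapMatrix M)) (choiMap (unzipMatrix M) X) = X)
    (Y : Matrix (Fin t → V) (Fin t → V) ℂ) :
    choiMap (unzipMatrix M) (X * Y) = choiMap (unzipMatrix M) X * choiMap (unzipMatrix M) Y :=
  hM.isCoupling.choiMap_mul rfl hX Y

/-- The matrices on which the map given by `M` is inverted by its transpose, and whose images
are in the algebra of `H`. -/
def starSubalgebra (hM : IsWeakIsoMatrix t G H M) :
    StarSubalgebra ℂ (Matrix (Fin t → V) (Fin t → V) ℂ) where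
  carrier := {X | choiMap (unzipMatrix (swapMatrix M)) (choiMap (unzipMatrix M) X) = X ∧
    choiMap (unzipMatrix M) X ∈ pcAlgebra t H}
  mul_mem' := by
    rintro X Y ⟨hX, hX'⟩ ⟨hY, hY'⟩
    refine ⟨?_, ?_⟩
    -- The image of `X` is in turn inverted, with the roles of the two maps exchanged, so the way
    -- back is multiplicative too.
    · rw [hM.choiMap_mul hX, hM.swap.choiMap_mul (X := choiMap (unzipMatrix M) X) (congrArg _ hX), hX, hY]
    · rw [hM.choiMap_mul hX]
      exact mul_mem hX' hY'
  add_mem' := by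
    rintro X Y ⟨hX, hX'⟩ ⟨hY, hY'⟩
    refine ⟨?_, ?_⟩
    · rw [map_add, map_add, hX, hY]
    · rw [map_add]
      exact add_mem hX' hY'
  algebraMap_mem' c := by
    have e := hM.isCoupling.choiMap_one
    have e' := hM.swap.isCoupling.choiMap_one
    refine ⟨?_, ?_⟩
    · rw [Algebra.algebraMap_eq_smul_one, map_smul, map_smul, e, e']
    · rw [Algebra.algebraMap_eq_smul_one, map_smul, e]
      exact SMulMemClass.smul_mem c (one_mem _)
  star_mem' := by
    rintro X ⟨hX, hX'⟩
    refine ⟨?_, ?_⟩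
    · rw [hM.isCoupling.choiMap_star, hM.swap.isCoupling.choiMap_star, hX]
    · rw [hM.isCoupling.choiMap_star]
      exact star_mem hX'

lemma isPartiallyCoherent (hM : IsWeakIsoMatrix t G H M) :
    IsPartiallyCoherent t G hM.starSubalgebra where
  allOnes_mem := by
    refine ⟨?_, ?_⟩
    · rw [hM.isCoupling.choiMap_allOnes, hM.swap.isCoupling.choiMap_allOnes]
    · rw [hM.isCoupling.choiMap_allOnes]
      exact (pcAlgebra_isPartiallyCoherent t H).allOnes_mem
  hadamard_mem := by
    rintro A hA X ⟨hX, hX'⟩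
    refine ⟨?_, ?_⟩
    · rw [hM.choiMap_hadamard A hA, hM.swap.choiMap_hadamard A hA, hX]
    · rw [hM.choiMap_hadamard A hA]
      exact (pcAlgebra_isPartiallyCoherent t H).hadamard_mem A hA _ hX'
  perm_mem := by
    rintro σ X ⟨hX, hX'⟩
    refine ⟨?_, ?_⟩
    · rw [hM.choiMap_permTensor, hM.swap.choiMap_permTensor, hX]
    · rw [hM.choiMap_permTensor]
      exact (pcAlgebra_isPartiallyCoherent t H).perm_mem σ _ hX'

/-- This is the minimality of `pcAlgebra`; it makes the two Choi maps mutually inverse between the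
two algebras. -/
lemma mem_starSubalgebra (hM : IsWeakIsoMatrix t G H M)
    {X : Matrix (Fin t → V) (Fin t → V) ℂ} (hX : X ∈ pcAlgebra t G) :
    choiMap (unzipMatrix (swapMatrix M)) (choiMap (unzipMatrix M) X) = X ∧
      choiMap (unzipMatrix M) X ∈ pcAlgebra t H :=
  (sInf_le hM.isPartiallyCoherent : pcAlgebra t G ≤ hM.starSubalgebra) hX

/-- The isomorphism of partially coherent algebras given by an isomorphism matrix. -/
noncomputable def algebraEquiv (hM : IsWeakIsoMatrix t G H M) :
    pcAlgebra t G ≃ₗ[ℂ] pcAlgebra t H where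
  toFun X := ⟨choiMap (unzipMatrix M) X.1, (hM.mem_starSubalgebra X.2).2⟩
  map_add' _ _ := Subtype.ext (map_add _ _ _)
  map_smul' _ _ := Subtype.ext (map_smul _ _ _)
  invFun Y := ⟨choiMap (unzipMatrix (swapMatrix M)) Y.1, (hM.swap.mem_starSubalgebra Y.2).2⟩
  left_inv X := Subtype.ext (hM.mem_starSubalgebra X.2).1
  right_inv Y := Subtype.ext (hM.swap.mem_starSubalgebra Y.2).1

lemma partiallyEquivalent (ht : 1 ≤ t) (hM : IsWeakIsoMatrix t G H M) :
    PartiallyEquivalent t G H := by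
  refine ⟨?_, hM.algebraEquiv, ?_⟩
  -- The coupling compares numbers of tuples, |V|^t = |W|^t, and roots can be taken as t is
  -- positive.
  · have := hM.isCoupling.card_eq
    rw [Fintype.card_fun, Fintype.card_fun, Fintype.card_fin] at this
    exact Nat.pow_left_injective (by omega) this
  · exact {
      map_star := fun X => Subtype.ext (hM.isCoupling.choiMap_star X.1)
      map_mul := fun X Y => Subtype.ext (hM.choiMap_mul (hM.mem_starSubalgebra X.2).1 Y.1)
      map_one := Subtype.ext hM.isCoupling.choiMap_one
      map_atom := fun A hA => Subtype.ext (hM.choiMap_tensor A hA)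
      map_ones := Subtype.ext hM.isCoupling.choiMap_allOnes
      map_schur := fun A hA X => Subtype.ext (hM.choiMap_hadamard A hA X.1)
      map_perm := fun σ X => Subtype.ext (hM.choiMap_permTensor σ X.1) }

end IsWeakIsoMatrix

/-- The generating rules of `BiL` match the operations that `φ` respects. Since `φ` respects Schur
products with atomic tensors only, parallel composition is restricted accordingly. -/
lemma BiL.exists_map_tensor {φ : pcAlgebra t G ≃ₗ[ℂ] pcAlgebra t H}
    (hφ : IsPartialEquivalence t G H φ) {F : BiGraph t} (hF : BiL t F) :
    ∃ X : pcAlgebra t G, X.1 = F.tensor G ∧ (φ X).1 = F.tensor H := by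
  induction hF with
  | atomic A hA =>
    exact ⟨pcAlgebra.atom G A hA, rfl, by rw [hφ.map_atom]; rfl⟩
  | parallel A F hA _ ih =>
    obtain ⟨X, hX, hX'⟩ := ih
    refine ⟨pcAlgebra.schur A hA X, ?_, ?_⟩
    · rw [BiGraph.tensor_parallel, ← hX]; rfl
    · rw [BiGraph.tensor_parallel, ← hX', hφ.map_schur]; rfl
  | series F F' _ _ ih ih' =>
    obtain ⟨X, hX, hX'⟩ := ih
    obtain ⟨Y, hY, hY'⟩ := ih'
    refine ⟨X * Y, ?_, ?_⟩
    · rw [BiGraph.tensor_series, ← hX, ← hY]; rfl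
    · rw [BiGraph.tensor_series, ← hX', ← hY', hφ.map_mul]; rfl
  | permute F σ _ ih =>
    obtain ⟨X, hX, hX'⟩ := ih
    refine ⟨pcAlgebra.perm σ X, ?_, ?_⟩
    · rw [BiGraph.tensor_permute, ← hX]; rfl
    · rw [BiGraph.tensor_permute, ← hX', hφ.map_perm]; rfl

lemma allOnes_mul_mul_allOnes {ι : Type*} [Fintype ι] (X : Matrix ι ι ℂ) :
    allOnes ι * X * allOnes ι = (∑ x, ∑ y, X x y) • allOnes ι := by
  ext i j
  simp only [Matrix.mul_apply, allOnes, Matrix.of_apply, one_mul, mul_one, Matrix.smul_apply,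
    smul_eq_mul]
  exact Finset.sum_comm

lemma homCount_eq_of_isEmpty {V W : Type*} [IsEmpty V] [IsEmpty W] (F : FGraph)
    (G : SimpleGraph V) (H : SimpleGraph W) : F.homCount G = F.homCount H := by
  refine Nat.card_congr (Equiv.subtypeEquiv (Equiv.arrowCongr (Equiv.refl _)
    (Equiv.equivOfIsEmpty V W)) fun h => ?_)
  exact ⟨fun _ a => isEmptyElim (h a), fun _ a => isEmptyElim (h a)⟩

lemma homCount_eq_one {F : FGraph} (hF : IsEmpty F.V) {V : Type*} (G : SimpleGraph V) :
    F.homCount G = 1 :=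
  Nat.card_eq_one_iff_unique.2 ⟨⟨fun _ _ => Subtype.ext (funext fun a => hF.elim a)⟩,
    ⟨⟨fun a => hF.elim a, fun a => hF.elim a⟩⟩⟩

lemma PartiallyEquivalent.homIndistinguishable (h : PartiallyEquivalent t G H) :
    HomIndistinguishable (LClass t) G H := by
  obtain ⟨hcard, φ, hφ⟩ := h
  rintro F (hF | ⟨B, hB, hiso⟩)
  · rw [homCount_eq_one hF, homCount_eq_one hF]
  rw [hiso.homCount_eq, hiso.homCount_eq]
  -- The counts are read off as scalar multiples of the all-ones matrix, which needs an entry to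
  -- look at. Without vertices on one side, equality of cardinalities settles the claim.
  rcases isEmpty_or_nonempty W with hW | hW
  · have : IsEmpty V := by
      rw [← Fintype.card_eq_zero_iff] at hW ⊢
      rw [hcard, hW]
    exact homCount_eq_of_isEmpty _ G H
  obtain ⟨X, hX, hX'⟩ := hB.exists_map_tensor hφ
  have e : pcAlgebra.ones t G * X * pcAlgebra.ones t G =
      (B.graph.homCount G : ℂ) • pcAlgebra.ones t G := by
    apply Subtype.ext
    change allOnes _ * X.1 * allOnes _ = _ • allOnes _
    rw [allOnes_mul_mul_allOnes, hX, BiGraph.sum_tensor]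
  have e' : pcAlgebra.ones t H * φ X * pcAlgebra.ones t H =
      (B.graph.homCount H : ℂ) • pcAlgebra.ones t H := by
    apply Subtype.ext
    change allOnes _ * (φ X).1 * allOnes _ = _ • allOnes _
    rw [allOnes_mul_mul_allOnes, hX', BiGraph.sum_tensor]
  have := congrArg φ e
  rw [hφ.map_mul, hφ.map_mul, map_smul, hφ.map_ones, e'] at this
  have := congrFun (congrFun (congrArg Subtype.val this) fun _ => Classical.arbitrary W)
    fun _ => Classical.arbitrary W
  have : (B.graph.homCount H : ℂ) * 1 = B.graph.homCount G * 1 := this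
  rw [mul_one, mul_one] at this
  exact_mod_cast this.symm

end algebra

/-! ### Frames of isometric pairs of matrices -/

section frame

variable {α β : Type*} [Fintype α] [Fintype β]

/-- The Hilbert–Schmidt inner product of real matrices. -/
def hsInner (X Y : Matrix α α ℝ) : ℝ := ∑ i, ∑ j, X i j * Y i j

lemma hsInner_comm (X Y : Matrix α α ℝ) : hsInner X Y = hsInner Y X := by
  simp only [hsInner, mul_comm]

lemma hsInner_eq_trace (X Y : Matrix α α ℝ) : hsInner X Y = (X * Yᵀ).trace := rfl

lemma hsInner_self_eq_zero {X : Matrix α α ℝ} (h : hsInner X X = 0) : X = 0 := by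
  ext i j
  have nn : ∀ i j, 0 ≤ X i j * X i j := fun i j => mul_self_nonneg _
  have h₁ := (Finset.sum_eq_zero_iff_of_nonneg fun i _ =>
    Finset.sum_nonneg fun j _ => nn i j).1 h i (Finset.mem_univ _)
  have h₂ := (Finset.sum_eq_zero_iff_of_nonneg fun j _ => nn i j).1 h₁ j (Finset.mem_univ _)
  exact mul_self_eq_zero.1 h₂

/-- `b` is an orthonormal basis of the space `S` of pairs of matrices, whose two components have the
same inner products. -/
structure IsFrame (S : Submodule ℝ (Matrix α α ℝ × Matrix β β ℝ)) {n : ℕ}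
    (b : Fin n → Matrix α α ℝ × Matrix β β ℝ) : Prop where
  iso : ∀ p ∈ S, ∀ q ∈ S, hsInner p.1 q.1 = hsInner p.2 q.2
  mem : ∀ k, b k ∈ S
  expand : ∀ p ∈ S, ∑ k, hsInner (b k).1 p.1 • b k = p

/-- A pair in `S` is determined by its left component: if that is zero, the right component has norm
zero. Hence an orthonormal basis of the space of left components lifts to `S`. -/
lemma exists_isFrame (S : Submodule ℝ (Matrix α α ℝ × Matrix β β ℝ))
    (hS : ∀ p ∈ S, ∀ q ∈ S, hsInner p.1 q.1 = hsInner p.2 q.2) :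
    ∃ (n : ℕ) (b : Fin n → Matrix α α ℝ × Matrix β β ℝ), IsFrame S b := by
  let f : S →ₗ[ℝ] EuclideanSpace ℝ (α × α) :=
    { toFun := fun p => WithLp.toLp 2 fun ij => p.1.1 ij.1 ij.2
      map_add' := fun _ _ => rfl
      map_smul' := fun _ _ => rfl }
  have hf : ∀ p q : S, inner ℝ (f p) (f q) = hsInner p.1.1 q.1.1 := by
    intro p q
    change (fun ij : α × α => q.1.1 ij.1 ij.2) ⬝ᵥ star (fun ij : α × α => p.1.1 ij.1 ij.2) = _
    simp only [dotProduct, Fintype.sum_prod_type, hsInner, Pi.star_apply, star_trivial, mul_comm]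
  have hinj : Function.Injective f := by
    rw [injective_iff_map_eq_zero]
    intro p hp
    have h₁ : hsInner p.1.1 p.1.1 = 0 := by rw [← hf, hp, inner_zero_left]
    have h₂ := hS _ p.2 _ p.2
    rw [h₁] at h₂
    exact Subtype.ext (Prod.ext (hsInner_self_eq_zero h₁) (hsInner_self_eq_zero h₂.symm))
  let e := stdOrthonormalBasis ℝ (LinearMap.range f)
  choose c hc using fun k => (e k).2
  refine ⟨_, fun k => (c k).1, hS, fun k => (c k).2, fun p hp => ?_⟩
  have := e.sum_repr' ⟨f ⟨p, hp⟩, ⟨p, hp⟩, rfl⟩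
  have h' : f (∑ k, hsInner (c k).1.1 p.1 • c k) = f ⟨p, hp⟩ := by
    rw [map_sum]
    have := congrArg Subtype.val this
    rw [AddSubmonoidClass.coe_finsetSum] at this
    refine Eq.trans (Finset.sum_congr rfl fun k _ => ?_) this
    rw [map_smul, hc, Submodule.coe_smul, Submodule.coe_inner, ← hc, hf]
  have := congrArg Subtype.val (hinj h')
  simpa using this

namespace IsFrame

variable {S : Submodule ℝ (Matrix α α ℝ × Matrix β β ℝ)} {n : ℕ}
  {b : Fin n → Matrix α α ℝ × Matrix β β ℝ}

lemma expand_left (hb : IsFrame S b) {p} (hp : p ∈ S) (x y : α) :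
    ∑ k, hsInner (b k).1 p.1 * (b k).1 x y = p.1 x y := by
  have := congrArg (fun q => q.1 x y) (hb.expand p hp)
  simpa [Prod.fst_sum, Matrix.sum_apply] using this

lemma expand_right (hb : IsFrame S b) {p} (hp : p ∈ S) (u v : β) :
    ∑ k, hsInner (b k).1 p.1 * (b k).2 u v = p.2 u v := by
  have := congrArg (fun q => q.2 u v) (hb.expand p hp)
  simpa [Prod.snd_sum, Matrix.sum_apply] using this

/-- An operator on the left components can be replaced by its adjoint on the right components. -/
lemma sum_adjoint (hb : IsFrame S b) {c d : Fin n → Matrix α α ℝ × Matrix β β ℝ}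
    (hc : ∀ k, c k ∈ S) (hd : ∀ k, d k ∈ S)
    (hcd : ∀ k l, hsInner (c k).1 (b l).1 = hsInner (b k).1 (d l).1) (x y : α) (u v : β) :
    ∑ k, (c k).1 x y * (b k).2 u v = ∑ l, (b l).1 x y * (d l).2 u v := by
  simp only [← hb.expand_left (hc _) x y, ← hb.expand_right (hd _) u v, Finset.sum_mul,
    Finset.mul_sum]
  rw [Finset.sum_comm]
  refine Finset.sum_congr rfl fun l _ => Finset.sum_congr rfl fun k _ => ?_
  rw [hsInner_comm (b l).1, hcd]
  ring

/-- The Choi matrix of the isometry. -/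
def choi {α β : Type*} {n : ℕ} (b : Fin n → Matrix α α ℝ × Matrix β β ℝ) : Matrix (α × β) (α × β) ℝ :=
  Matrix.of fun p q => ∑ k, (b k).1 p.1 q.1 * (b k).2 p.2 q.2

lemma choi_apply {α β : Type*} {n : ℕ} (b : Fin n → Matrix α α ℝ × Matrix β β ℝ) (x y : α) (u v : β) :
    choi b (x, u) (y, v) = ∑ k, (b k).1 x y * (b k).2 u v := rfl

open scoped Kronecker in
lemma choi_eq_sum {α β : Type*} {n : ℕ} (b : Fin n → Matrix α α ℝ × Matrix β β ℝ) :
    choi b = ∑ k, (b k).1 ⊗ₖ (b k).2 := by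
  ext ⟨x, u⟩ ⟨y, v⟩
  rw [choi_apply, Matrix.sum_apply]
  rfl

lemma choi_isHermitian (hb : IsFrame S b) (htr : ∀ p ∈ S, (p.1ᵀ, p.2ᵀ) ∈ S) :
    (choi b).IsHermitian := by
  ext ⟨x, u⟩ ⟨y, v⟩
  have := hb.sum_adjoint (fun k => htr _ (hb.mem k)) (fun k => htr _ (hb.mem k)) (fun k l => by
    simp only [hsInner, Matrix.transpose_apply]
    exact Finset.sum_comm) x y v u
  simp only [Matrix.transpose_apply] at this
  rw [Matrix.conjTranspose_apply, star_trivial, choi_apply, choi_apply, this]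

open scoped Kronecker in
-- Closure of `S` under products and transposes gives K² = D K for the Choi matrix K, with D = 1 ⊗ C
-- and C the sum of the `(b k).2 * (b k).2ᵀ`. As K is symmetric and D is positive definite, this
-- forces K = K D⁻¹ K.
lemma choi_posSemidef [DecidableEq α] [DecidableEq β] (hb : IsFrame S b)
    (htr : ∀ p ∈ S, (p.1ᵀ, p.2ᵀ) ∈ S)
    (hmul : ∀ p ∈ S, ∀ q ∈ S, p * q ∈ S) (hone : 1 ∈ S) : (choi b).PosSemidef := by
  have hherm := hb.choi_isHermitian htr
  let C : Matrix β β ℝ := ∑ k, (b k).2 * (b k).2ᵀ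
  have hC : C.PosDef := by
    refine Matrix.PosDef.of_dotProduct_mulVec_pos ?_ fun v hv => ?_
    · simp only [C, Matrix.IsHermitian, Matrix.conjTranspose_eq_transpose_of_trivial,
        Matrix.transpose_sum, Matrix.transpose_mul, Matrix.transpose_transpose]
    have e : star v ⬝ᵥ C *ᵥ v = ∑ k, ((b k).2ᵀ *ᵥ v) ⬝ᵥ ((b k).2ᵀ *ᵥ v) := by
      simp only [C, Matrix.sum_mulVec, dotProduct_sum, star_trivial]
      refine Finset.sum_congr rfl fun k _ => ?_
      rw [← Matrix.mulVec_mulVec, Matrix.dotProduct_mulVec, ← Matrix.mulVec_transpose]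
    rw [e]
    have nn : ∀ k, 0 ≤ ((b k).2ᵀ *ᵥ v) ⬝ᵥ ((b k).2ᵀ *ᵥ v) := fun k =>
      Finset.sum_nonneg fun i _ => mul_self_nonneg _
    refine lt_of_le_of_ne (Finset.sum_nonneg fun k _ => nn k) fun h => hv ?_
    have h₀ := (Finset.sum_eq_zero_iff_of_nonneg fun k _ => nn k).1 h.symm
    have h₁ : ∀ k, (b k).2ᵀ *ᵥ v = 0 := fun k =>
      dotProduct_self_eq_zero.1 (h₀ k (Finset.mem_univ _))
    -- The identity is a combination of the `b k`, so a vector annihilated by every `(b k).2ᵀ` is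
    -- zero.
    have h₂ := congrArg (fun p : Matrix α α ℝ × Matrix β β ℝ => p.2ᵀ *ᵥ v) (hb.expand 1 hone)
    simp only [Prod.snd_sum, Prod.smul_snd, Matrix.transpose_sum, Matrix.transpose_smul,
      Matrix.sum_mulVec, Matrix.smul_mulVec, h₁, smul_zero, Finset.sum_const_zero, Prod.snd_one,
      Matrix.transpose_one, Matrix.one_mulVec] at h₂
    exact h₂.symm
  let D : Matrix (α × β) (α × β) ℝ := (1 : Matrix α α ℝ) ⊗ₖ C
  have hD : D.PosDef := Matrix.PosDef.one.kronecker hC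
  have hsq : choi b * choi b = D * choi b := by
    -- Left multiplication by `b k` has left multiplication by its transpose as adjoint, and
    -- `sum_adjoint` moves it to the right factor.
    have key : ∀ k, ∑ l, ((b k).1 * (b l).1) ⊗ₖ (b l).2 =
        ∑ l, (b l).1 ⊗ₖ ((b k).2ᵀ * (b l).2) := by
      intro k
      ext ⟨x, w⟩ ⟨y, v⟩
      rw [Matrix.sum_apply, Matrix.sum_apply]
      exact hb.sum_adjoint (c := fun l => b k * b l) (d := fun l => ((b k).1ᵀ, (b k).2ᵀ) * b l)
        (fun l => hmul _ (hb.mem k) _ (hb.mem l))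
        (fun l => hmul _ (htr _ (hb.mem k)) _ (hb.mem l)) (fun l l' => by
          simp only [hsInner_eq_trace, Prod.fst_mul, Matrix.transpose_mul,
            Matrix.transpose_transpose]
          rw [Matrix.mul_assoc, Matrix.trace_mul_comm, Matrix.mul_assoc]) x y w v
    have key' : ∀ k, ∑ l, ((b k).1 * (b l).1) ⊗ₖ ((b k).2 * (b l).2) =
        ∑ l, (b l).1 ⊗ₖ ((b k).2 * (b k).2ᵀ * (b l).2) := by
      intro k
      have := congrArg (fun Z => ((1 : Matrix α α ℝ) ⊗ₖ (b k).2) * Z) (key k)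
      simpa only [Finset.mul_sum, ← Matrix.mul_kronecker_mul, Matrix.one_mul,
        ← Matrix.mul_assoc] using this
    rw [choi_eq_sum, Finset.sum_mul_sum]
    simp only [← Matrix.mul_kronecker_mul, key']
    simp only [D, C, Finset.mul_sum, ← Matrix.mul_kronecker_mul, Matrix.one_mul, Finset.sum_mul]
    rw [Finset.sum_comm]
    refine Finset.sum_congr rfl fun l _ => ?_
    ext ⟨x, u⟩ ⟨y, v⟩
    simp only [Matrix.sum_apply, Matrix.kroneckerMap_apply, Finset.mul_sum]
  have hcomm : D * choi b = choi b * D := by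
    have := congrArg Matrix.conjTranspose hsq
    rw [Matrix.conjTranspose_mul, Matrix.conjTranspose_mul, hherm.eq, hD.isHermitian.eq] at this
    rw [← hsq, this]
  have hdet : IsUnit D.det := (Matrix.isUnit_iff_isUnit_det D).1 hD.isUnit
  have hfin : choi b = (choi b)ᴴ * D⁻¹ * choi b := by
    rw [hherm.eq]
    have e : choi b * D⁻¹ = D⁻¹ * choi b := by
      calc choi b * D⁻¹ = D⁻¹ * (D * choi b) * D⁻¹ := by
            rw [← Matrix.mul_assoc, Matrix.nonsing_inv_mul _ hdet, Matrix.one_mul]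
        _ = D⁻¹ * choi b := by
            rw [hcomm, Matrix.mul_assoc, Matrix.mul_assoc, Matrix.mul_nonsing_inv _ hdet,
              Matrix.mul_one]
    rw [e, Matrix.mul_assoc, hsq, ← Matrix.mul_assoc, Matrix.nonsing_inv_mul _ hdet,
      Matrix.one_mul]
  rw [hfin]
  exact hD.inv.posSemidef.conjTranspose_mul_mul_same _

end IsFrame

end frame

/-! ### From homomorphism counts to isomorphism matrices -/

section realTensor

variable {V W : Type*} {t : ℕ}

/-- The homomorphism tensor as a real matrix. -/
noncomputable def BiGraph.realTensor (F : BiGraph t) (G : SimpleGraph V) :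
    Matrix (Fin t → V) (Fin t → V) ℝ :=
  Matrix.of fun x y => (Nat.card (F.LabelledHom G x y) : ℝ)

/-- The action of the symmetric group on real tensors. -/
def permRealTensor (σ : Equiv.Perm (Fin t ⊕ Fin t)) :
    Matrix (Fin t → V) (Fin t → V) ℝ →ₗ[ℝ] Matrix (Fin t → V) (Fin t → V) ℝ where
  toFun A := Matrix.of fun u v =>
    A (fun i => Sum.elim u v (σ⁻¹ (Sum.inl i))) (fun i => Sum.elim u v (σ⁻¹ (Sum.inr i)))
  map_add' _ _ := rfl
  map_smul' _ _ := rfl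

lemma permRealTensor_apply (σ : Equiv.Perm (Fin t ⊕ Fin t))
    (A : Matrix (Fin t → V) (Fin t → V) ℝ) (w : Fin t ⊕ Fin t → V) :
    permRealTensor σ A (fun i => w (Sum.inl i)) (fun i => w (Sum.inr i)) =
      A (fun i => (w ∘ ⇑σ⁻¹) (Sum.inl i)) (fun i => (w ∘ ⇑σ⁻¹) (Sum.inr i)) := by
  have e : Sum.elim (fun i => w (Sum.inl i)) (fun i => w (Sum.inr i)) = w :=
    Sum.elim_comp_inl_inr w
  change A (fun i => Sum.elim _ _ (σ⁻¹ (Sum.inl i))) (fun i => Sum.elim _ _ (σ⁻¹ (Sum.inr i))) = _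
  rw [e]
  rfl

namespace BiGraph

lemma tensor_eq_map (F : BiGraph t) (G : SimpleGraph V) :
    F.tensor G = (F.realTensor G).map Complex.ofRealHom := by
  ext x y
  simp [tensor_apply, realTensor]

lemma eq_of_map_ofReal_eq {α : Type*} {X Y : Matrix α α ℝ}
    (h : X.map Complex.ofRealHom = Y.map Complex.ofRealHom) : X = Y :=
  Matrix.map_injective Complex.ofReal_injective h

lemma realTensor_parallel (F F' : BiGraph t) (G : SimpleGraph V) :
    (F.parallel F').realTensor G = F.realTensor G ⊙ F'.realTensor G := by
  apply eq_of_map_ofReal_eq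
  rw [← tensor_eq_map, tensor_parallel, tensor_eq_map, tensor_eq_map]
  ext x y
  simp

lemma realTensor_series [Fintype V] (F F' : BiGraph t) (G : SimpleGraph V) :
    (F.series F').realTensor G = F.realTensor G * F'.realTensor G := by
  apply eq_of_map_ofReal_eq
  rw [← tensor_eq_map, tensor_series, tensor_eq_map, tensor_eq_map, Matrix.map_mul]

lemma realTensor_permute (F : BiGraph t) (σ : Equiv.Perm (Fin t ⊕ Fin t)) (G : SimpleGraph V) :
    (F.permute σ).realTensor G = permRealTensor σ (F.realTensor G) := by
  apply eq_of_map_ofReal_eq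
  rw [← tensor_eq_map, tensor_permute, tensor_eq_map]
  rfl

lemma sum_realTensor [Fintype V] (F : BiGraph t) (G : SimpleGraph V) :
    ∑ x, ∑ y, F.realTensor G x y = F.graph.homCount G := by
  have := F.sum_tensor G
  rw [tensor_eq_map] at this
  simp only [Matrix.map_apply, Complex.ofRealHom_eq_coe] at this
  exact_mod_cast this

lemma realTensor_idGraph [DecidableEq V] (G : SimpleGraph V) :
    (idGraph t).realTensor G = 1 := by
  apply eq_of_map_ofReal_eq
  rw [← tensor_eq_map, tensor_idGraph]
  simp

lemma realTensor_quotGraph_bot (G : SimpleGraph V) (x y : Fin t → V) :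
    (quotGraph (t := t) fun _ _ => False).realTensor G x y = 1 := by
  have := congrFun (congrFun (tensor_quotGraph_bot (t := t) G) x) y
  rw [tensor_eq_map] at this
  simp only [Matrix.map_apply, Complex.ofRealHom_eq_coe, allOnes, Matrix.of_apply] at this
  exact_mod_cast this

end BiGraph

/-- The span of the pairs of homomorphism tensors. -/
def tensorSpan (t : ℕ) (G : SimpleGraph V) (H : SimpleGraph W) :
    Submodule ℝ (Matrix (Fin t → V) (Fin t → V) ℝ × Matrix (Fin t → W) (Fin t → W) ℝ) :=
  Submodule.span ℝ {p | ∃ F, BiL t F ∧ p = (F.realTensor G, F.realTensor H)}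

variable {G : SimpleGraph V} {H : SimpleGraph W}

lemma BiL.mem_tensorSpan {F : BiGraph t} (hF : BiL t F) :
    (F.realTensor G, F.realTensor H) ∈ tensorSpan t G H :=
  Submodule.subset_span ⟨F, hF, rfl⟩

lemma perm_mem_tensorSpan (σ : Equiv.Perm (Fin t ⊕ Fin t))
    {p : Matrix (Fin t → V) (Fin t → V) ℝ × Matrix (Fin t → W) (Fin t → W) ℝ}
    (hp : p ∈ tensorSpan t G H) :
    (permRealTensor σ p.1, permRealTensor σ p.2) ∈ tensorSpan t G H := by
  induction hp using Submodule.span_induction with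
  | mem p hp =>
    obtain ⟨F, hF, rfl⟩ := hp
    rw [← BiGraph.realTensor_permute, ← BiGraph.realTensor_permute]
    exact (hF.permute _ σ).mem_tensorSpan
  | zero => exact zero_mem _
  | add p q _ _ hp hq => exact add_mem hp hq
  | smul c p _ hp => exact Submodule.smul_mem _ c hp

/-- Transposition is the label permutation that exchanges in-labels and out-labels. -/
lemma transpose_mem_tensorSpan
    {p : Matrix (Fin t → V) (Fin t → V) ℝ × Matrix (Fin t → W) (Fin t → W) ℝ}
    (hp : p ∈ tensorSpan t G H) : (p.1ᵀ, p.2ᵀ) ∈ tensorSpan t G H :=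
  perm_mem_tensorSpan (Equiv.sumComm _ _) hp

lemma hadamard_mem_tensorSpan {A : BiGraph t} (hA : A.IsAtomic)
    {p : Matrix (Fin t → V) (Fin t → V) ℝ × Matrix (Fin t → W) (Fin t → W) ℝ}
    (hp : p ∈ tensorSpan t G H) :
    (A.realTensor G ⊙ p.1, A.realTensor H ⊙ p.2) ∈ tensorSpan t G H := by
  induction hp using Submodule.span_induction with
  | mem p hp =>
    obtain ⟨F, hF, rfl⟩ := hp
    rw [← BiGraph.realTensor_parallel, ← BiGraph.realTensor_parallel]
    exact (hF.parallel A _ hA).mem_tensorSpan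
  | zero =>
    convert zero_mem (tensorSpan t G H) using 1
    simp
  | add p q _ _ hp hq =>
    convert add_mem hp hq using 1
    simp [Matrix.hadamard_add]
  | smul c p _ hp =>
    convert Submodule.smul_mem _ c hp using 1
    simp [Matrix.hadamard_smul]

lemma one_mem_tensorSpan [DecidableEq V] [DecidableEq W] : 1 ∈ tensorSpan t G H := by
  have := (BiL.atomic (idGraph t) isAtomic_idGraph).mem_tensorSpan (G := G) (H := H)
  rwa [BiGraph.realTensor_idGraph, BiGraph.realTensor_idGraph] at this

variable [Fintype V] [Fintype W]

lemma mul_mem_tensorSpan {p q : Matrix (Fin t → V) (Fin t → V) ℝ × Matrix (Fin t → W) (Fin t → W) ℝ}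
    (hp : p ∈ tensorSpan t G H) (hq : q ∈ tensorSpan t G H) : p * q ∈ tensorSpan t G H := by
  classical
  have h := Submodule.mul_mem_mul hp hq
  rw [tensorSpan, Submodule.span_mul_span] at h
  refine Submodule.span_mono ?_ h
  rintro _ ⟨_, ⟨F, hF, rfl⟩, _, ⟨F', hF', rfl⟩, rfl⟩
  refine ⟨_, hF.series _ _ hF', ?_⟩
  rw [BiGraph.realTensor_series, BiGraph.realTensor_series]
  rfl

lemma hsInner_permRealTensor {V : Type*} [Fintype V] (σ : Equiv.Perm (Fin t ⊕ Fin t))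
    (X Y : Matrix (Fin t → V) (Fin t → V) ℝ) :
    hsInner (permRealTensor σ X) Y = hsInner X (permRealTensor σ⁻¹ Y) := by
  rw [hsInner, hsInner, ← sum_sumArrow, ← sum_sumArrow]
  refine Fintype.sum_equiv (σ.arrowCongr (Equiv.refl V)) _ _ fun g => ?_
  rw [permRealTensor_apply]
  change X _ _ * _ = X _ _ * permRealTensor σ⁻¹ Y (fun i => (g ∘ ⇑σ⁻¹) (Sum.inl i))
    (fun i => (g ∘ ⇑σ⁻¹) (Sum.inr i))
  rw [permRealTensor_apply]
  simp

variable [DecidableEq V] [DecidableEq W]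

lemma trace_eq_sum_one_hadamard {α : Type*} [Fintype α] [DecidableEq α] (X : Matrix α α ℝ) :
    X.trace = ∑ i, ∑ j, ((1 : Matrix α α ℝ) ⊙ X) i j := by
  simp [Matrix.trace, Matrix.hadamard_apply, Matrix.one_apply]

/-- The trace is the sum of the entries of the Schur product with the identity. The identity is an
atomic tensor, so for a generated graph the trace counts homomorphisms from a graph in `LClass t`.
-/
lemma HomIndistinguishable.trace_eq (h : HomIndistinguishable (LClass t) G H)
    {p : Matrix (Fin t → V) (Fin t → V) ℝ × Matrix (Fin t → W) (Fin t → W) ℝ}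
    (hp : p ∈ tensorSpan t G H) : p.1.trace = p.2.trace := by
  induction hp using Submodule.span_induction with
  | mem p hp =>
    obtain ⟨F, hF, rfl⟩ := hp
    simp only [trace_eq_sum_one_hadamard]
    rw [← BiGraph.realTensor_idGraph G, ← BiGraph.realTensor_idGraph H,
      ← BiGraph.realTensor_parallel, ← BiGraph.realTensor_parallel, BiGraph.sum_realTensor,
      BiGraph.sum_realTensor]
    exact congrArg _ (h _ (Or.inr ⟨_, hF.parallel _ _ isAtomic_idGraph, Equiv.refl _,
      fun _ _ => Iff.rfl⟩))
  | zero => simp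
  | add p q _ _ hp hq => simp [hp, hq]
  | smul c p _ hp => simp [hp]

lemma HomIndistinguishable.hsInner_eq (h : HomIndistinguishable (LClass t) G H)
    {p q : Matrix (Fin t → V) (Fin t → V) ℝ × Matrix (Fin t → W) (Fin t → W) ℝ}
    (hp : p ∈ tensorSpan t G H) (hq : q ∈ tensorSpan t G H) :
    hsInner p.1 q.1 = hsInner p.2 q.2 := by
  rw [hsInner_eq_trace, hsInner_eq_trace]
  exact h.trace_eq (mul_mem_tensorSpan hp (transpose_mem_tensorSpan hq))

/-- Equal inner products make the passage from tensors for G to tensors for H an isometry, whose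
Choi matrix is taken. Schur multiplication by an atomic tensor is self-adjoint and the adjoint of a
label permutation is its inverse, so `sum_adjoint` yields the zero pattern and the symmetry. The
sums come from expanding the all-ones pair. -/
theorem HomIndistinguishable.exists_isWeakIsoMatrix (h : HomIndistinguishable (LClass t) G H) :
    ∃ M : Matrix (Fin t → V × W) (Fin t → V × W) ℝ, IsWeakIsoMatrix t G H M := by
  obtain ⟨n, b, hb⟩ := exists_isFrame (tensorSpan t G H) fun p hp q hq => h.hsInner_eq hp hq
  have hK : ∀ g h, pairEntry (zipMatrix (IsFrame.choi b)) g h =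
      ∑ k, (b k).1 (fun i => g (Sum.inl i)) (fun i => g (Sum.inr i)) *
        (b k).2 (fun i => h (Sum.inl i)) (fun i => h (Sum.inr i)) := fun g h => rfl
  let Q : BiGraph t := quotGraph fun _ _ => False
  have hQ : (Q.realTensor G, Q.realTensor H) ∈ tensorSpan t G H :=
    (BiL.atomic Q (isAtomic_quotGraph _)).mem_tensorSpan
  refine ⟨zipMatrix (IsFrame.choi b), (hb.choi_posSemidef (fun p hp => transpose_mem_tensorSpan hp)
    (fun p hp q hq => mul_mem_tensorSpan hp hq) one_mem_tensorSpan).submatrix _,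
    fun g => ?_, fun h => ?_, fun g h hgh => ?_, fun σ g h => ?_⟩
  · have e := hb.expand_left hQ (fun i => g (Sum.inl i)) (fun i => g (Sum.inr i))
    -- Summing over `h` produces inner products of right components with J, whereas the expansion
    -- has left components; the isometry exchanges them.
    simp only [hb.iso _ (hb.mem _) _ hQ] at e
    simp only [Q, BiGraph.realTensor_quotGraph_bot] at e
    simp only [hK]
    rw [← e, Finset.sum_comm]
    refine Finset.sum_congr rfl fun k _ => ?_
    rw [← Finset.mul_sum, sum_sumArrow (b k).2, mul_comm]
    simp only [hsInner, BiGraph.realTensor_quotGraph_bot, mul_one]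
  · have e := hb.expand_right hQ (fun i => h (Sum.inl i)) (fun i => h (Sum.inr i))
    simp only [Q, BiGraph.realTensor_quotGraph_bot] at e
    simp only [hK]
    rw [← e, Finset.sum_comm]
    refine Finset.sum_congr rfl fun k _ => ?_
    rw [← Finset.sum_mul, sum_sumArrow (b k).1]
    simp only [hsInner, BiGraph.realTensor_quotGraph_bot, mul_one]
  · by_contra hne
    refine hgh (sameType_of_tensor_eq fun A hA => ?_)
    have := hb.sum_adjoint (fun k => hadamard_mem_tensorSpan hA (hb.mem k))
      (fun k => hadamard_mem_tensorSpan hA (hb.mem k)) (fun k l => by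
        simp only [hsInner, Matrix.hadamard_apply]
        refine Finset.sum_congr rfl fun x _ => Finset.sum_congr rfl fun y _ => ?_
        ring)
      (fun i => g (Sum.inl i)) (fun i => g (Sum.inr i)) (fun i => h (Sum.inl i))
      (fun i => h (Sum.inr i))
    simp only [Matrix.hadamard_apply, mul_assoc, mul_left_comm _ (A.realTensor H _ _),
      ← Finset.mul_sum, ← hK] at this
    rw [BiGraph.tensor_eq_map, BiGraph.tensor_eq_map, Matrix.map_apply, Matrix.map_apply,
      mul_right_cancel₀ hne this]
  · have := hb.sum_adjoint (fun k => perm_mem_tensorSpan σ (hb.mem k))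
      (fun k => perm_mem_tensorSpan σ⁻¹ (hb.mem k)) (fun k l => hsInner_permRealTensor σ _ _)
      (fun i => (g ∘ σ) (Sum.inl i)) (fun i => (g ∘ σ) (Sum.inr i)) (fun i => h (Sum.inl i))
      (fun i => h (Sum.inr i))
    simp only [permRealTensor_apply] at this
    rw [hK, hK]
    simpa using this

end realTensor

/-! ### The Lasserre relaxation -/

section lasserre

/-- Positive semidefiniteness extends the summation conditions by one level. -/
lemma sum_union_eq_of_posSemidef {P κ : Type*} [DecidableEq P] [Finite P] [Fintype κ] {t : ℕ}
    (ht : 1 ≤ t) (y : Finset P → ℝ)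
    (hpsd : (Matrix.of fun I J : {I : Finset P // I.card ≤ t} => y (I.1 ∪ J.1)).PosSemidef)
    (p : κ → P) (hsum : ∀ I : Finset P, I.card + 2 ≤ 2 * t → ∑ k, y (I ∪ {p k}) = y I)
    (hzero : ∀ I : Finset P, I.card + 2 ≤ 2 * t → ∀ k l, k ≠ l → y (I ∪ {p k, p l}) = 0)
    (I : Finset P) (hI : I.card + 1 ≤ 2 * t) : ∑ k, y (I ∪ {p k}) = y I := by
  classical
  have := Fintype.ofFinite P
  -- With min (t - 1) |I| elements, `A` leaves room for one more pair in a row index, while `I \ A`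
  -- still has at most `t` elements.
  obtain ⟨A, hAI, hA⟩ := Finset.exists_subset_card_eq (min_le_right (t - 1) I.card)
  have hA₁ : A.card + 1 ≤ t := by omega
  have hA₂ : A.card + 2 ≤ 2 * t := by omega
  have hB : (I \ A).card ≤ t := by
    rw [Finset.card_sdiff_of_subset hAI]
    omega
  have hAB : (I \ A) ∪ A = I := Finset.sdiff_union_of_subset hAI
  have hcard : ∀ k, (A ∪ {p k}).card ≤ t := fun k =>
    (Finset.card_union_le _ _).trans (by simpa using hA₁)
  let K : κ → {I : Finset P // I.card ≤ t} := fun k => ⟨A ∪ {p k}, hcard k⟩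
  let A' : {I : Finset P // I.card ≤ t} := ⟨A, by omega⟩
  -- `v` expresses the summation condition at `A`. Its quadratic form vanishes by the given
  -- conditions, so it lies in the kernel, and the row `I \ A` of the kernel equation is the
  -- condition at `I`.
  let v : {I : Finset P // I.card ≤ t} → ℝ := fun J =>
    (∑ k, if J = K k then 1 else 0) - if J = A' then 1 else 0
  have hv : ∀ f : {I : Finset P // I.card ≤ t} → ℝ, ∑ J, v J * f J = ∑ k, f (K k) - f A' := by
    intro f
    simp only [v, sub_mul, Finset.sum_sub_distrib, Finset.sum_mul, ite_mul, one_mul, zero_mul,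
      Finset.sum_ite_eq', Finset.mem_univ, if_true]
    rw [Finset.sum_comm]
    simp
  set Y := Matrix.of fun I J : {I : Finset P // I.card ≤ t} => y (I.1 ∪ J.1) with hY
  have hYv : ∀ J, (Y *ᵥ v) J = ∑ k, Y J (K k) - Y J A' := by
    intro J
    rw [← hv, Matrix.mulVec, dotProduct]
    exact Finset.sum_congr rfl fun _ _ => mul_comm _ _
  have hKK : ∀ k, ∑ l, Y (K k) (K l) = y (A ∪ {p k}) := by
    intro k
    have e : ∀ l, Y (K k) (K l) = y (A ∪ {p k, p l}) := by
      intro l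
      simp only [Y, K, Matrix.of_apply]
      congr 1
      ext; simp; tauto
    simp only [e]
    rw [Finset.sum_eq_single k (fun l _ h => hzero A hA₂ k l h.symm) (by simp)]
    simp
  have hKA : ∀ k, Y (K k) A' = y (A ∪ {p k}) := by
    intro k
    simp only [Y, K, A', Matrix.of_apply]
    congr 1
    ext; simp
  have hAK : ∀ k, Y A' (K k) = y (A ∪ {p k}) := by
    intro k
    simp only [Y, K, A', Matrix.of_apply]
    congr 1
    ext; simp
  have hAA : Y A' A' = y A := by simp [Y, A']
  have hquad : star v ⬝ᵥ Y *ᵥ v = 0 := by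
    simp only [dotProduct, Pi.star_apply, star_trivial]
    rw [hv]
    simp only [hYv, hKK, hKA, hAK, hAA, sub_self, Finset.sum_const_zero, hsum A hA₂]
  have := congrFun ((hpsd.dotProduct_mulVec_zero_iff _).1 hquad) ⟨I \ A, hB⟩
  rw [hYv, Pi.zero_apply, sub_eq_zero] at this
  simp only [Y, K, A', Matrix.of_apply, ← Finset.union_assoc, hAB] at this
  exact this

/-- The entries are summed out one at a time; the set of the remaining ones always has fewer than
`N` elements. -/
lemma sum_image_eq_of_sum_union {P κ : Type*} [DecidableEq P] [Fintype κ] {N : ℕ}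
    (y : Finset P → ℝ) {n : ℕ} (hn : n ≤ N) (p : Fin n → κ → P)
    (hsum : ∀ i, ∀ I : Finset P, I.card + 1 ≤ N → ∑ k, y (I ∪ {p i k}) = y I) :
    ∑ h : Fin n → κ, y (Finset.univ.image fun i => p i (h i)) = y ∅ := by
  induction n with
  | zero => simp
  | succ n ih =>
    rw [← (Fin.consEquiv fun _ => κ).sum_comp, Fintype.sum_prod_type, Finset.sum_comm,
      ← ih (by omega) (fun i => p i.succ) fun i => hsum i.succ]
    refine Finset.sum_congr rfl fun h _ => ?_
    rw [← hsum 0 _ (le_trans (Nat.succ_le_succ Finset.card_image_le) (by simpa using hn))]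
    refine Finset.sum_congr rfl fun k _ => ?_
    congr 1
    ext x
    simp [Fin.consEquiv, Fin.exists_fin_succ, eq_comm]

lemma sum_image_eq_one {P κ ι : Type*} [DecidableEq P] [Fintype κ] [Fintype ι] [DecidableEq ι]
    {N : ℕ} (hι : Fintype.card ι ≤ N) (y : Finset P → ℝ) (p : ι → κ → P)
    (hsum : ∀ i, ∀ I : Finset P, I.card + 1 ≤ N → ∑ k, y (I ∪ {p i k}) = y I) :
    ∑ h : ι → κ, y (Finset.univ.image fun i => p i (h i)) = y ∅ := by
  let e := Fintype.equivFin ι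
  rw [← sum_image_eq_of_sum_union y hι (fun i => p (e.symm i)) fun i => hsum _]
  refine Fintype.sum_equiv (e.arrowCongr (Equiv.refl κ)) _ _ fun h => ?_
  congr 1
  ext x
  simp only [Finset.mem_image, Finset.mem_univ, true_and]
  refine e.symm.surjective.exists.trans (exists_congr fun i => ?_)
  rfl

variable {V W : Type*} [Fintype V] [Fintype W] [DecidableEq V] [DecidableEq W] {t : ℕ}
  {G : SimpleGraph V} {H : SimpleGraph W}

/-- Summing out all `2 * t` pairs requires the summation conditions for sets of size up to `2 * t -
1`, one more than the relaxation imposes. -/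
theorem LasserreFeasible.sPlusIsomorphic (ht : 1 ≤ t) (h : LasserreFeasible t G H) :
    SPlusIsomorphic t G H := by
  obtain ⟨y, hy⟩ := h
  have hr : ∀ g : V, ∀ I : Finset (V × W), I.card + 1 ≤ 2 * t → ∑ h : W, y (I ∪ {(g, h)}) = y I := by
    intro g
    refine sum_union_eq_of_posSemidef ht y hy.psd _ (fun I hI => hy.sum_right I hI g)
      fun I hI k l hkl => hy.zero _ ((Finset.card_union_le _ _).trans ?_) fun hp => ?_
    · exact (Nat.add_le_add_left Finset.card_le_two _).trans hI
    · exact hkl ((hp (g, k) (by simp) (g, l) (by simp)).1.1 rfl)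
  have hl : ∀ h : W, ∀ I : Finset (V × W), I.card + 1 ≤ 2 * t → ∑ g : V, y (I ∪ {(g, h)}) = y I := by
    intro h
    refine sum_union_eq_of_posSemidef ht y hy.psd _ (fun I hI => hy.sum_left I hI h)
      fun I hI k l hkl => hy.zero _ ((Finset.card_union_le _ _).trans ?_) fun hp => ?_
    · exact (Nat.add_le_add_left Finset.card_le_two _).trans hI
    · exact hkl ((hp (k, h) (by simp) (l, h) (by simp)).1.2 rfl)
  let M : Matrix (Fin t → V × W) (Fin t → V × W) ℝ :=
    Matrix.of fun p q => y (Finset.univ.image p ∪ Finset.univ.image q)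
  have hM : ∀ g h, pairEntry M g h = y (Finset.univ.image fun i => (g i, h i)) := by
    intro g h
    simp only [pairEntry, M, Matrix.of_apply]
    congr 1
    ext x
    simp
  have hcard : Fintype.card (Fin t ⊕ Fin t) ≤ 2 * t := by
    simp only [Fintype.card_sum, Fintype.card_fin]
    omega
  refine ⟨M, IsWeakIsoMatrix.isSPlusIsoMatrix ⟨?_, fun g => ?_, fun h => ?_, fun g h hgh => ?_,
    fun σ g h => ?_⟩⟩
  · exact hy.psd.submatrix fun p : Fin t → V × W =>
      ⟨Finset.univ.image p, Finset.card_image_le.trans (by simp)⟩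
  · simp only [hM]
    rw [sum_image_eq_one hcard y (fun i k => (g i, k)) fun i => hr (g i), hy.one]
  · simp only [hM]
    rw [sum_image_eq_one hcard y (fun i k => (k, h i)) fun i => hl (h i), hy.one]
  · rw [hM]
    refine hy.zero _ (Finset.card_image_le.trans (by simpa using hcard)) fun hp => hgh fun i j => ?_
    exact hp (g i, h i) (Finset.mem_image_of_mem _ (Finset.mem_univ _)) (g j, h j)
      (Finset.mem_image_of_mem _ (Finset.mem_univ _))
  · rw [hM, hM]
    congr 1
    ext x
    simp only [Finset.mem_image, Finset.mem_univ, true_and]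
    exact σ.surjective.exists

/-- A function of tuples that is symmetric and does not depend on which entry is repeated depends
only on the set of entries. -/
lemma eq_of_range_eq {ι P R : Type*} [Fintype ι] [DecidableEq ι] (f : (ι → P) → R)
    (hperm : ∀ (σ : Equiv.Perm ι) p, f (p ∘ σ) = f p)
    (hdup : ∀ p i j k, j ≠ i → k ≠ i →
      f (Function.update p i (p j)) = f (Function.update p i (p k))) {p q : ι → P}
    (h : Set.range p = Set.range q) : f p = f q := by
  classical
  let D (p q : ι → P) : ℕ := (Finset.univ.filter fun i => p i ≠ q i).card
  have hD : ∀ p q, D p q = D q p := fun p q => by simp only [D, ne_comm]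
  -- A repeated entry of `p` can be overwritten with the desired `q i`, which occurs elsewhere in
  -- `p`. This reduces the number of disagreements and keeps both the range and the value of `f`.
  have step : ∀ p q : ι → P, Set.range p = Set.range q → ∀ i j, p i ≠ q i → j ≠ i → p j = p i →
      ∃ p', f p' = f p ∧ Set.range p' = Set.range p ∧ D p' q < D p q := by
    intro p q h i j hi hj hji
    obtain ⟨k, hk⟩ : q i ∈ Set.range p := h ▸ ⟨i, rfl⟩
    have hki : k ≠ i := by
      rintro rfl
      exact hi hk
    refine ⟨Function.update p i (q i), ?_, ?_, Finset.card_lt_card ?_⟩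
    · rw [← hk, hdup p i k j hki hj, hji, Function.update_eq_self]
    · ext x
      constructor
      · rintro ⟨l, rfl⟩
        by_cases hl : l = i
        · subst hl
          rw [Function.update_self]
          exact ⟨k, hk⟩
        · rw [Function.update_of_ne hl]
          exact ⟨l, rfl⟩
      · rintro ⟨l, rfl⟩
        by_cases hl : l = i
        · subst hl
          exact ⟨j, by rw [Function.update_of_ne hj, hji]⟩
        · exact ⟨l, Function.update_of_ne hl _ _⟩
    · refine (Finset.ssubset_iff_of_subset fun l hl => ?_).2 ⟨i, by simpa using hi, by simp⟩
      simp only [Finset.mem_filter, Finset.mem_univ, true_and] at hl ⊢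
      by_cases hli : l = i
      · subst hli
        simp at hl
      · rwa [Function.update_of_ne hli] at hl
  suffices ∀ n, ∀ p q : ι → P, D p q = n → Set.range p = Set.range q → f p = f q from
    this _ p q rfl h
  intro n
  induction n using Nat.strong_induction_on with
  | _ n ih =>
    intro p q hn h
    by_cases hpq : p = q
    · rw [hpq]
    obtain ⟨i, hi⟩ := Function.ne_iff.1 hpq
    by_cases hp : ∃ j, j ≠ i ∧ p j = p i
    · obtain ⟨j, hj, hji⟩ := hp
      obtain ⟨p', hf, hr, hlt⟩ := step p q h i j hi hj hji
      rw [← hf]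
      exact ih _ (hn ▸ hlt) p' q rfl (hr.trans h)
    by_cases hq : ∃ j, j ≠ i ∧ q j = q i
    · obtain ⟨j, hj, hji⟩ := hq
      obtain ⟨q', hf, hr, hlt⟩ := step q p h.symm i j (Ne.symm hi) hj hji
      rw [← hf]
      refine ih _ ?_ p q' rfl (h.trans hr.symm)
      rwa [hD p q', ← hn, hD p q]
    -- No entry can be overwritten at `i`, so `q i` is swapped into place from position `k`.
    -- Position `k` was already wrong, since otherwise `q i` would be repeated in `q`; hence no
    -- disagreement is created.
    obtain ⟨k, hk⟩ : q i ∈ Set.range p := h ▸ ⟨i, rfl⟩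
    have hki : k ≠ i := by
      rintro rfl
      exact hi hk
    have hqk : p k ≠ q k := fun e => hq ⟨k, hki, by rw [← e, hk]⟩
    rw [← hperm (Equiv.swap i k) p]
    refine ih _ ?_ _ q rfl ((EquivLike.range_comp p _).trans h)
    rw [← hn]
    refine Finset.card_lt_card ((Finset.ssubset_iff_of_subset fun l hl => ?_).2
      ⟨i, by simpa using hi, by simp [hk]⟩)
    simp only [Finset.mem_filter, Finset.mem_univ, true_and, Function.comp_apply] at hl ⊢
    by_cases hli : l = i
    · subst hli
      exact hi
    by_cases hlk : l = k
    · subst hlk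
      exact hqk
    rwa [Equiv.swap_apply_of_ne_of_ne hli hlk] at hl

lemma exists_range_eq {ι P : Type*} [Fintype ι] {I : Finset P} (hI : I.Nonempty)
    (hcard : I.card ≤ Fintype.card ι) : ∃ p : ι → P, Set.range p = I := by
  have : Nonempty I := hI.to_subtype
  obtain ⟨e⟩ := Function.Embedding.nonempty_of_card_le (α := I) (β := ι) (by simpa using hcard)
  refine ⟨Subtype.val ∘ Function.invFun e, ?_⟩
  rw [Set.range_comp, (Function.invFun_surjective e.injective).range_eq]
  simp

lemma exists_range_eq_and_repeated {ι P : Type*} [Fintype ι] {I : Finset P} (hI : I.Nonempty)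
    (hcard : I.card < Fintype.card ι) :
    ∃ p : ι → P, Set.range p = I ∧ ∃ i j, j ≠ i ∧ p j = p i := by
  classical
  obtain ⟨p, hp⟩ := exists_range_eq hI hcard.le
  refine ⟨p, hp, ?_⟩
  by_contra! hne
  have hinj : Function.Injective p := fun a b hab => by
    by_contra h
    exact hne b a h hab
  have : Finset.univ.image p = I := by
    rw [← Finset.coe_inj, ← hp]
    simp
  rw [← this, Finset.card_image_of_injective _ hinj, Finset.card_univ] at hcard
  exact lt_irrefl _ hcard

end lasserre

/-! ### From isomorphism matrices to Lasserre solutions -/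

section toLasserre

variable {V W : Type*} {t : ℕ}

/-- The entry of `M` at a tuple of `2t` pairs. -/
def tupleEntry (M : Matrix (Fin t → V × W) (Fin t → V × W) ℝ) (p : Fin t ⊕ Fin t → V × W) : ℝ :=
  pairEntry M (Prod.fst ∘ p) (Prod.snd ∘ p)

lemma tupleEntry_elim (M : Matrix (Fin t → V × W) (Fin t → V × W) ℝ) (p q : Fin t → V × W) :
    tupleEntry M (Sum.elim p q) = M p q := rfl

open Classical in
/-- The common entry of `M` at the tuples of pairs whose set of entries is `I`. -/
noncomputable def lasserreValue (M : Matrix (Fin t → V × W) (Fin t → V × W) ℝ)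
    (I : Finset (V × W)) : ℝ :=
  -- For positive `t`, the default 1 is the required value at the empty set. Otherwise it occurs
  -- only at sets of more than `2 * t` pairs, which no constraint involves.
  if h : ∃ p : Fin t ⊕ Fin t → V × W, Set.range p = I then tupleEntry M h.choose else 1

lemma lasserreValue_empty (ht : 1 ≤ t) (M : Matrix (Fin t → V × W) (Fin t → V × W) ℝ) :
    lasserreValue M ∅ = 1 := by
  rw [lasserreValue, dif_neg]
  rintro ⟨p, hp⟩
  have : p (Sum.inl ⟨0, ht⟩) ∈ Set.range p := ⟨_, rfl⟩
  rw [hp] at this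
  simp at this

lemma range_update_of_repeated {ι P : Type*} [DecidableEq ι] (p : ι → P) {i j : ι} (hj : j ≠ i)
    (hji : p j = p i) (x : P) : Set.range (Function.update p i x) = Set.range p ∪ {x} := by
  ext z
  simp only [Set.mem_range, Set.mem_union, Set.mem_singleton_iff]
  constructor
  · rintro ⟨l, rfl⟩
    by_cases hl : l = i
    · subst hl
      simp
    · exact Or.inl ⟨l, (Function.update_of_ne hl _ _).symm⟩
  · rintro (⟨l, rfl⟩ | rfl)
    · by_cases hl : l = i
      · subst hl
        exact ⟨j, by rw [Function.update_of_ne hj, hji]⟩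
      · exact ⟨l, Function.update_of_ne hl _ _⟩
    · exact ⟨i, Function.update_self _ _ _⟩

variable [Fintype V] [Fintype W] [DecidableEq V] [DecidableEq W]
  {G : SimpleGraph V} {H : SimpleGraph W} {M : Matrix (Fin t → V × W) (Fin t → V × W) ℝ}

namespace IsSPlusIsoMatrix

lemma tupleEntry_comp (hM : IsSPlusIsoMatrix t G H M) (σ : Equiv.Perm (Fin t ⊕ Fin t))
    (p : Fin t ⊕ Fin t → V × W) : tupleEntry M (p ∘ σ) = tupleEntry M p :=
  (hM.symm σ (Prod.fst ∘ p) (Prod.snd ∘ p)).symm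

lemma tupleEntry_eq_zero (hM : IsSPlusIsoMatrix t G H M) {p : Fin t ⊕ Fin t → V × W}
    (i j : Fin t ⊕ Fin t) (hp : ¬ ((p i).1 = (p j).1 ↔ (p i).2 = (p j).2)) :
    tupleEntry M p = 0 :=
  hM.zero _ _ fun h => hp (h i j).1

/-- Position `j` already pairs `(p j).1` with `(p j).2`, so the zero pattern leaves a single term.
-/
lemma sum_update_right (hM : IsSPlusIsoMatrix t G H M) (p : Fin t ⊕ Fin t → V × W)
    {i j : Fin t ⊕ Fin t} (hj : j ≠ i) :
    ∑ b, tupleEntry M (Function.update p i ((p j).1, b)) =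
      tupleEntry M (Function.update p i (p j)) := by
  refine (Finset.sum_eq_single (p j).2 (fun b _ hb => ?_) (by simp)).trans rfl
  refine hM.tupleEntry_eq_zero i j ?_
  rw [Function.update_self, Function.update_of_ne hj]
  simpa using hb

lemma sum_update_left (hM : IsSPlusIsoMatrix t G H M) (p : Fin t ⊕ Fin t → V × W)
    {i j : Fin t ⊕ Fin t} (hj : j ≠ i) :
    ∑ a, tupleEntry M (Function.update p i (a, (p j).2)) =
      tupleEntry M (Function.update p i (p j)) := by
  refine (Finset.sum_eq_single (p j).1 (fun b _ hb => ?_) (by simp)).trans rfl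
  refine hM.tupleEntry_eq_zero i j ?_
  rw [Function.update_self, Function.update_of_ne hj]
  simpa using hb

lemma sum_update_eq_sum_update (hM : IsSPlusIsoMatrix t G H M) (p : Fin t ⊕ Fin t → V × W)
    (i : Fin t ⊕ Fin t) (c : V) (d : W) :
    ∑ b, tupleEntry M (Function.update p i (c, b)) =
      ∑ a, tupleEntry M (Function.update p i (a, d)) := by
  have := hM.sum_eq_sum (Function.update (Prod.fst ∘ p) i c) (Function.update (Prod.snd ∘ p) i d) i
  simp only [Function.update_idem] at this
  simp only [tupleEntry, Function.comp_update]
  exact this.symm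

/-- Both sides are collapsed sums over position `i`, one over W and one over V, and such sums
coincide whatever the fixed coordinates are. This is the `hdup` hypothesis of `eq_of_range_eq`. -/
lemma tupleEntry_update_eq (hM : IsSPlusIsoMatrix t G H M) (p : Fin t ⊕ Fin t → V × W)
    {i j k : Fin t ⊕ Fin t} (hj : j ≠ i) (hk : k ≠ i) :
    tupleEntry M (Function.update p i (p j)) = tupleEntry M (Function.update p i (p k)) := by
  rw [← hM.sum_update_right p hj, ← hM.sum_update_left p hk, hM.sum_update_eq_sum_update]

lemma lasserreValue_eq (hM : IsSPlusIsoMatrix t G H M) {p : Fin t ⊕ Fin t → V × W}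
    {I : Finset (V × W)} (hp : Set.range p = I) : lasserreValue M I = tupleEntry M p := by
  have h : ∃ p : Fin t ⊕ Fin t → V × W, Set.range p = I := ⟨p, hp⟩
  rw [lasserreValue, dif_pos h]
  exact eq_of_range_eq _ hM.tupleEntry_comp (fun p i j k hj hk => hM.tupleEntry_update_eq p hj hk)
    (h.choose_spec.trans hp.symm)

lemma sum_const_right (hM : IsSPlusIsoMatrix t G H M) (ht : 1 ≤ t) (g : V) :
    ∑ w, tupleEntry M (fun _ => (g, w)) = 1 := by
  rw [← hM.sum_right fun _ => g]
  let i : Fin t ⊕ Fin t := Sum.inl ⟨0, ht⟩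
  refine Finset.sum_of_injOn (fun w _ => w) (fun a _ b _ hab => congrFun hab i)
    (by simp) (fun h _ hh => hM.zero _ _ fun hs => hh ⟨h i, by simp, ?_⟩) fun w _ => rfl
  funext k
  exact (hs i k).1.1 rfl

lemma sum_const_left (hM : IsSPlusIsoMatrix t G H M) (ht : 1 ≤ t) (h : W) :
    ∑ v, tupleEntry M (fun _ => (v, h)) = 1 := by
  rw [← hM.sum_left fun _ => h]
  let i : Fin t ⊕ Fin t := Sum.inl ⟨0, ht⟩
  refine Finset.sum_of_injOn (fun w _ => w) (fun a _ b _ hab => congrFun hab i)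
    (by simp) (fun h _ hh => hM.zero _ _ fun hs => hh ⟨h i, by simp, ?_⟩) fun w _ => rfl
  funext k
  exact (hs i k).1.2 rfl

lemma lasserreValue_singleton (hM : IsSPlusIsoMatrix t G H M) (ht : 1 ≤ t) (x : V × W) :
    lasserreValue M {x} = tupleEntry M fun _ => x := by
  have : Nonempty (Fin t ⊕ Fin t) := ⟨Sum.inl ⟨0, ht⟩⟩
  exact hM.lasserreValue_eq (by simp)

/-- Since `I` has fewer than `2 * t` elements, it is listed by a tuple with a repeated position,
which is free to receive the new pair. Marginal equality turns the sum over W into a sum over V with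
one nonzero term. -/
lemma sum_lasserreValue_right (hM : IsSPlusIsoMatrix t G H M) (ht : 1 ≤ t) {I : Finset (V × W)}
    (hI : I.card < 2 * t) (g : V) : ∑ w, lasserreValue M (I ∪ {(g, w)}) = lasserreValue M I := by
  obtain rfl | hne := I.eq_empty_or_nonempty
  · simp only [Finset.empty_union, hM.lasserreValue_singleton ht, lasserreValue_empty ht]
    exact hM.sum_const_right ht g
  obtain ⟨p, hp, i, j, hj, hji⟩ := exists_range_eq_and_repeated (ι := Fin t ⊕ Fin t) hne
    (by simpa [← two_mul] using hI)
  have key : ∀ x, lasserreValue M (I ∪ {x}) = tupleEntry M (Function.update p i x) := fun x =>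
    hM.lasserreValue_eq (by rw [range_update_of_repeated p hj hji, hp]; simp)
  simp only [key]
  rw [hM.sum_update_eq_sum_update p i g (p j).2, hM.sum_update_left p hj, hji,
    Function.update_eq_self, hM.lasserreValue_eq hp]

lemma sum_lasserreValue_left (hM : IsSPlusIsoMatrix t G H M) (ht : 1 ≤ t) {I : Finset (V × W)}
    (hI : I.card < 2 * t) (h : W) : ∑ v, lasserreValue M (I ∪ {(v, h)}) = lasserreValue M I := by
  obtain rfl | hne := I.eq_empty_or_nonempty
  · simp only [Finset.empty_union, hM.lasserreValue_singleton ht, lasserreValue_empty ht]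
    exact hM.sum_const_left ht h
  obtain ⟨p, hp, i, j, hj, hji⟩ := exists_range_eq_and_repeated (ι := Fin t ⊕ Fin t) hne
    (by simpa [← two_mul] using hI)
  have key : ∀ x, lasserreValue M (I ∪ {x}) = tupleEntry M (Function.update p i x) := fun x =>
    hM.lasserreValue_eq (by rw [range_update_of_repeated p hj hji, hp]; simp)
  simp only [key]
  rw [← hM.sum_update_eq_sum_update p i (p j).1, hM.sum_update_right p hj, hji,
    Function.update_eq_self, hM.lasserreValue_eq hp]

/-- Nonempty index sets are represented by rows of `M`, but the empty set is not. By the summation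
condition at a fixed vertex `g₀`, its row is the sum over `w` of the rows of the constant tuples
`(g₀, w)`. -/
lemma posSemidef_lasserreValue (hM : IsSPlusIsoMatrix t G H M) (ht : 1 ≤ t) :
    (Matrix.of fun I J : {I : Finset (V × W) // I.card ≤ t} =>
      lasserreValue M (I.1 ∪ J.1)).PosSemidef := by
  obtain hV | ⟨⟨g₀⟩⟩ := isEmpty_or_nonempty V
  · convert Matrix.posSemidef_vecMulVec_self_star
      (fun _ : {I : Finset (V × W) // I.card ≤ t} => (1 : ℝ)) using 1
    ext I J
    simp [Matrix.vecMulVec_apply, Finset.eq_empty_of_isEmpty, lasserreValue_empty ht]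
  obtain hW | ⟨⟨w₀⟩⟩ := isEmpty_or_nonempty W
  -- An empty sum would equal 1.
  · simpa using hM.sum_const_right ht g₀
  have hx : ∀ K : {I : Finset (V × W) // I.card ≤ t}, ∃ p : Fin t → V × W,
      K.1.Nonempty → Set.range p = K.1 := by
    intro K
    by_cases hK : K.1.Nonempty
    · obtain ⟨p, hp⟩ := exists_range_eq (ι := Fin t) hK (by simpa using K.2)
      exact ⟨p, fun _ => hp⟩
    · exact ⟨fun _ => (g₀, w₀), fun h => absurd h hK⟩
  choose x hx using hx
  let p (s : {I : Finset (V × W) // I.card ≤ t} × W) : Fin t → V × W :=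
    if s.1.1 = ∅ then fun _ => (g₀, s.2) else x s.1
  -- Every index set is replicated over `W` so that `sum_blocks` applies uniformly; for a nonempty
  -- set the weight keeps only the copy at `w₀`.
  let c (s : {I : Finset (V × W) // I.card ≤ t} × W) : ℝ :=
    if s.1.1 = ∅ then 1 else if s.2 = w₀ then 1 else 0
  have hZ := ((hM.psd.submatrix p).mul_mul_conjTranspose_same (Matrix.diagonal c)).sum_blocks
  convert hZ using 1
  have : Nonempty (Fin t) := ⟨⟨0, ht⟩⟩
  have hconst : ∀ w, Set.range (fun _ : Fin t => (g₀, w)) = ↑({(g₀, w)} : Finset (V × W)) := by simp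
  have hMy : ∀ {p q : Fin t → V × W} {I J : Finset (V × W)}, Set.range p = I → Set.range q = J →
      M p q = lasserreValue M (I ∪ J) := by
    intro p q I J hp hq
    rw [hM.lasserreValue_eq (p := Sum.elim p q) (by rw [Set.Sum.elim_range, hp, hq]; simp),
      tupleEntry_elim]
  have hlt : ∀ I : Finset (V × W), I.card ≤ t → I.card < 2 * t := fun I hI => by omega
  ext I J
  simp only [Matrix.of_apply, Matrix.diagonal_conjTranspose, Matrix.mul_diagonal,
    Matrix.diagonal_mul, Matrix.submatrix_apply, star_trivial, p, c]
  by_cases hI : I.1 = ∅ <;> by_cases hJ : J.1 = ∅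
  · simp only [hI, hJ, if_true, one_mul, mul_one, hMy (hconst _) (hconst _)]
    simp only [hM.sum_lasserreValue_right ht (I := {(g₀, _)}) (by simp; omega)]
    have := hM.sum_lasserreValue_right ht (I := ∅) (by simp; omega) g₀
    simpa using this.symm
  · simp only [hI, hJ, if_true, if_false, one_mul, mul_ite, mul_one, mul_zero, Finset.sum_ite_eq',
      Finset.mem_univ, hMy (hconst _) (hx J (Finset.nonempty_iff_ne_empty.2 hJ)),
      Finset.empty_union]
    simp only [Finset.union_comm _ J.1]
    exact (hM.sum_lasserreValue_right ht (hlt _ J.2) g₀).symm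
  · simp only [hI, hJ, if_true, if_false, ite_mul, one_mul, mul_one, zero_mul, Finset.sum_ite_irrel,
      Finset.sum_const_zero, Finset.sum_ite_eq',
      Finset.mem_univ, hMy (hx I (Finset.nonempty_iff_ne_empty.2 hI)) (hconst _),
      Finset.union_empty]
    exact (hM.sum_lasserreValue_right ht (hlt _ I.2) g₀).symm
  · simp [hI, hJ, hMy (hx I (Finset.nonempty_iff_ne_empty.2 hI))
      (hx J (Finset.nonempty_iff_ne_empty.2 hJ))]

theorem lasserreFeasible (hM : IsSPlusIsoMatrix t G H M) (ht : 1 ≤ t) :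
    LasserreFeasible t G H := by
  refine ⟨lasserreValue M, hM.posSemidef_lasserreValue ht,
    fun I hI g => hM.sum_lasserreValue_right ht (by omega) g,
    fun I hI h => hM.sum_lasserreValue_left ht (by omega) h, fun I hI hIp => ?_,
    lasserreValue_empty ht M⟩
  obtain rfl | hne := I.eq_empty_or_nonempty
  · exact absurd (fun p hp => absurd hp (Finset.notMem_empty p)) hIp
  obtain ⟨p, hp⟩ := exists_range_eq (ι := Fin t ⊕ Fin t) hne (by simpa [← two_mul] using hI)
  rw [hM.lasserreValue_eq hp]
  refine hM.zero _ _ fun hs => hIp fun a ha b hb => ?_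
  rw [← Finset.mem_coe, ← hp] at ha hb
  obtain ⟨i, rfl⟩ := ha
  obtain ⟨j, rfl⟩ := hb
  exact hs i j

end IsSPlusIsoMatrix

end toLasserre

/-! ### The main theorem -/

theorem theorem2 (t : ℕ) (ht : 1 ≤ t) :
    MinorClosed (LClass t) ∧
    (∀ F : FGraph, LClass t F → F.TreewidthLE (3 * t - 1)) ∧
    (∀ F : FGraph, LPlusClass t F → F.TreewidthLE (3 * t - 1)) ∧
    ∀ (V W : Type*) [Fintype V] [Fintype W] [DecidableEq V] [DecidableEq W]
      (G : SimpleGraph V) (H : SimpleGraph W),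
      List.TFAE [
        LasserreFeasible t G H,
        SPlusIsomorphic t G H,
        ∃ Φ : Matrix (Fin t → V) (Fin t → V) ℂ →ₗ[ℂ] Matrix (Fin t → W) (Fin t → W) ℂ,
          IsSPlusIsoMap t G H Φ,
        PartiallyEquivalent t G H,
        HomIndistinguishable (LClass t) G H] := by
  refine ⟨minorClosed_LClass ht, fun F hF => hF.lPlusClass.treewidthLE ht,
    fun F hF => hF.treewidthLE ht, ?_⟩
  intro V W _ _ _ _ G H
  -- Condition 2 is the hub: it is equivalent to 1 and to 3, and the cycle 2 → 4 → 5 → 2 covers the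
  -- rest.
  tfae_have 1 → 2 := LasserreFeasible.sPlusIsomorphic ht
  tfae_have 2 → 1 := fun ⟨_, hM⟩ => hM.lasserreFeasible ht
  tfae_have 2 → 3 := fun ⟨_, hM⟩ => ⟨_, hM.weak.isSPlusIsoMap⟩
  tfae_have 3 → 2 := fun ⟨_, hΦ⟩ =>
    let ⟨M, hM⟩ := hΦ.exists_isWeakIsoMatrix
    ⟨M, hM.isSPlusIsoMatrix⟩
  tfae_have 2 → 4 := fun ⟨_, hM⟩ => hM.weak.partiallyEquivalent ht
  tfae_have 4 → 5 := PartiallyEquivalent.homIndistinguishable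
  tfae_have 5 → 2 := fun h =>
    let ⟨M, hM⟩ := h.exists_isWeakIsoMatrix
    ⟨M, hM.isSPlusIsoMatrix⟩
  tfae_finish
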